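/- Let $\sigma(x)=\max(x,0)$ and, for weights $w_r\in\mathbb R^d$, $\tilde w_{rk}\in\mathbb R^q$ and signs $\tilde a_{rk}$ ($1\le r\le m$, $1\le k\le p$, with $m,p\ge 1$), consider the shallow neural operator $$G(u)(y)=\frac1{\sqrt m}\sum_{r=1}^m\Big[\frac1{\sqrt p}\sum_{k=1}^p\tilde a_{rk}\,\sigma(\tilde w_{rk}^{T}u)\Big]\sigma(w_r^{T}y),\qquad u\in\mathbb R^q,\ y\in\mathbb R^d .$$ Let $u_1,\dots,u_{n_1}\in\mathbb R^q$, $y_1,\dots,y_{n_2}\in\mathbb R^d$ and $z=(z^i_j)\in\mathbb R^{n_1n_2}$ be training data ($n_1,n_2\ge1$) with $\|u_i\|_2\le M$, $\|y_j\|_2\le M$, $|z^i_j|\le M$, such that all $u_i$ and all $y_j$ are nonzero, no two of the $u_i$ are parallel and no two of the $y_j$ are parallel. Initialize independently $w_r(0)\sim\mathcal N(0,I)$, $\tilde w_{rk}(0)\sim\mathcal N(0,I)$, $\tilde a_{rk}\sim\mathrm{Unif}\{-1,1\}$, keep the $\tilde a_{rk}$ fixed, and train all $w_r,\tilde w_{rk}$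 simultaneously by gradient descent with step size $\eta>0$ on $L=\frac12\sum_{i=1}^{n_1}\sum_{j=1}^{n_2}(G(u_i)(y_j)-z_j^i)^2$, where the derivative of $\sigma$ is taken to be $I\{x\ge0\}$: $$w_r(t+1)=w_r(t)-\eta\,\frac{\partial L}{\partial w_r}(t),\qquad \tilde w_{rk}(t+1)=\tilde w_{rk}(t)-\eta\,\frac{\partial L}{\partial\tilde w_{rk}}(t),\qquad t=0,1,2,\dots$$ Let $G^t(u)=(G^t(u_i)(y_j))_{i,j}\in\mathbb R^{n_1n_2}$ be the vector of predictions at step $t$. Let $H^\infty=H_1^\infty\otimes H_2^\infty$ and $\tilde H^\infty=\tilde H_1^\infty\otimes\tilde H_2^\infty$ where, for standard Gaussian $\tilde w\in\mathbb R^q$ and $w\in\mathbb R^d$, $$(H_1^\infty)_{ij}=\mathbb E[\sigma(\tilde w^{T}u_i)\sigma(\tilde w^{T}u_j)],\qquad (H_2^\infty)_{ij}=\mathbb E[y_i^{T}y_j\,I\{w^{T}y_i\ge0,\,w^{T}y_j\ge0\}],$$ $$(\tilde H_1^\infty)_{ij}=\mathbb E[u_i^{T}u_j\,I\{\tilde w^{T}u_i\ge0,\,\tilde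 w^{T}u_j\ge0\}],\qquad(\tilde H_2^\infty)_{ij}=\mathbb E[\sigma(w^{T}y_i)\sigma(w^{T}y_j)],$$ and let $\lambda_0,\tilde\lambda_0$ be the least eigenvalues of $H^\infty,\tilde H^\infty$. There are an absolute constant $c>0$ and, for each $M$, a constant $C>0$ depending only on $M$ such that for all such data, all $d,q,n_1,n_2,m,p$ and all $\delta\in(0,1)$: if $$0<\eta\le\frac{c}{\|H^\infty\|_2+\|\tilde H^\infty\|_2}\qquad\text{and}\qquad m\ \ge\ C\,\frac{n_1^4n_2^4\,\log\!\big(\tfrac{2n_1n_2}{\delta}\big)\,\log^3\!\big(\tfrac{2m}{\delta}\big)}{\min(\lambda_0,\tilde\lambda_0)^2\,(\lambda_0+\tilde\lambda_0)^2},$$ then with probability at least $1-\delta$ over the initialization, for all $t\in\mathbb N$, $$\|z-G^t(u)\|_2^2\le\Big(1-\eta\,\frac{\lambda_0+\tilde\lambda_0}2\Big)^{t}\,\|z-G^0(u)\|_2^2 .$$ -/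

import Mathlib

open MeasureTheory ProbabilityTheory
open scoped Kronecker ENNReal

noncomputable section

namespace NeuralOperator

/-- The ReLU activation `σ(x) = max(x, 0)`. -/
def relu (x : ℝ) : ℝ := max x 0

/-- The derivative `I{x ≥ 0}` of the ReLU, with value `1` at the kink. -/
def step (x : ℝ) : ℝ := if 0 ≤ x then 1 else 0

/-- The trained weights: the trunk weights `w_r ∈ ℝ^d` and the branch weights `w̃_{rk} ∈ ℝ^q`. -/
abbrev Weights (m p d q : ℕ) : Type :=
  (Fin m → EuclideanSpace ℝ (Fin d)) × (Fin m → Fin p → EuclideanSpace ℝ (Fin q))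

/-- The fixed outer weights `ã_{rk}`. -/
abbrev Signs (m p : ℕ) : Type := Fin m → Fin p → ℝ

section Network

variable {m p d q n₁ n₂ : ℕ}

/-- The `r`-th branch output `p^{-1/2} ∑_k ã_{rk} σ(w̃_{rk}ᵀ u)`. -/
def branch (a : Signs m p) (θ : Weights m p d q) (u : EuclideanSpace ℝ (Fin q)) (r : Fin m) : ℝ :=
  (1 / √(p : ℝ)) * ∑ k, a r k * relu (inner ℝ (θ.2 r k) u)

/-- The shallow neural operator
`G(u)(y) = m^{-1/2} ∑_r [p^{-1/2} ∑_k ã_{rk} σ(w̃_{rk}ᵀ u)] σ(w_rᵀ y)`. -/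
def G (a : Signs m p) (θ : Weights m p d q)
    (u : EuclideanSpace ℝ (Fin q)) (y : EuclideanSpace ℝ (Fin d)) : ℝ :=
  (1 / √(m : ℝ)) * ∑ r, branch a θ u r * relu (inner ℝ (θ.1 r) y)

/-- `∂G(u)(y)/∂w_r`, with the ReLU derivative `I{x ≥ 0}`. -/
def gradTrunk (a : Signs m p) (θ : Weights m p d q)
    (u : EuclideanSpace ℝ (Fin q)) (y : EuclideanSpace ℝ (Fin d)) (r : Fin m) :
    EuclideanSpace ℝ (Fin d) :=
  ((1 / √(m : ℝ)) * branch a θ u r * step (inner ℝ (θ.1 r) y)) • y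

/-- `∂G(u)(y)/∂w̃_{rk}`, with the ReLU derivative `I{x ≥ 0}`. -/
def gradBranch (a : Signs m p) (θ : Weights m p d q)
    (u : EuclideanSpace ℝ (Fin q)) (y : EuclideanSpace ℝ (Fin d)) (r : Fin m) (k : Fin p) :
    EuclideanSpace ℝ (Fin q) :=
  ((1 / √(m : ℝ)) * (a r k / √(p : ℝ)) * step (inner ℝ (θ.2 r k) u)
    * relu (inner ℝ (θ.1 r) y)) • u

/-- One step of gradient descent with step size `η` on the loss
`L = (1/2) ∑_i ∑_j (G(u_i)(y_j) - z_j^i)²`; both layers move simultaneously and the outer weights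
`a` stay fixed. By the chain rule the partial gradient of `L` is
`∑_i ∑_j (G(u_i)(y_j) - z_j^i) ∂G(u_i)(y_j)`. -/
def gdStep (a : Signs m p) (u : Fin n₁ → EuclideanSpace ℝ (Fin q))
    (y : Fin n₂ → EuclideanSpace ℝ (Fin d)) (z : Fin n₁ → Fin n₂ → ℝ) (η : ℝ)
    (θ : Weights m p d q) : Weights m p d q :=
  (fun r => θ.1 r - η • ∑ i, ∑ j, (G a θ (u i) (y j) - z i j) • gradTrunk a θ (u i) (y j) r,
   fun r k => θ.2 r k
      - η • ∑ i, ∑ j, (G a θ (u i) (y j) - z i j) • gradBranch a θ (u i) (y j) r k)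

/-- The gradient descent iterates `(W(t), W̃(t))`, `t = 0, 1, 2, …`, started at `θ₀`. -/
def gd (a : Signs m p) (u : Fin n₁ → EuclideanSpace ℝ (Fin q))
    (y : Fin n₂ → EuclideanSpace ℝ (Fin d)) (z : Fin n₁ → Fin n₂ → ℝ) (η : ℝ)
    (θ₀ : Weights m p d q) : ℕ → Weights m p d q
  | 0 => θ₀
  | t + 1 => gdStep a u y z η (gd a u y z η θ₀ t)

/-- The squared training residual `‖z - G(u)‖₂² = ∑_i ∑_j (z_j^i - G(u_i)(y_j))²`. -/
def sqResidual (a : Signs m p) (u : Fin n₁ → EuclideanSpace ℝ (Fin q))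
    (y : Fin n₂ → EuclideanSpace ℝ (Fin d)) (z : Fin n₁ → Fin n₂ → ℝ)
    (θ : Weights m p d q) : ℝ :=
  ∑ i, ∑ j, (z i j - G a θ (u i) (y j)) ^ 2

end Network

/-- The law of the initialization: `w_r(0) ∼ N(0, I)`, `w̃_{rk}(0) ∼ N(0, I)`,
`ã_{rk} ∼ Unif{-1, 1}`, all independent. -/
def initLaw (m p d q : ℕ) : Measure (Weights m p d q × Signs m p) :=
  ((Measure.pi fun _ : Fin m => stdGaussian (EuclideanSpace ℝ (Fin d))).prod
    (Measure.pi fun _ : Fin m => Measure.pi fun _ : Fin p =>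
      stdGaussian (EuclideanSpace ℝ (Fin q)))).prod
  (Measure.pi fun _ : Fin m => Measure.pi fun _ : Fin p => uniformOn ({-1, 1} : Set ℝ))

section Gram

variable {n e : ℕ}

/-- `E[σ(wᵀ v_i) σ(wᵀ v_j)]`, `w ∼ N(0, I)`. -/
def gramRelu (v : Fin n → EuclideanSpace ℝ (Fin e)) : Matrix (Fin n) (Fin n) ℝ :=
  Matrix.of fun i j =>
    ∫ w, relu (inner ℝ w (v i)) * relu (inner ℝ w (v j)) ∂stdGaussian (EuclideanSpace ℝ (Fin e))

/-- `E[v_iᵀ v_j I{wᵀ v_i ≥ 0, wᵀ v_j ≥ 0}]`, `w ∼ N(0, I)`. -/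
def gramStep (v : Fin n → EuclideanSpace ℝ (Fin e)) : Matrix (Fin n) (Fin n) ℝ :=
  Matrix.of fun i j =>
    ∫ w, inner ℝ (v i) (v j) * (step (inner ℝ w (v i)) * step (inner ℝ w (v j)))
      ∂stdGaussian (EuclideanSpace ℝ (Fin e))

end Gram

section Limit

variable {n₁ n₂ d q : ℕ}

/-- `H^∞ = H_1^∞ ⊗ H_2^∞`: the entry at `((i, i₁), (j, j₁))` is
`E[σ(w̃ᵀu_i) σ(w̃ᵀu_j)] · E[y_{i₁}ᵀ y_{j₁} I{wᵀy_{i₁} ≥ 0, wᵀy_{j₁} ≥ 0}]`. -/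
def Hinf (u : Fin n₁ → EuclideanSpace ℝ (Fin q)) (y : Fin n₂ → EuclideanSpace ℝ (Fin d)) :
    Matrix (Fin n₁ × Fin n₂) (Fin n₁ × Fin n₂) ℝ :=
  gramRelu u ⊗ₖ gramStep y

/-- `H̃^∞ = H̃_1^∞ ⊗ H̃_2^∞`: the entry at `((i, i₁), (j, j₁))` is
`E[u_iᵀ u_j I{w̃ᵀu_i ≥ 0, w̃ᵀu_j ≥ 0}] · E[σ(wᵀy_{i₁}) σ(wᵀy_{j₁})]`. -/
def Htinf (u : Fin n₁ → EuclideanSpace ℝ (Fin q)) (y : Fin n₂ → EuclideanSpace ℝ (Fin d)) :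
    Matrix (Fin n₁ × Fin n₂) (Fin n₁ × Fin n₂) ℝ :=
  gramStep u ⊗ₖ gramRelu y

end Limit

section LinearAlgebra

variable {ι : Type*} [Fintype ι] [DecidableEq ι]

/-- The least real eigenvalue of a matrix (used for symmetric matrices of positive size, where the
set of eigenvalues is finite and nonempty). -/
def leastEigenvalue (A : Matrix ι ι ℝ) : ℝ :=
  sInf {μ : ℝ | Module.End.HasEigenvalue (Matrix.toLin' A) μ}

/-- The spectral norm `‖A‖₂`: the operator norm for the Euclidean norm. -/
def specNorm (A : Matrix ι ι ℝ) : ℝ := ‖Matrix.toEuclideanCLM (𝕜 := ℝ) A‖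

end LinearAlgebra

/-- No two of the vectors are parallel. The zero vector counts as parallel to every vector, so it
is excluded, also from a family with a single member. -/
def NoTwoParallel {n e : ℕ} (v : Fin n → EuclideanSpace ℝ (Fin e)) : Prop :=
  (∀ i, v i ≠ 0) ∧ ∀ i j, i ≠ j → LinearIndependent ℝ ![v i, v j]

end NeuralOperator

end

open NeuralOperator

namespace NeuralOperator

/-! The proof is a neural tangent kernel argument in discrete time. Let `e` be the residual vector
and `A = Hinf + Htinf`. A gradient step changes the predictions to first order by `-η` times the
empirical kernel applied to `e` (`linG_gdStep`). If that kernel stayed equal to `A` and the network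
were linear in its weights, the residual would become `e - η A e`. Its norm is at most `(1 - η l)
‖e‖` with `l = lam + lamt`, because the spectrum of `A` lies in `[l, N]` and `η N ≤ 1`
(`norm_sub_smul_toEuclideanCLM_le`). Everything else shows that the deviation from this ideal step
is at most `η (l / 8) ‖e‖`.

The deviation is controlled inside a ball around the initialization: trunk weights move by at most
`R`, branch weights by at most `R / √p`. A ReLU unit is affine on each side of its kink, so both the
Taylor remainder and the change of the indicators come only from units whose initial preactivation
is within `R ‖v‖` of zero. Such a unit has probability at most `R` (`integral_near_le`), so at most
a fraction `2 R` of them is present. Hence remainder and kernel drift are `O(R)` relative to the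
ideal step, up to factors of `n = n₁ n₂`, `M` and the size `B` of the units. The properties of the
initialization that are needed form `WellInit`, and `WellInit.gd_converges` is the resulting
deterministic theorem: contraction makes the displacements a geometric series, whose sum stays below
`R`, so the weights never leave the ball and contraction persists.

`WellInit` holds with high probability by Bernstein bounds and a union bound
(`measure_not_wellInit_le`). The network is an average over `m` independent blocks. Each block
output is sub-Gaussian with a variance proxy independent of `p`, because the random signs are
centred, so `p` never has to be large. Strict positivity of `lam` and `lamt` comes from linear
independence of the ridge functions attached to pairwise nonparallel data
(`NoTwoParallel.posDef_gramRelu`, `NoTwoParallel.posDef_gramStep`).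

The width is dictated by the displacement. Let `a = log (2 n / δ)` and `b = log (2 m / δ)`. The
initial residual is of order `√(n a)`, units have size `B ~ √b`, and the allowed radius is `R ~ l /
(n b)`. Total displacement `B n √a / (√m l) ≲ R` then reads `m l ^ 4 ≳ n ^ 4 a b ^ 3`, up to powers
of `M` (`width_scales`). -/

lemma step_nonneg (x : ℝ) : 0 ≤ step x := by unfold step; split_ifs <;> norm_num

lemma step_le_one (x : ℝ) : step x ≤ 1 := by unfold step; split_ifs <;> norm_num

lemma abs_relu_sub_le (x y : ℝ) : |relu x - relu y| ≤ |x - y| := abs_max_sub_max_le_abs x y 0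

lemma abs_relu_le (x : ℝ) : |relu x| ≤ |x| := by
  simpa [relu] using abs_relu_sub_le x 0

lemma relu_eq_step_mul (x : ℝ) : relu x = step x * x := by
  unfold relu step
  split_ifs with h
  · simp [h]
  · simp [(not_le.mp h).le]

/-! ### Single ReLU units: when a sign can flip, and the first-order remainder -/

section Ridge

variable {E : Type*} [NormedAddCommGroup E] [InnerProductSpace ℝ E]

/-- Indicator of the event that moving `w` by at most `R` can flip the sign of `⟪w, v⟫`. -/
noncomputable def near (R : ℝ) (v w : E) : ℝ := if |inner ℝ w v| ≤ R * ‖v‖ then 1 else 0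

lemma near_nonneg (R : ℝ) (v w : E) : 0 ≤ near R v w := by unfold near; split_ifs <;> norm_num

lemma near_le_one (R : ℝ) (v w : E) : near R v w ≤ 1 := by unfold near; split_ifs <;> norm_num

lemma abs_inner_sub_inner_le (v w w' : E) :
    |inner ℝ w' v - inner ℝ w v| ≤ ‖w' - w‖ * ‖v‖ := by
  rw [← inner_sub_left]; exact abs_real_inner_le_norm _ _

lemma abs_relu_inner_sub_le (v w w' : E) :
    |relu (inner ℝ w' v) - relu (inner ℝ w v)| ≤ ‖w' - w‖ * ‖v‖ :=
  (abs_relu_sub_le _ _).trans (abs_inner_sub_inner_le v w w')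

lemma step_inner_eq {R : ℝ} {v w w₀ : E} (hw : ‖w - w₀‖ ≤ R) (h : ¬ |inner ℝ w₀ v| ≤ R * ‖v‖) :
    step (inner ℝ w v) = step (inner ℝ w₀ v) := by
  have h1 := (abs_inner_sub_inner_le v w₀ w).trans
    (mul_le_mul_of_nonneg_right hw (norm_nonneg v))
  rw [abs_le] at h1
  unfold step
  rcases lt_abs.mp (not_le.mp h) with h2 | h2
  · rw [if_pos (by linarith), if_pos]
    nlinarith [norm_nonneg v, (norm_nonneg _).trans hw]
  · rw [if_neg (by linarith), if_neg]
    nlinarith [norm_nonneg v, (norm_nonneg _).trans hw]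

lemma abs_step_sub_le {R : ℝ} {v w w₀ : E} (hw : ‖w - w₀‖ ≤ R) :
    |step (inner ℝ w v) - step (inner ℝ w₀ v)| ≤ near R v w₀ := by
  by_cases h : |inner ℝ w₀ v| ≤ R * ‖v‖
  · rw [near, if_pos h, abs_le]
    constructor <;> linarith [step_nonneg (inner ℝ w v), step_le_one (inner ℝ w v),
      step_nonneg (inner ℝ w₀ v), step_le_one (inner ℝ w₀ v)]
  · rw [step_inner_eq hw h]; simpa using near_nonneg R v w₀

/-- If `w₀` is not near the hyperplane, the whole `R`-ball around it lies on one side, where the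
unit is linear and the remainder is zero. Otherwise a first-order bound suffices: the remainder
never exceeds the increment of the preactivation. -/
lemma abs_relu_taylor_le {R : ℝ} {v w w' w₀ : E} (hw : ‖w - w₀‖ ≤ R) (hw' : ‖w' - w₀‖ ≤ R) :
    |relu (inner ℝ w' v) - relu (inner ℝ w v) - step (inner ℝ w v) * inner ℝ (w' - w) v|
      ≤ near R v w₀ * (‖w' - w‖ * ‖v‖) := by
  rw [inner_sub_left]
  by_cases h : |inner ℝ w₀ v| ≤ R * ‖v‖
  · rw [near, if_pos h, one_mul]
    refine le_trans ?_ (abs_inner_sub_inner_le v w w')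
    generalize inner ℝ w v = x
    generalize inner ℝ w' v = x'
    unfold relu step
    split_ifs with hx
    · rw [max_eq_left hx]
      rcases le_total 0 x' with hx' | hx'
      · rw [max_eq_left hx']; simp
      · rw [max_eq_right hx']
        rw [abs_le]; constructor <;> nlinarith [neg_abs_le (x' - x), le_abs_self (x' - x)]
    · rw [max_eq_right (not_le.mp hx).le, zero_mul, sub_zero, sub_zero, abs_of_nonneg (le_max_right _ _)]
      refine max_le ?_ (abs_nonneg _)
      linarith [le_abs_self (x' - x)]
  · rw [relu_eq_step_mul (inner ℝ w v), relu_eq_step_mul (inner ℝ w' v), step_inner_eq hw h,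
      step_inner_eq hw' h]
    have : step (inner ℝ w₀ v) * inner ℝ w' v - step (inner ℝ w₀ v) * inner ℝ w v -
      step (inner ℝ w₀ v) * (inner ℝ w' v - inner ℝ w v) = 0 := by ring
    rw [this, abs_zero]
    exact mul_nonneg (near_nonneg _ _ _) (by positivity)

end Ridge

lemma abs_eq_one_of_sq {x : ℝ} (h : x ^ 2 = 1) : |x| = 1 := by
  rw [← sq_abs] at h; nlinarith [abs_nonneg x]

/-! ### Linearization of the network and the empirical tangent kernels -/

section Kernels

variable {m p d q n₁ n₂ : ℕ}

/-- The trunk part of the empirical tangent kernel. -/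
noncomputable def kerTrunk (a : Signs m p) (θ : Weights m p d q) (u u' : EuclideanSpace ℝ (Fin q))
    (y y' : EuclideanSpace ℝ (Fin d)) : ℝ :=
  (1 / (m : ℝ)) * ∑ r, branch a θ u r * branch a θ u' r *
    (inner ℝ y y' * (step (inner ℝ (θ.1 r) y) * step (inner ℝ (θ.1 r) y')))

/-- The branch part of the empirical tangent kernel (for outer weights of modulus one). -/
noncomputable def kerBranch (θ : Weights m p d q) (u u' : EuclideanSpace ℝ (Fin q))
    (y y' : EuclideanSpace ℝ (Fin d)) : ℝ :=
  (1 / (m : ℝ)) * ∑ r, (1 / (p : ℝ)) * ∑ k,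
    inner ℝ u u' * (step (inner ℝ (θ.2 r k) u) * step (inner ℝ (θ.2 r k) u')) *
      (relu (inner ℝ (θ.1 r) y) * relu (inner ℝ (θ.1 r) y'))

/-- The `p` summands each move by at most `D / √p * ‖u‖` and the normalization contributes another
`1 / √p`, so the bound is free of `p`. This is why displacements of branch weights are measured in
units of `1 / √p` throughout. -/
lemma abs_branch_sub_le {a : Signs m p} (ha : ∀ r k, a r k ^ 2 = 1) (hp : 0 < p)
    {θ θ' : Weights m p d q} {r : Fin m} {D : ℝ}
    (h : ∀ k, ‖θ'.2 r k - θ.2 r k‖ ≤ D / √(p : ℝ)) (u : EuclideanSpace ℝ (Fin q)) :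
    |branch a θ' u r - branch a θ u r| ≤ D * ‖u‖ := by
  have hp' : (0 : ℝ) < p := by exact_mod_cast hp
  have hs : 0 < √(p : ℝ) := Real.sqrt_pos.mpr hp'
  unfold branch
  rw [← mul_sub, ← Finset.sum_sub_distrib, abs_mul, abs_of_pos (by positivity : 0 < 1 / √(p : ℝ))]
  have : |∑ k, (a r k * relu (inner ℝ (θ'.2 r k) u) - a r k * relu (inner ℝ (θ.2 r k) u))|
      ≤ ∑ k : Fin p, D / √(p : ℝ) * ‖u‖ := by
    refine (Finset.abs_sum_le_sum_abs _ _).trans (Finset.sum_le_sum fun k _ => ?_)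
    rw [← mul_sub, abs_mul, (abs_eq_one_of_sq (ha r k)), one_mul]
    exact (abs_relu_inner_sub_le _ _ _).trans (mul_le_mul_of_nonneg_right (h k) (norm_nonneg _))
  calc _ ≤ 1 / √(p : ℝ) * ∑ k : Fin p, D / √(p : ℝ) * ‖u‖ := by gcongr
    _ = (p / (√(p : ℝ) * √(p : ℝ))) * (D * ‖u‖) := by
      simp only [Finset.sum_const, Finset.card_univ, Fintype.card_fin, nsmul_eq_mul]; field_simp
    _ = D * ‖u‖ := by rw [Real.mul_self_sqrt hp'.le, div_self hp'.ne', one_mul]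

lemma abs_branch_taylor_le {a : Signs m p} (ha : ∀ r k, a r k ^ 2 = 1)
    {θ₀ θ θ' : Weights m p d q} {r : Fin m} {D R : ℝ}
    (hθ : ∀ k, ‖θ.2 r k - θ₀.2 r k‖ ≤ R) (hθ' : ∀ k, ‖θ'.2 r k - θ₀.2 r k‖ ≤ R)
    (h : ∀ k, ‖θ'.2 r k - θ.2 r k‖ ≤ D / √(p : ℝ)) (u : EuclideanSpace ℝ (Fin q)) :
    |branch a θ' u r - branch a θ u r - (1 / √(p : ℝ)) * ∑ k, a r k *
        (step (inner ℝ (θ.2 r k) u) * inner ℝ (θ'.2 r k - θ.2 r k) u)|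
      ≤ D * ‖u‖ * ((1 / (p : ℝ)) * ∑ k, near R u (θ₀.2 r k)) := by
  unfold branch
  rw [← mul_sub, ← mul_sub, ← Finset.sum_sub_distrib, ← Finset.sum_sub_distrib, abs_mul,
    abs_of_nonneg (by positivity : 0 ≤ 1 / √(p : ℝ))]
  have : |∑ k, (a r k * relu (inner ℝ (θ'.2 r k) u) - a r k * relu (inner ℝ (θ.2 r k) u) -
        a r k * (step (inner ℝ (θ.2 r k) u) * inner ℝ (θ'.2 r k - θ.2 r k) u))|
      ≤ ∑ k : Fin p, near R u (θ₀.2 r k) * (D / √(p : ℝ) * ‖u‖) := by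
    refine (Finset.abs_sum_le_sum_abs _ _).trans (Finset.sum_le_sum fun k _ => ?_)
    rw [← mul_sub, ← mul_sub, abs_mul, abs_eq_one_of_sq (ha r k), one_mul]
    refine (abs_relu_taylor_le (hθ k) (hθ' k)).trans ?_
    exact mul_le_mul_of_nonneg_left (mul_le_mul_of_nonneg_right (h k) (norm_nonneg _))
      (near_nonneg _ _ _)
  refine (mul_le_mul_of_nonneg_left this (by positivity)).trans (le_of_eq ?_)
  rw [← Finset.sum_mul]
  have h2 : (1 : ℝ) / p = 1 / √(p : ℝ) * (1 / √(p : ℝ)) := by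
    rw [div_mul_div_comm, one_mul, Real.mul_self_sqrt (Nat.cast_nonneg _)]
  rw [h2]; ring

/-- The first-order change of the prediction `G(u)(y)` when the weights move from `θ` to `θ'`. -/
noncomputable def linG (a : Signs m p) (θ θ' : Weights m p d q) (u : EuclideanSpace ℝ (Fin q))
    (y : EuclideanSpace ℝ (Fin d)) : ℝ :=
  ∑ r, (inner ℝ (gradTrunk a θ u y r) (θ'.1 r - θ.1 r) +
    ∑ k, inner ℝ (gradBranch a θ u y r k) (θ'.2 r k - θ.2 r k))

lemma linG_eq (a : Signs m p) (θ θ' : Weights m p d q) (u : EuclideanSpace ℝ (Fin q))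
    (y : EuclideanSpace ℝ (Fin d)) :
    linG a θ θ' u y = (1 / √(m : ℝ)) * ∑ r,
      (branch a θ u r * (step (inner ℝ (θ.1 r) y) * inner ℝ (θ'.1 r - θ.1 r) y) +
        ((1 / √(p : ℝ)) * ∑ k, a r k *
          (step (inner ℝ (θ.2 r k) u) * inner ℝ (θ'.2 r k - θ.2 r k) u)) *
            relu (inner ℝ (θ.1 r) y)) := by
  unfold linG gradTrunk gradBranch
  rw [Finset.mul_sum]
  refine Finset.sum_congr rfl fun r _ => ?_
  rw [mul_add]
  congr 1
  · rw [real_inner_smul_left, real_inner_comm (θ'.1 r - θ.1 r) y]; ring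
  · rw [Finset.mul_sum, Finset.sum_mul, Finset.mul_sum]
    refine Finset.sum_congr rfl fun k _ => ?_
    rw [real_inner_smul_left, real_inner_comm (θ'.2 r k - θ.2 r k) u]; ring

/-- Second-order remainder of the network along a step inside the ball on which few neurons flip. -/
lemma abs_G_taylor_le {a : Signs m p} (ha : ∀ r k, a r k ^ 2 = 1) (hm : 0 < m) (hp : 0 < p)
    {θ₀ θ θ' : Weights m p d q} {B D R R' M : ℝ} (hD : 0 ≤ D)
    (hθ1 : ∀ r, ‖θ.1 r - θ₀.1 r‖ ≤ R) (hθ1' : ∀ r, ‖θ'.1 r - θ₀.1 r‖ ≤ R)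
    (hθ2 : ∀ r k, ‖θ.2 r k - θ₀.2 r k‖ ≤ R) (hθ2' : ∀ r k, ‖θ'.2 r k - θ₀.2 r k‖ ≤ R)
    (h1 : ∀ r, ‖θ'.1 r - θ.1 r‖ ≤ D) (h2 : ∀ r k, ‖θ'.2 r k - θ.2 r k‖ ≤ D / √(p : ℝ))
    (h3 : ∀ r k, ‖θ'.2 r k - θ.2 r k‖ ≤ R' / √(p : ℝ))
    {u : EuclideanSpace ℝ (Fin q)} {y : EuclideanSpace ℝ (Fin d)} (hu : ‖u‖ ≤ M) (hy : ‖y‖ ≤ M)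
    (hb : ∀ r, |branch a θ u r| ≤ B) (hs : ∀ r, |inner ℝ (θ.1 r) y| ≤ B)
    (hn1 : ∑ r, near R y (θ₀.1 r) ≤ 2 * R * m)
    (hn2 : ∑ r, (1 / (p : ℝ)) * ∑ k, near R u (θ₀.2 r k) ≤ 2 * R * m) :
    |G a θ' u y - G a θ u y - linG a θ θ' u y| ≤ √(m : ℝ) * D * (4 * B * M * R + R' * M ^ 2) := by
  have hm' : (0 : ℝ) < m := by exact_mod_cast hm
  have hM : 0 ≤ M := (norm_nonneg _).trans hu
  have hB : 0 ≤ B := (abs_nonneg _).trans (hb ⟨0, hm⟩)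
  have hsum : |∑ r, (branch a θ' u r * relu (inner ℝ (θ'.1 r) y) -
      branch a θ u r * relu (inner ℝ (θ.1 r) y) -
      (branch a θ u r * (step (inner ℝ (θ.1 r) y) * inner ℝ (θ'.1 r - θ.1 r) y) +
        ((1 / √(p : ℝ)) * ∑ k, a r k *
          (step (inner ℝ (θ.2 r k) u) * inner ℝ (θ'.2 r k - θ.2 r k) u)) *
            relu (inner ℝ (θ.1 r) y)))|
      ≤ ∑ r : Fin m, (B * D * M * near R y (θ₀.1 r)
        + B * D * M * ((1 / (p : ℝ)) * ∑ k, near R u (θ₀.2 r k)) + R' * D * M ^ 2) := by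
    refine (Finset.abs_sum_le_sum_abs _ _).trans (Finset.sum_le_sum fun r _ => ?_)
    set b := branch a θ u r
    set b' := branch a θ' u r
    set s := relu (inner ℝ (θ.1 r) y)
    set s' := relu (inner ℝ (θ'.1 r) y)
    set l := step (inner ℝ (θ.1 r) y) * inner ℝ (θ'.1 r - θ.1 r) y
    set l' := (1 / √(p : ℝ)) * ∑ k, a r k *
          (step (inner ℝ (θ.2 r k) u) * inner ℝ (θ'.2 r k - θ.2 r k) u)
    -- Product rule: the remainder of each factor times the other factor, plus the product of the
    -- two increments. The first two terms are supported on near units. In the last one, one factor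
    -- is estimated by `D` and the other by the separate bound `R'`, so the total is linear in `D`
    -- with a small coefficient.
    have e : b' * s' - b * s - (b * l + l' * s) =
      b * (s' - s - l) + (b' - b - l') * s + (b' - b) * (s' - s) := by ring
    rw [e]
    refine (abs_add_three _ _ _).trans ?_
    rw [abs_mul, abs_mul, abs_mul]
    have hR' : 0 ≤ R' := by
      have := (norm_nonneg _).trans (h3 r ⟨0, hp⟩)
      by_contra hc
      exact absurd (div_neg_of_neg_of_pos (not_le.mp hc)
        (Real.sqrt_pos.mpr (by exact_mod_cast hp : (0 : ℝ) < p))) (not_lt.mpr this)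
    have t1 : |s' - s - l| ≤ near R y (θ₀.1 r) * (D * M) :=
      (abs_relu_taylor_le (hθ1 r) (hθ1' r)).trans (mul_le_mul_of_nonneg_left
        (mul_le_mul (h1 r) hy (norm_nonneg _) hD) (near_nonneg _ _ _))
    have hN : 0 ≤ (1 / (p : ℝ)) * ∑ k, near R u (θ₀.2 r k) :=
      mul_nonneg (by positivity) (Finset.sum_nonneg fun _ _ => near_nonneg _ _ _)
    have t2 : |b' - b - l'| ≤ D * M * ((1 / (p : ℝ)) * ∑ k, near R u (θ₀.2 r k)) :=
      (abs_branch_taylor_le ha (hθ2 r) (hθ2' r) (h2 r) u).trans (by gcongr)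
    have t3 : |b' - b| ≤ R' * M := (abs_branch_sub_le ha hp (h3 r) u).trans (by gcongr)
    have t4 : |s' - s| ≤ D * M := (abs_relu_inner_sub_le _ _ _).trans
        (mul_le_mul (h1 r) hy (norm_nonneg _) hD)
    have t5 : |s| ≤ B := (abs_relu_le _).trans (hs r)
    have hnear := near_nonneg R y (θ₀.1 r)
    calc _ ≤ B * (near R y (θ₀.1 r) * (D * M)) +
          (D * M * ((1 / (p : ℝ)) * ∑ k, near R u (θ₀.2 r k))) * B + (R' * M) * (D * M) := by
            gcongr; exact hb r
      _ = _ := by ring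
  have hG : G a θ' u y - G a θ u y - linG a θ θ' u y = (1 / √(m : ℝ)) *
      ∑ r, (branch a θ' u r * relu (inner ℝ (θ'.1 r) y) -
      branch a θ u r * relu (inner ℝ (θ.1 r) y) -
      (branch a θ u r * (step (inner ℝ (θ.1 r) y) * inner ℝ (θ'.1 r - θ.1 r) y) +
        ((1 / √(p : ℝ)) * ∑ k, a r k *
          (step (inner ℝ (θ.2 r k) u) * inner ℝ (θ'.2 r k - θ.2 r k) u)) *
            relu (inner ℝ (θ.1 r) y))) := by
    rw [linG_eq, G, G, Finset.sum_sub_distrib, Finset.sum_sub_distrib]; ring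
  rw [hG, abs_mul, abs_of_nonneg (by positivity : 0 ≤ 1 / √(m : ℝ))]
  refine (mul_le_mul_of_nonneg_left hsum (by positivity)).trans ?_
  rw [Finset.sum_add_distrib, Finset.sum_add_distrib, ← Finset.mul_sum, ← Finset.mul_sum]
  simp only [Finset.sum_const, Finset.card_univ, Fintype.card_fin, nsmul_eq_mul]
  calc _ ≤ 1 / √(m : ℝ) * (B * D * M * (2 * R * m) + B * D * M * (2 * R * m)
        + m * (R' * D * M ^ 2)) := by gcongr
    _ = (m / √(m : ℝ)) * D * (4 * B * M * R + R' * M ^ 2) := by ring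
    _ = _ := by rw [Real.div_sqrt]

/-- The displacement is `-η` times the residual-weighted sum of gradients, so pairing it with the
gradient at `(u i, y j)` produces a Gram matrix of gradients. That matrix is the sum of the two
kernels; the condition on `a` removes the squared signs from the branch part. -/
lemma linG_gdStep {a : Signs m p} (ha : ∀ r k, a r k ^ 2 = 1)
    (u : Fin n₁ → EuclideanSpace ℝ (Fin q))
    (y : Fin n₂ → EuclideanSpace ℝ (Fin d)) (z : Fin n₁ → Fin n₂ → ℝ) (η : ℝ)
    (θ : Weights m p d q) (i : Fin n₁) (j : Fin n₂) :
    linG a θ (gdStep a u y z η θ) (u i) (y j) =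
      -η * ∑ i', ∑ j', (kerTrunk a θ (u i) (u i') (y j) (y j') +
        kerBranch θ (u i) (u i') (y j) (y j')) * (G a θ (u i') (y j') - z i' j') := by
  have e1 : ∀ r, inner ℝ (gradTrunk a θ (u i) (y j) r) ((gdStep a u y z η θ).1 r - θ.1 r) =
      -η * ∑ i', ∑ j', (G a θ (u i') (y j') - z i' j') *
        inner ℝ (gradTrunk a θ (u i) (y j) r) (gradTrunk a θ (u i') (y j') r) := by
    intro r
    simp only [gdStep, sub_sub_cancel_left, ← neg_smul, real_inner_smul_right, inner_sum]
  have e2 : ∀ r k, inner ℝ (gradBranch a θ (u i) (y j) r k)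
        ((gdStep a u y z η θ).2 r k - θ.2 r k) =
      -η * ∑ i', ∑ j', (G a θ (u i') (y j') - z i' j') *
        inner ℝ (gradBranch a θ (u i) (y j) r k) (gradBranch a θ (u i') (y j') r k) := by
    intro r k
    simp only [gdStep, sub_sub_cancel_left, ← neg_smul, real_inner_smul_right, inner_sum]
  have hsm : (1 : ℝ) / m = 1 / √(m : ℝ) * (1 / √(m : ℝ)) := by
    rw [div_mul_div_comm, one_mul, Real.mul_self_sqrt (Nat.cast_nonneg _)]
  have hsp : (1 : ℝ) / p = 1 / √(p : ℝ) * (1 / √(p : ℝ)) := by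
    rw [div_mul_div_comm, one_mul, Real.mul_self_sqrt (Nat.cast_nonneg _)]
  have k1 : ∀ i' j', kerTrunk a θ (u i) (u i') (y j) (y j') =
      ∑ r, inner ℝ (gradTrunk a θ (u i) (y j) r) (gradTrunk a θ (u i') (y j') r) := by
    intro i' j'
    rw [kerTrunk, Finset.mul_sum]
    refine Finset.sum_congr rfl fun r _ => ?_
    rw [gradTrunk, gradTrunk, real_inner_smul_left, real_inner_smul_right, hsm]; ring
  have k2 : ∀ i' j', kerBranch θ (u i) (u i') (y j) (y j') =
      ∑ r, ∑ k, inner ℝ (gradBranch a θ (u i) (y j) r k) (gradBranch a θ (u i') (y j') r k) := by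
    intro i' j'
    rw [kerBranch, Finset.mul_sum]
    refine Finset.sum_congr rfl fun r _ => ?_
    rw [Finset.mul_sum, Finset.mul_sum]
    refine Finset.sum_congr rfl fun k _ => ?_
    rw [gradBranch, gradBranch, real_inner_smul_left, real_inner_smul_right, hsm, hsp]
    linear_combination (-(1 / √(m : ℝ) * (1 / √(m : ℝ))) * (1 / √(p : ℝ) * (1 / √(p : ℝ))) *
      inner ℝ (u i) (u i') * (step (inner ℝ (θ.2 r k) (u i)) * step (inner ℝ (θ.2 r k) (u i'))) *
      (relu (inner ℝ (θ.1 r) (y j)) * relu (inner ℝ (θ.1 r) (y j')))) * ha r k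
  unfold linG
  simp only [e1, e2, k1, k2]
  simp only [← Finset.mul_sum, ← mul_add, ← Finset.sum_add_distrib]
  congr 1
  simp only [add_mul, Finset.sum_mul, Finset.sum_add_distrib]
  congr 1
  · rw [Finset.sum_comm]
    refine Finset.sum_congr rfl fun i' _ => ?_
    rw [Finset.sum_comm]
    exact Finset.sum_congr rfl fun j' _ => Finset.sum_congr rfl fun r _ => mul_comm _ _
  · have : ∀ r : Fin m, ∑ k : Fin p, ∑ i', ∑ j', (G a θ (u i') (y j') - z i' j') *
        inner ℝ (gradBranch a θ (u i) (y j) r k) (gradBranch a θ (u i') (y j') r k) =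
        ∑ i', ∑ j', ∑ k : Fin p, inner ℝ (gradBranch a θ (u i) (y j) r k)
          (gradBranch a θ (u i') (y j') r k) * (G a θ (u i') (y j') - z i' j') := by
      intro r
      rw [Finset.sum_comm]
      refine Finset.sum_congr rfl fun i' _ => ?_
      rw [Finset.sum_comm]
      exact Finset.sum_congr rfl fun j' _ => Finset.sum_congr rfl fun r _ => mul_comm _ _
    simp only [this]
    rw [Finset.sum_comm]
    refine Finset.sum_congr rfl fun i' _ => ?_
    rw [Finset.sum_comm]

end Kernels

/-- One summand of either kernel: `x, x'` are bounded amplitudes that drift by `D`, and `s, s'` are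
activation indicators that change only with near units. Both kernels fit this pattern with the roles
of trunk and branch exchanged. -/
lemma abs_kernel_term_sub_le {x x' x₀ x₀' s s' s₀ s₀' Y B D ν ν' Q : ℝ}
    (hx : |x - x₀| ≤ D) (hx' : |x' - x₀'| ≤ D) (h₀ : |x₀| ≤ B) (h₀' : |x₀'| ≤ B)
    (h' : |x'| ≤ 2 * B) (hY : |Y| ≤ Q)
    (hs : |s - s₀| ≤ ν) (hs' : |s' - s₀'| ≤ ν') (hs1 : |s| ≤ 1) (hs1' : |s'| ≤ 1)
    (hs₀ : |s₀| ≤ 1) :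
    |x * x' * (Y * (s * s')) - x₀ * x₀' * (Y * (s₀ * s₀'))|
      ≤ Q * (3 * B * D + B ^ 2 * (ν + ν')) := by
  have e : x * x' * (Y * (s * s')) - x₀ * x₀' * (Y * (s₀ * s₀')) =
    Y * (((x - x₀) * x' + x₀ * (x' - x₀')) * (s * s') +
      x₀ * x₀' * ((s - s₀) * s' + s₀ * (s' - s₀'))) := by ring
  have hD := (abs_nonneg _).trans hx
  have hB := (abs_nonneg _).trans h₀
  have hν := (abs_nonneg _).trans hs
  have hν' := (abs_nonneg _).trans hs'
  have hQ := (abs_nonneg _).trans hY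
  rw [e, abs_mul]
  refine mul_le_mul hY ((abs_add_le _ _).trans ?_) (abs_nonneg _) hQ
  rw [abs_mul _ (s * s'), abs_mul (x₀ * x₀'), abs_mul s, abs_mul x₀ x₀']
  have t1 : |(x - x₀) * x' + x₀ * (x' - x₀')| ≤ 3 * B * D := by
    refine (abs_add_le _ _).trans ?_
    rw [abs_mul, abs_mul]
    calc _ ≤ D * (2 * B) + B * D := by gcongr
      _ = _ := by ring
  have t2 : |(s - s₀) * s' + s₀ * (s' - s₀')| ≤ ν + ν' := by
    refine (abs_add_le _ _).trans ?_
    rw [abs_mul, abs_mul]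
    calc _ ≤ ν * 1 + 1 * ν' := by gcongr
      _ = _ := by ring
  calc _ ≤ 3 * B * D * (1 * 1) + B * B * (ν + ν') := by gcongr
    _ = _ := by ring

lemma abs_step_le_one (x : ℝ) : |step x| ≤ 1 := by
  rw [abs_of_nonneg (step_nonneg x)]; exact step_le_one x

lemma sum_mul_add_mul_add {n : ℕ} (Q c b : ℝ) (f g : Fin n → ℝ) :
    ∑ r, Q * (c + b * (f r + g r)) = Q * (n * c + b * (∑ r, f r + ∑ r, g r)) := by
  rw [← Finset.mul_sum, Finset.sum_add_distrib, ← Finset.mul_sum, Finset.sum_add_distrib,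
    Finset.sum_const, Finset.card_univ, Fintype.card_fin, nsmul_eq_mul]

/-! ### Kernel drift in the ball and the size of one gradient step -/

section Training

variable {m p d q n₁ n₂ : ℕ}

/-- The drift of the amplitudes contributes `3 B D` per summand. The indicators contribute on
average `B ^ 2` times the fraction of near units, which is `2 R` for each of the two inputs. -/
lemma abs_kerTrunk_sub_le {a : Signs m p} (hm : 0 < m) {θ₀ θ : Weights m p d q} {B D R M : ℝ}
    {u u' : EuclideanSpace ℝ (Fin q)} {y y' : EuclideanSpace ℝ (Fin d)}
    (hy : ‖y‖ ≤ M) (hy' : ‖y'‖ ≤ M) (hθ : ∀ r, ‖θ.1 r - θ₀.1 r‖ ≤ R)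
    (hb : ∀ r, |branch a θ₀ u r| ≤ B) (hb' : ∀ r, |branch a θ₀ u' r| ≤ B)
    (hd : ∀ r, |branch a θ u r - branch a θ₀ u r| ≤ D)
    (hd' : ∀ r, |branch a θ u' r - branch a θ₀ u' r| ≤ D) (hDB : D ≤ B)
    (hn : ∑ r, near R y (θ₀.1 r) ≤ 2 * R * m) (hn' : ∑ r, near R y' (θ₀.1 r) ≤ 2 * R * m) :
    |kerTrunk a θ u u' y y' - kerTrunk a θ₀ u u' y y'| ≤ M ^ 2 * (3 * B * D + 4 * B ^ 2 * R) := by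
  have hm' : (0 : ℝ) < m := by exact_mod_cast hm
  unfold kerTrunk
  rw [← mul_sub, ← Finset.sum_sub_distrib, abs_mul, abs_of_nonneg (by positivity)]
  have hY : |inner ℝ y y'| ≤ M ^ 2 := (abs_real_inner_le_norm _ _).trans (by
    rw [sq]; exact mul_le_mul hy hy' (norm_nonneg _) ((norm_nonneg _).trans hy))
  have : |∑ r, (branch a θ u r * branch a θ u' r *
        (inner ℝ y y' * (step (inner ℝ (θ.1 r) y) * step (inner ℝ (θ.1 r) y'))) -
      branch a θ₀ u r * branch a θ₀ u' r *
        (inner ℝ y y' * (step (inner ℝ (θ₀.1 r) y) * step (inner ℝ (θ₀.1 r) y'))))| ≤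
      ∑ r, M ^ 2 * (3 * B * D + B ^ 2 * (near R y (θ₀.1 r) + near R y' (θ₀.1 r))) := by
    refine (Finset.abs_sum_le_sum_abs _ _).trans (Finset.sum_le_sum fun r _ => ?_)
    refine abs_kernel_term_sub_le (hd r) (hd' r) (hb r) (hb' r) ?_ hY (abs_step_sub_le (hθ r))
      (abs_step_sub_le (hθ r)) (abs_step_le_one _) (abs_step_le_one _) (abs_step_le_one _)
    linarith [abs_sub_abs_le_abs_sub (branch a θ u' r) (branch a θ₀ u' r), hb' r, hd' r]
  refine (mul_le_mul_of_nonneg_left this (by positivity)).trans ?_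
  rw [sum_mul_add_mul_add]
  calc _ ≤ 1 / (m : ℝ) * (M ^ 2 * (m * (3 * B * D) + B ^ 2 * (2 * R * m + 2 * R * m))) := by gcongr
    _ = _ := by field_simp; ring

lemma abs_kerBranch_sub_le (hm : 0 < m) (hp : 0 < p) {θ₀ θ : Weights m p d q} {B D R M : ℝ}
    {u u' : EuclideanSpace ℝ (Fin q)} {y y' : EuclideanSpace ℝ (Fin d)}
    (hu : ‖u‖ ≤ M) (hu' : ‖u'‖ ≤ M) (hθ : ∀ r k, ‖θ.2 r k - θ₀.2 r k‖ ≤ R)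
    (hb : ∀ r, |inner ℝ (θ₀.1 r) y| ≤ B) (hb' : ∀ r, |inner ℝ (θ₀.1 r) y'| ≤ B)
    (hd : ∀ r, |relu (inner ℝ (θ.1 r) y) - relu (inner ℝ (θ₀.1 r) y)| ≤ D)
    (hd' : ∀ r, |relu (inner ℝ (θ.1 r) y') - relu (inner ℝ (θ₀.1 r) y')| ≤ D) (hDB : D ≤ B)
    (hn : ∑ r, (1 / (p : ℝ)) * ∑ k, near R u (θ₀.2 r k) ≤ 2 * R * m)
    (hn' : ∑ r, (1 / (p : ℝ)) * ∑ k, near R u' (θ₀.2 r k) ≤ 2 * R * m) :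
    |kerBranch θ u u' y y' - kerBranch θ₀ u u' y y'| ≤ M ^ 2 * (3 * B * D + 4 * B ^ 2 * R) := by
  have hm' : (0 : ℝ) < m := by exact_mod_cast hm
  have hp' : (0 : ℝ) < p := by exact_mod_cast hp
  unfold kerBranch
  rw [← mul_sub, ← Finset.sum_sub_distrib, abs_mul, abs_of_nonneg (by positivity)]
  have hY : |inner ℝ u u'| ≤ M ^ 2 := (abs_real_inner_le_norm _ _).trans (by
    rw [sq]; exact mul_le_mul hu hu' (norm_nonneg _) ((norm_nonneg _).trans hu))
  have : ∀ r : Fin m, |(1 / (p : ℝ)) * ∑ k,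
    inner ℝ u u' * (step (inner ℝ (θ.2 r k) u) * step (inner ℝ (θ.2 r k) u')) *
      (relu (inner ℝ (θ.1 r) y) * relu (inner ℝ (θ.1 r) y')) - (1 / (p : ℝ)) * ∑ k,
    inner ℝ u u' * (step (inner ℝ (θ₀.2 r k) u) * step (inner ℝ (θ₀.2 r k) u')) *
      (relu (inner ℝ (θ₀.1 r) y) * relu (inner ℝ (θ₀.1 r) y'))| ≤
      M ^ 2 * (3 * B * D + B ^ 2 * ((1 / (p : ℝ)) * ∑ k, near R u (θ₀.2 r k) +
        (1 / (p : ℝ)) * ∑ k, near R u' (θ₀.2 r k))) := by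
    intro r
    rw [← mul_sub, ← Finset.sum_sub_distrib, abs_mul, abs_of_nonneg (by positivity)]
    have : |∑ k, (inner ℝ u u' * (step (inner ℝ (θ.2 r k) u) * step (inner ℝ (θ.2 r k) u')) *
        (relu (inner ℝ (θ.1 r) y) * relu (inner ℝ (θ.1 r) y')) -
        inner ℝ u u' * (step (inner ℝ (θ₀.2 r k) u) * step (inner ℝ (θ₀.2 r k) u')) *
        (relu (inner ℝ (θ₀.1 r) y) * relu (inner ℝ (θ₀.1 r) y')))| ≤
        ∑ k, M ^ 2 * (3 * B * D + B ^ 2 * (near R u (θ₀.2 r k) + near R u' (θ₀.2 r k))) := by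
      refine (Finset.abs_sum_le_sum_abs _ _).trans (Finset.sum_le_sum fun k _ => ?_)
      rw [mul_comm (inner ℝ u u' * _), mul_comm (inner ℝ u u' * _)]
      refine abs_kernel_term_sub_le (hd r) (hd' r) ((abs_relu_le _).trans (hb r))
        ((abs_relu_le _).trans (hb' r)) ?_ hY (abs_step_sub_le (hθ r k))
        (abs_step_sub_le (hθ r k)) (abs_step_le_one _) (abs_step_le_one _) (abs_step_le_one _)
      linarith [abs_sub_abs_le_abs_sub (relu (inner ℝ (θ.1 r) y')) (relu (inner ℝ (θ₀.1 r) y')),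
        (abs_relu_le _).trans (hb' r), hd' r]
    refine (mul_le_mul_of_nonneg_left this (by positivity)).trans (le_of_eq ?_)
    rw [sum_mul_add_mul_add]
    field_simp
  refine (mul_le_mul_of_nonneg_left ((Finset.abs_sum_le_sum_abs _ _).trans
    (Finset.sum_le_sum fun r _ => this r)) (by positivity)).trans ?_
  rw [sum_mul_add_mul_add]
  calc _ ≤ 1 / (m : ℝ) * (M ^ 2 * (m * (3 * B * D) + B ^ 2 * (2 * R * m + 2 * R * m))) := by gcongr
    _ = _ := by field_simp; ring

/-- The vector of residuals `G(u_i)(y_j) - z_j^i`. -/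
noncomputable def resid (a : Signs m p) (u : Fin n₁ → EuclideanSpace ℝ (Fin q))
    (y : Fin n₂ → EuclideanSpace ℝ (Fin d)) (z : Fin n₁ → Fin n₂ → ℝ) (θ : Weights m p d q) :
    EuclideanSpace ℝ (Fin n₁ × Fin n₂) :=
  WithLp.toLp 2 fun ij => G a θ (u ij.1) (y ij.2) - z ij.1 ij.2

lemma resid_apply (a : Signs m p) (u : Fin n₁ → EuclideanSpace ℝ (Fin q))
    (y : Fin n₂ → EuclideanSpace ℝ (Fin d)) (z : Fin n₁ → Fin n₂ → ℝ) (θ : Weights m p d q)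
    (ij : Fin n₁ × Fin n₂) :
    resid a u y z θ ij = G a θ (u ij.1) (y ij.2) - z ij.1 ij.2 := rfl

lemma norm_resid_sq (a : Signs m p) (u : Fin n₁ → EuclideanSpace ℝ (Fin q))
    (y : Fin n₂ → EuclideanSpace ℝ (Fin d)) (z : Fin n₁ → Fin n₂ → ℝ) (θ : Weights m p d q) :
    ‖resid a u y z θ‖ ^ 2 = sqResidual a u y z θ := by
  rw [EuclideanSpace.real_norm_sq_eq, Fintype.sum_prod_type, sqResidual]
  refine Finset.sum_congr rfl fun i _ => Finset.sum_congr rfl fun j _ => ?_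
  rw [resid_apply]; ring

lemma sum_abs_le_sqrt_card_mul_norm {ι : Type*} [Fintype ι] (e : EuclideanSpace ℝ ι) :
    ∑ i, |e i| ≤ √(Fintype.card ι : ℝ) * ‖e‖ := by
  have h := Real.sum_mul_le_sqrt_mul_sqrt Finset.univ (fun _ : ι => (1 : ℝ)) (fun i => |e i|)
  simpa [EuclideanSpace.norm_eq] using h

lemma norm_le_sqrt_card_mul {ι : Type*} [Fintype ι] {e : EuclideanSpace ℝ ι} {b : ℝ}
    (h : ∀ i, |e i| ≤ b) (hb : 0 ≤ b) : ‖e‖ ≤ √(Fintype.card ι : ℝ) * b := by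
  rw [EuclideanSpace.norm_eq]
  apply Real.sqrt_le_iff.mpr ⟨by positivity, ?_⟩
  rw [mul_pow, Real.sq_sqrt (Nat.cast_nonneg _)]
  calc _ ≤ ∑ _i : ι, b ^ 2 := Finset.sum_le_sum fun i _ => by
        rw [Real.norm_eq_abs]; exact pow_le_pow_left₀ (abs_nonneg _) (h i) 2
    _ = _ := by simp

lemma norm_gdStep_fst_sub_le (hm : 0 < m) {a : Signs m p}
    {u : Fin n₁ → EuclideanSpace ℝ (Fin q)}
    {y : Fin n₂ → EuclideanSpace ℝ (Fin d)} (z : Fin n₁ → Fin n₂ → ℝ) {η : ℝ} (hη : 0 ≤ η)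
    {θ : Weights m p d q} {B M : ℝ} (r : Fin m) (hb : ∀ i, |branch a θ (u i) r| ≤ B)
    (hy : ∀ j, ‖y j‖ ≤ M) :
    ‖(gdStep a u y z η θ).1 r - θ.1 r‖ ≤
      η * (B * M * (√(Fintype.card (Fin n₁ × Fin n₂) : ℝ) / √(m : ℝ)) * ‖resid a u y z θ‖) := by
  have hm' : (0 : ℝ) < m := by exact_mod_cast hm
  simp only [gdStep, sub_sub_cancel_left]
  rw [norm_neg, norm_smul, Real.norm_of_nonneg hη]
  refine mul_le_mul_of_nonneg_left ?_ hη
  have : ‖∑ i, ∑ j, (G a θ (u i) (y j) - z i j) • gradTrunk a θ (u i) (y j) r‖ ≤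
      ∑ ij : Fin n₁ × Fin n₂, |resid a u y z θ ij| * (1 / √(m : ℝ) * (B * M)) := by
    rw [Fintype.sum_prod_type]
    refine (norm_sum_le _ _).trans (Finset.sum_le_sum fun i _ =>
      (norm_sum_le _ _).trans (Finset.sum_le_sum fun j _ => ?_))
    have hB := (abs_nonneg _).trans (hb i)
    rw [norm_smul, Real.norm_eq_abs, resid_apply, gradTrunk, norm_smul, Real.norm_eq_abs, abs_mul,
      abs_mul, abs_of_nonneg (by positivity : 0 ≤ 1 / √(m : ℝ))]
    refine mul_le_mul_of_nonneg_left ?_ (abs_nonneg _)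
    calc _ ≤ 1 / √(m : ℝ) * B * 1 * M := by
          gcongr
          · exact hb i
          · exact abs_step_le_one _
          · exact hy j
      _ = _ := by ring
  refine this.trans ?_
  rw [← Finset.sum_mul]
  rcases isEmpty_or_nonempty (Fin n₁ × Fin n₂) with h | ⟨⟨i, j⟩⟩
  · simp
  have hB := (abs_nonneg _).trans (hb i)
  have hM := (norm_nonneg _).trans (hy j)
  calc _ ≤ (√(Fintype.card (Fin n₁ × Fin n₂) : ℝ) * ‖resid a u y z θ‖) *
        (1 / √(m : ℝ) * (B * M)) := by gcongr; exact sum_abs_le_sqrt_card_mul_norm _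
    _ = _ := by ring

/-- Same estimate as for the trunk, except that the gradient carries the extra factor `1 / √p`,
which matches the scale on which branch displacements are measured. -/
lemma norm_gdStep_snd_sub_le (hm : 0 < m) {a : Signs m p} (ha : ∀ r k, a r k ^ 2 = 1)
    {u : Fin n₁ → EuclideanSpace ℝ (Fin q)}
    {y : Fin n₂ → EuclideanSpace ℝ (Fin d)} (z : Fin n₁ → Fin n₂ → ℝ) {η : ℝ} (hη : 0 ≤ η)
    {θ : Weights m p d q} {B M : ℝ} (r : Fin m) (k : Fin p) (hb : ∀ j, |inner ℝ (θ.1 r) (y j)| ≤ B)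
    (hu : ∀ i, ‖u i‖ ≤ M) :
    ‖(gdStep a u y z η θ).2 r k - θ.2 r k‖ ≤
      η * (B * M * (√(Fintype.card (Fin n₁ × Fin n₂) : ℝ) / √(m : ℝ)) * ‖resid a u y z θ‖)
        / √(p : ℝ) := by
  have hm' : (0 : ℝ) < m := by exact_mod_cast hm
  simp only [gdStep, sub_sub_cancel_left]
  rw [norm_neg, norm_smul, Real.norm_of_nonneg hη, mul_div_assoc]
  refine mul_le_mul_of_nonneg_left ?_ hη
  have : ‖∑ i, ∑ j, (G a θ (u i) (y j) - z i j) • gradBranch a θ (u i) (y j) r k‖ ≤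
      ∑ ij : Fin n₁ × Fin n₂, |resid a u y z θ ij| * (1 / √(m : ℝ) * (1 / √(p : ℝ)) * (B * M)) := by
    rw [Fintype.sum_prod_type]
    refine (norm_sum_le _ _).trans (Finset.sum_le_sum fun i _ =>
      (norm_sum_le _ _).trans (Finset.sum_le_sum fun j _ => ?_))
    have hB := (abs_nonneg _).trans (hb j)
    rw [norm_smul, Real.norm_eq_abs, resid_apply, gradBranch, norm_smul, Real.norm_eq_abs, abs_mul,
      abs_mul, abs_mul, abs_of_nonneg (by positivity : 0 ≤ 1 / √(m : ℝ)), abs_div,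
      abs_eq_one_of_sq (ha r k), abs_of_nonneg (Real.sqrt_nonneg (p : ℝ))]
    refine mul_le_mul_of_nonneg_left ?_ (abs_nonneg _)
    calc _ ≤ 1 / √(m : ℝ) * (1 / √(p : ℝ)) * 1 * B * M := by
          gcongr
          · exact abs_step_le_one _
          · exact (abs_relu_le _).trans (hb j)
          · exact hu i
      _ = _ := by ring
  refine this.trans ?_
  rw [← Finset.sum_mul]
  rcases isEmpty_or_nonempty (Fin n₁ × Fin n₂) with h | ⟨⟨i, j⟩⟩
  · simp
  have hB := (abs_nonneg _).trans (hb j)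
  have hM := (norm_nonneg _).trans (hu i)
  calc _ ≤ (√(Fintype.card (Fin n₁ × Fin n₂) : ℝ) * ‖resid a u y z θ‖) *
        (1 / √(m : ℝ) * (1 / √(p : ℝ)) * (B * M)) := by
          gcongr; exact sum_abs_le_sqrt_card_mul_norm _
    _ = _ := by ring

end Training

/-! ### Deterministic convergence from a good initialization -/

section Contraction

variable {m p d q n₁ n₂ : ℕ}

/-- Initializations from which gradient descent stays in the linearized regime: neurons are of
size at most `B`, few of them can change sign within distance `R`, and the empirical tangent
kernel is entrywise `ε`-close to its limit. -/
structure WellInit (a : Signs m p) (u : Fin n₁ → EuclideanSpace ℝ (Fin q))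
    (y : Fin n₂ → EuclideanSpace ℝ (Fin d)) (B R ε : ℝ) (θ₀ : Weights m p d q) : Prop where
  sign_sq : ∀ r k, a r k ^ 2 = 1
  branch_le : ∀ i r, |branch a θ₀ (u i) r| ≤ B
  trunk_le : ∀ j r, |inner ℝ (θ₀.1 r) (y j)| ≤ B
  near_trunk : ∀ j, ∑ r, near R (y j) (θ₀.1 r) ≤ 2 * R * m
  near_branch : ∀ i, ∑ r, (1 / (p : ℝ)) * ∑ k, near R (u i) (θ₀.2 r k) ≤ 2 * R * m
  kerTrunk_le : ∀ i i' j j',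
    |kerTrunk a θ₀ (u i) (u i') (y j) (y j') - Hinf u y (i, j) (i', j')| ≤ ε
  kerBranch_le : ∀ i i' j j',
    |kerBranch θ₀ (u i) (u i') (y j) (y j') - Htinf u y (i, j) (i', j')| ≤ ε

variable {a : Signs m p} {u : Fin n₁ → EuclideanSpace ℝ (Fin q)}
  {y : Fin n₂ → EuclideanSpace ℝ (Fin d)} {z : Fin n₁ → Fin n₂ → ℝ} {B R ε η lam M E₀ : ℝ}
  {θ₀ θ : Weights m p d q}

lemma div_sqrt_nat_le {p : ℕ} {R : ℝ} (hR : 0 ≤ R) (hp : 0 < p) : R / √(p : ℝ) ≤ R := by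
  refine div_le_self hR ?_
  rw [Real.one_le_sqrt]
  exact_mod_cast hp

lemma WellInit.abs_branch_le (h : WellInit a u y B R ε θ₀) (hp : 0 < p) (hR : 0 ≤ R)
    (hu : ∀ i, ‖u i‖ ≤ M) (hRM : R * M ≤ B)
    (hθ2 : ∀ r k, ‖θ.2 r k - θ₀.2 r k‖ ≤ R / √(p : ℝ)) (i : Fin n₁) (r : Fin m) :
    |branch a θ (u i) r| ≤ 2 * B := by
  have := abs_branch_sub_le h.sign_sq hp (hθ2 r) (u i)
  have := mul_le_mul_of_nonneg_left (hu i) hR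
  linarith [abs_sub_abs_le_abs_sub (branch a θ (u i) r) (branch a θ₀ (u i) r), h.branch_le i r]

lemma WellInit.abs_trunk_le (h : WellInit a u y B R ε θ₀)
    (hy : ∀ j, ‖y j‖ ≤ M) (hRM : R * M ≤ B) (hR : 0 ≤ R)
    (hθ1 : ∀ r, ‖θ.1 r - θ₀.1 r‖ ≤ R) (j : Fin n₂) (r : Fin m) :
    |inner ℝ (θ.1 r) (y j)| ≤ 2 * B := by
  have := abs_inner_sub_inner_le (y j) (θ₀.1 r) (θ.1 r)
  have := mul_le_mul (hθ1 r) (hy j) (norm_nonneg _) hR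
  linarith [abs_sub_abs_le_abs_sub (inner ℝ (θ.1 r) (y j)) (inner ℝ (θ₀.1 r) (y j)),
    h.trunk_le j r]

lemma WellInit.abs_ker_sub_le (h : WellInit a u y B R ε θ₀) (hm : 0 < m) (hp : 0 < p) (hR : 0 ≤ R)
    (hM : 1 ≤ M) (hB : 1 ≤ B) (hu : ∀ i, ‖u i‖ ≤ M) (hy : ∀ j, ‖y j‖ ≤ M) (hRM : R * M ≤ B)
    (hθ1 : ∀ r, ‖θ.1 r - θ₀.1 r‖ ≤ R) (hθ2 : ∀ r k, ‖θ.2 r k - θ₀.2 r k‖ ≤ R / √(p : ℝ))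
    (i i' : Fin n₁) (j j' : Fin n₂) :
    |kerTrunk a θ (u i) (u i') (y j) (y j') + kerBranch θ (u i) (u i') (y j) (y j') -
      (Hinf u y + Htinf u y) (i, j) (i', j')| ≤ 2 * ε + 14 * M ^ 3 * B ^ 2 * R := by
  have hb : ∀ i r, |branch a θ (u i) r - branch a θ₀ (u i) r| ≤ R * M := fun i r =>
    (abs_branch_sub_le h.sign_sq hp (hθ2 r) (u i)).trans (by gcongr; exact hu i)
  have hs : ∀ j r, |relu (inner ℝ (θ.1 r) (y j)) - relu (inner ℝ (θ₀.1 r) (y j))| ≤ R * M :=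
    fun j r => (abs_relu_inner_sub_le _ _ _).trans
      (mul_le_mul (hθ1 r) (hy j) (norm_nonneg _) hR)
  have t1 := abs_kerTrunk_sub_le (a := a) hm (hy j) (hy j') hθ1 (h.branch_le i) (h.branch_le i')
    (hb i) (hb i') hRM (h.near_trunk j) (h.near_trunk j')
  have t2 := abs_kerBranch_sub_le hm hp (hu i) (hu i')
    (fun r k => (hθ2 r k).trans (div_sqrt_nat_le hR hp)) (h.trunk_le j) (h.trunk_le j')
    (hs j) (hs j') hRM (h.near_branch i) (h.near_branch i')
  have t3 := h.kerTrunk_le i i' j j'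
  have t4 := h.kerBranch_le i i' j j'
  have t5 : M ^ 2 * (3 * B * (R * M) + 4 * B ^ 2 * R) ≤ 7 * M ^ 3 * B ^ 2 * R := by
    have e1 : M ^ 3 * R * B ≤ M ^ 3 * R * B ^ 2 := by
      apply mul_le_mul_of_nonneg_left _ (by positivity); nlinarith
    have e2 : B ^ 2 * R * M ^ 2 ≤ B ^ 2 * R * M ^ 3 := by
      apply mul_le_mul_of_nonneg_left _ (by positivity)
      exact pow_le_pow_right₀ hM (by norm_num)
    nlinarith
  rw [abs_le] at *
  rw [Matrix.add_apply]
  constructor <;> linarith [t1.1, t1.2, t2.1, t2.2, t3.1, t3.2, t4.1, t4.2]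

/-- One step of gradient descent contracts the residual as long as the weights stay close to
their initial values. -/
lemma WellInit.norm_resid_gdStep_le (h : WellInit a u y B R ε θ₀) (hn : 0 < n₁ * n₂)
    (hm : 0 < m) (hp : 0 < p)
    (hR : 0 ≤ R) (hM : 1 ≤ M) (hB : 1 ≤ B) (hu : ∀ i, ‖u i‖ ≤ M) (hy : ∀ j, ‖y j‖ ≤ M)
    (hRM : R * M ≤ B) (hη : 0 < η)
    (hlin : ∀ e : EuclideanSpace ℝ (Fin n₁ × Fin n₂),
      ‖e - η • Matrix.toEuclideanCLM (𝕜 := ℝ) (Hinf u y + Htinf u y) e‖ ≤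
        (1 - η * lam / 2) * ‖e‖)
    (hsmall : (n₁ * n₂ : ℝ) * (2 * ε + 14 * M ^ 3 * B ^ 2 * R) +
      20 * (n₁ * n₂) * B ^ 2 * R * M ^ 3 ≤ lam / 8)
    (hθ1 : ∀ r, ‖θ.1 r - θ₀.1 r‖ ≤ R) (hθ2 : ∀ r k, ‖θ.2 r k - θ₀.2 r k‖ ≤ R / √(p : ℝ))
    (hθ1' : ∀ r, ‖(gdStep a u y z η θ).1 r - θ₀.1 r‖ ≤ R)
    (hθ2' : ∀ r k, ‖(gdStep a u y z η θ).2 r k - θ₀.2 r k‖ ≤ R / √(p : ℝ)) :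
    ‖resid a u y z (gdStep a u y z η θ)‖ ≤ (1 - 3 / 8 * (η * lam)) * ‖resid a u y z θ‖ := by
  set θ' := gdStep a u y z η θ with hθ'
  set e := resid a u y z θ with he
  set A := Matrix.toEuclideanCLM (𝕜 := ℝ) (Hinf u y + Htinf u y) with hA
  have hm' : (0 : ℝ) < m := by exact_mod_cast hm
  have hB' := h.abs_branch_le hp hR hu hRM hθ2
  have hS' := h.abs_trunk_le hy hRM hR hθ1
  have hcard : (Fintype.card (Fin n₁ × Fin n₂) : ℝ) = n₁ * n₂ := by simp
  have hn0 : (0 : ℝ) < n₁ * n₂ := by exact_mod_cast hn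
  set n : ℝ := n₁ * n₂ with hn'
  set D := η * (2 * B * M * (√n / √(m : ℝ)) * ‖e‖) with hD
  have hD0 : 0 ≤ D := by positivity
  have hstep1 : ∀ r, ‖θ'.1 r - θ.1 r‖ ≤ D := fun r => by
    have := norm_gdStep_fst_sub_le hm z hη.le (θ := θ) r (fun i => hB' i r) hy
    rwa [hcard] at this
  have hstep2 : ∀ r k, ‖θ'.2 r k - θ.2 r k‖ ≤ D / √(p : ℝ) := fun r k => by
    have := norm_gdStep_snd_sub_le hm h.sign_sq z hη.le (θ := θ) r k (fun j => hS' j r) hu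
    rwa [hcard] at this
  -- A cruder bound than `hstep2`, by the triangle inequality through `θ₀`. It serves as `R'` in the
  -- Taylor estimate and turns the product of the two increments into a term of order `D R`.
  have hstep3 : ∀ r k, ‖θ'.2 r k - θ.2 r k‖ ≤ 2 * R / √(p : ℝ) := fun r k => by
    have e1 : θ'.2 r k - θ.2 r k = (θ'.2 r k - θ₀.2 r k) - (θ.2 r k - θ₀.2 r k) := by abel
    rw [e1, two_mul, add_div]
    exact (norm_sub_le _ _).trans (add_le_add (hθ2' r k) (hθ2 r k))
  set β := 2 * ε + 14 * M ^ 3 * B ^ 2 * R with hβ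
  have hF : ∀ ij, |(resid a u y z θ' - (e - η • A e)) ij| ≤
      η * ‖e‖ * √n * (20 * B ^ 2 * M ^ 3 * R + β) := by
    rintro ⟨i, j⟩
    have tay := abs_G_taylor_le h.sign_sq hm hp hD0 hθ1 hθ1'
      (fun r k => (hθ2 r k).trans (div_sqrt_nat_le hR hp))
      (fun r k => (hθ2' r k).trans (div_sqrt_nat_le hR hp)) hstep1 hstep2 hstep3 (hu i) (hy j)
      (hB' i) (hS' j) (h.near_trunk j) (h.near_branch i)
    have hlinG := linG_gdStep h.sign_sq u y z η θ i j
    have hAe : (A e) (i, j) = ∑ i', ∑ j', (Hinf u y + Htinf u y) (i, j) (i', j') *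
        (G a θ (u i') (y j') - z i' j') := by
      rw [hA, Matrix.ofLp_toEuclideanCLM]
      simp only [Matrix.mulVec, dotProduct, Fintype.sum_prod_type]
      rfl
    -- The deviation from the ideal step splits into the Taylor remainder of the network and the
    -- error from replacing the current kernel by its limit.
    have eF : (resid a u y z θ' - (e - η • A e)) (i, j) =
        (G a θ' (u i) (y j) - G a θ (u i) (y j) - linG a θ θ' (u i) (y j)) +
        -η * ∑ i', ∑ j', (kerTrunk a θ (u i) (u i') (y j) (y j') +
          kerBranch θ (u i) (u i') (y j) (y j') - (Hinf u y + Htinf u y) (i, j) (i', j')) *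
          (G a θ (u i') (y j') - z i' j') := by
      rw [PiLp.sub_apply, PiLp.sub_apply, PiLp.smul_apply, hAe, hlinG, he, resid_apply,
        resid_apply]
      simp only [sub_mul, Finset.sum_sub_distrib, smul_eq_mul]
      ring
    have hker : |∑ i', ∑ j', (kerTrunk a θ (u i) (u i') (y j) (y j') +
          kerBranch θ (u i) (u i') (y j) (y j') - (Hinf u y + Htinf u y) (i, j) (i', j')) *
          (G a θ (u i') (y j') - z i' j')| ≤ β * (√n * ‖e‖) := by
      have hβ0 : 0 ≤ β := (abs_nonneg _).trans
        (h.abs_ker_sub_le hm hp hR hM hB hu hy hRM hθ1 hθ2 i i j j)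
      have hs := sum_abs_le_sqrt_card_mul_norm e
      rw [hcard] at hs
      refine le_trans ?_ (mul_le_mul_of_nonneg_left hs hβ0)
      rw [Finset.mul_sum, Fintype.sum_prod_type]
      refine (Finset.abs_sum_le_sum_abs _ _).trans (Finset.sum_le_sum fun i' _ =>
        (Finset.abs_sum_le_sum_abs _ _).trans (Finset.sum_le_sum fun j' _ => ?_))
      rw [abs_mul]
      exact mul_le_mul_of_nonneg_right
        (h.abs_ker_sub_le hm hp hR hM hB hu hy hRM hθ1 hθ2 i i' j j') (abs_nonneg _)
    rw [eF]
    refine (abs_add_le _ _).trans ?_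
    rw [abs_mul, abs_neg, abs_of_pos hη]
    have e3 : √(m : ℝ) * D = η * ‖e‖ * √n * (2 * B * M) := by
      rw [hD]; field_simp
    have e4 : 2 * B * M * (4 * (2 * B) * M * R + 2 * R * M ^ 2) ≤ 20 * B ^ 2 * M ^ 3 * R := by
      have a1 : B * (R * M ^ 3) ≤ B ^ 2 * (R * M ^ 3) := by
        apply mul_le_mul_of_nonneg_right _ (by positivity); nlinarith
      have a2 : B ^ 2 * R * M ^ 2 ≤ B ^ 2 * R * M ^ 3 := by
        apply mul_le_mul_of_nonneg_left _ (by positivity)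
        exact pow_le_pow_right₀ hM (by norm_num)
      nlinarith
    rw [e3] at tay
    have hc : 0 ≤ η * ‖e‖ * √n := by positivity
    calc _ ≤ η * ‖e‖ * √n * (2 * B * M) * (4 * (2 * B) * M * R + 2 * R * M ^ 2) +
          η * (β * (√n * ‖e‖)) := add_le_add tay (mul_le_mul_of_nonneg_left hker hη.le)
      _ = η * ‖e‖ * √n * (2 * B * M * (4 * (2 * B) * M * R + 2 * R * M ^ 2) + β) := by ring
      _ ≤ _ := by gcongr
  have hβ0 : 0 ≤ η * ‖e‖ * √n * (20 * B ^ 2 * M ^ 3 * R + β) := by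
    have : Nonempty (Fin n₁ × Fin n₂) := by
      rw [← Fintype.card_pos_iff]; simpa using hn
    exact (abs_nonneg _).trans (hF (Classical.arbitrary _))
  have hFn := norm_le_sqrt_card_mul hF hβ0
  rw [hcard] at hFn
  have e5 : √n * (η * ‖e‖ * √n * (20 * B ^ 2 * M ^ 3 * R + β)) =
      η * ‖e‖ * (n * β + 20 * n * B ^ 2 * R * M ^ 3) := by
    have := Real.mul_self_sqrt hn0.le
    linear_combination (η * ‖e‖ * (20 * B ^ 2 * M ^ 3 * R + β)) * this
  have e6 : ‖resid a u y z θ'‖ ≤ ‖resid a u y z θ' - (e - η • A e)‖ + ‖e - η • A e‖ := by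
    have := norm_add_le (resid a u y z θ' - (e - η • A e)) (e - η • A e)
    rwa [sub_add_cancel] at this
  have e7 : η * ‖e‖ * (n * β + 20 * n * B ^ 2 * R * M ^ 3) ≤ η * ‖e‖ * (lam / 8) :=
    mul_le_mul_of_nonneg_left hsmall (by positivity)
  have := hlin e
  rw [e5] at hFn
  -- The ideal factor `1 - η lam / 2` loses at most `η lam / 8`, which leaves `1 - 3 / 8 * (η lam)`.
  nlinarith

/-- Convergence of gradient descent from a good initialization. -/
theorem WellInit.gd_converges (h : WellInit a u y B R ε θ₀) (hn : 0 < n₁ * n₂)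
    (hm : 0 < m) (hp : 0 < p)
    (hR : 0 ≤ R) (hM : 1 ≤ M) (hB : 1 ≤ B) (hu : ∀ i, ‖u i‖ ≤ M) (hy : ∀ j, ‖y j‖ ≤ M)
    (hRM : R * M ≤ B) (hη : 0 < η) (hlam : 0 < lam) (hηlam : η * lam ≤ 1)
    (hlin : ∀ e : EuclideanSpace ℝ (Fin n₁ × Fin n₂),
      ‖e - η • Matrix.toEuclideanCLM (𝕜 := ℝ) (Hinf u y + Htinf u y) e‖ ≤
        (1 - η * lam / 2) * ‖e‖)
    (hsmall : (n₁ * n₂ : ℝ) * (2 * ε + 14 * M ^ 3 * B ^ 2 * R) +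
      20 * (n₁ * n₂) * B ^ 2 * R * M ^ 3 ≤ lam / 8)
    (h0 : ‖resid a u y z θ₀‖ ≤ E₀)
    (hmove : 2 * B * M * (√(n₁ * n₂ : ℝ) / √(m : ℝ)) * E₀ ≤ 3 / 8 * lam * R) (t : ℕ) :
    sqResidual a u y z (gd a u y z η θ₀ t) ≤
      (1 - η * (lam / 2)) ^ t * sqResidual a u y z θ₀ := by
  set g := 1 - 3 / 8 * (η * lam) with hg
  have hg0 : 0 ≤ g := by linarith
  have hg1 : g ≤ 1 := by nlinarith
  -- The displacement bound `R * (1 - g ^ t)` is the partial sum of the geometric series of step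
  -- lengths. Carrying it in the induction, instead of just `R`, is what makes the induction close.
  have key : ∀ t, ‖resid a u y z (gd a u y z η θ₀ t)‖ ≤ g ^ t * ‖resid a u y z θ₀‖ ∧
      (∀ r, ‖(gd a u y z η θ₀ t).1 r - θ₀.1 r‖ ≤ R * (1 - g ^ t)) ∧
      ∀ r k, ‖(gd a u y z η θ₀ t).2 r k - θ₀.2 r k‖ ≤ R * (1 - g ^ t) / √(p : ℝ) := by
    intro t
    induction t with
    | zero => simp [gd]
    | succ t ih =>
      obtain ⟨i1, i2, i3⟩ := ih
      set θ := gd a u y z η θ₀ t with hθ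
      have hgt : 0 ≤ g ^ t := pow_nonneg hg0 t
      have hle : ∀ t, R * (1 - g ^ t) ≤ R := fun t => by
        have : 0 ≤ g ^ t := pow_nonneg hg0 t
        nlinarith
      have hθ1 : ∀ r, ‖θ.1 r - θ₀.1 r‖ ≤ R := fun r => (i2 r).trans (hle t)
      have hθ2 : ∀ r k, ‖θ.2 r k - θ₀.2 r k‖ ≤ R / √(p : ℝ) := fun r k =>
        (i3 r k).trans (by gcongr; exact hle t)
      have hcard : (Fintype.card (Fin n₁ × Fin n₂) : ℝ) = n₁ * n₂ := by simp
      -- Since `1 - g = 3 / 8 * (η * lam)`, the condition `hmove` says exactly that a step at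
      -- residual `g ^ t * E₀` costs at most the share `R * (g ^ t - g ^ (t + 1))` of the radius.
      have hD : η * (2 * B * M * (√(n₁ * n₂ : ℝ) / √(m : ℝ)) * ‖resid a u y z θ‖) ≤
          R * (g ^ t - g ^ (t + 1)) := by
        calc _ ≤ η * (2 * B * M * (√(n₁ * n₂ : ℝ) / √(m : ℝ)) * (g ^ t * E₀)) := by
              gcongr
              exact i1.trans (mul_le_mul_of_nonneg_left h0 hgt)
          _ = η * g ^ t * (2 * B * M * (√(n₁ * n₂ : ℝ) / √(m : ℝ)) * E₀) := by ring
          _ ≤ η * g ^ t * (3 / 8 * lam * R) := by gcongr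
          _ = _ := by rw [pow_succ, hg]; ring
      have s1 : ∀ r, ‖(gdStep a u y z η θ).1 r - θ₀.1 r‖ ≤ R * (1 - g ^ (t + 1)) := fun r => by
        have := norm_gdStep_fst_sub_le hm z hη.le (θ := θ) r
          (fun i => h.abs_branch_le hp hR hu hRM hθ2 i r) hy
        rw [hcard] at this
        have e1 : (gdStep a u y z η θ).1 r - θ₀.1 r =
          ((gdStep a u y z η θ).1 r - θ.1 r) + (θ.1 r - θ₀.1 r) := by abel
        rw [e1]
        refine (norm_add_le _ _).trans ((add_le_add (this.trans hD) (i2 r)).trans (le_of_eq ?_))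
        ring
      have s2 : ∀ r k, ‖(gdStep a u y z η θ).2 r k - θ₀.2 r k‖ ≤
          R * (1 - g ^ (t + 1)) / √(p : ℝ) := fun r k => by
        have := norm_gdStep_snd_sub_le hm h.sign_sq z hη.le (θ := θ) r k
          (fun j => h.abs_trunk_le hy hRM hR hθ1 j r) hu
        rw [hcard] at this
        have e1 : (gdStep a u y z η θ).2 r k - θ₀.2 r k =
          ((gdStep a u y z η θ).2 r k - θ.2 r k) + (θ.2 r k - θ₀.2 r k) := by abel
        rw [e1]
        refine (norm_add_le _ _).trans ((add_le_add (this.trans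
          (div_le_div_of_nonneg_right hD (Real.sqrt_nonneg _))) (i3 r k)).trans (le_of_eq ?_))
        ring
      refine ⟨?_, s1, s2⟩
      have := h.norm_resid_gdStep_le (z := z) hn hm hp hR hM hB hu hy hRM hη hlin hsmall hθ1 hθ2
        (fun r => (s1 r).trans (hle _)) (fun r k => (s2 r k).trans (by gcongr; exact hle _))
      calc _ ≤ g * ‖resid a u y z θ‖ := this
        _ ≤ g * (g ^ t * ‖resid a u y z θ₀‖) := by gcongr
        _ = _ := by ring
  rw [← norm_resid_sq, ← norm_resid_sq]
  calc _ ≤ (g ^ t * ‖resid a u y z θ₀‖) ^ 2 := pow_le_pow_left₀ (norm_nonneg _) (key t).1 2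
    _ = (g ^ 2) ^ t * ‖resid a u y z θ₀‖ ^ 2 := by
      rw [mul_pow, ← pow_mul, ← pow_mul, mul_comm t 2]
    _ ≤ _ := by
      gcongr
      rw [hg]
      -- With `x = η * lam ≤ 1`, the square `(1 - 3 x / 8) ^ 2 = 1 - 3 x / 4 + 9 x ^ 2 / 64` is at
      -- most `1 - x / 2`.
      nlinarith [mul_pos hη hlam]

end Contraction

/-! ### Least eigenvalue, spectral norm and contraction by a positive matrix -/

section Spectral

variable {ι : Type*} [Fintype ι] [DecidableEq ι]

lemma toEuclideanCLM_eigenvectorBasis {A : Matrix ι ι ℝ} (hA : A.IsHermitian) (i : ι) :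
    Matrix.toEuclideanCLM (𝕜 := ℝ) A (hA.eigenvectorBasis i) =
      hA.eigenvalues i • hA.eigenvectorBasis i := by
  ext j
  rw [Matrix.ofLp_toEuclideanCLM, hA.mulVec_eigenvectorBasis]
  rfl

lemma inner_toEuclideanCLM_comm {A : Matrix ι ι ℝ} (hA : A.IsHermitian)
    (x y : EuclideanSpace ℝ ι) :
    inner ℝ x (Matrix.toEuclideanCLM (𝕜 := ℝ) A y) =
      inner ℝ (Matrix.toEuclideanCLM (𝕜 := ℝ) A x) y := by
  simp only [EuclideanSpace.inner_eq_star_dotProduct, Matrix.ofLp_toEuclideanCLM, star_trivial]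
  rw [Matrix.dotProduct_mulVec, ← Matrix.mulVec_transpose, dotProduct_comm,
    ← Matrix.conjTranspose_eq_transpose_of_trivial, hA.eq, dotProduct_comm]

lemma inner_eigenvectorBasis_toEuclideanCLM {A : Matrix ι ι ℝ} (hA : A.IsHermitian) (i : ι)
    (x : EuclideanSpace ℝ ι) :
    inner ℝ (hA.eigenvectorBasis i) (Matrix.toEuclideanCLM (𝕜 := ℝ) A x) =
      hA.eigenvalues i * inner ℝ (hA.eigenvectorBasis i) x := by
  rw [inner_toEuclideanCLM_comm hA, toEuclideanCLM_eigenvectorBasis, real_inner_smul_left]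

lemma leastEigenvalue_eq {A : Matrix ι ι ℝ} (hA : A.IsHermitian) :
    leastEigenvalue A = sInf (Set.range hA.eigenvalues) := by
  rw [← hA.spectrum_real_eq_range_eigenvalues, ← Matrix.spectrum_toLin']
  unfold leastEigenvalue
  refine congrArg sInf (Set.ext fun μ => ?_)
  exact Module.End.hasEigenvalue_iff_mem_spectrum

lemma leastEigenvalue_le_eigenvalues {A : Matrix ι ι ℝ} (hA : A.IsHermitian) (i : ι) :
    leastEigenvalue A ≤ hA.eigenvalues i := by
  rw [leastEigenvalue_eq hA]
  exact csInf_le (Set.finite_range _).bddBelow ⟨i, rfl⟩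

lemma leastEigenvalue_pos [Nonempty ι] {A : Matrix ι ι ℝ} (hA : A.PosDef) :
    0 < leastEigenvalue A := by
  rw [leastEigenvalue_eq hA.isHermitian]
  obtain ⟨i, hi⟩ := (Set.range_nonempty hA.isHermitian.eigenvalues).csInf_mem (Set.finite_range _)
  rw [← hi]
  exact hA.eigenvalues_pos i

lemma leastEigenvalue_mul_norm_sq_le {A : Matrix ι ι ℝ} (hA : A.IsHermitian)
    (x : EuclideanSpace ℝ ι) :
    leastEigenvalue A * ‖x‖ ^ 2 ≤ inner ℝ x (Matrix.toEuclideanCLM (𝕜 := ℝ) A x) := by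
  rw [← hA.eigenvectorBasis.sum_sq_inner_right x, ← hA.eigenvectorBasis.sum_inner_mul_inner,
    Finset.mul_sum]
  refine Finset.sum_le_sum fun i _ => ?_
  rw [inner_eigenvectorBasis_toEuclideanCLM, real_inner_comm]
  nlinarith [leastEigenvalue_le_eigenvalues hA i, sq_nonneg (inner ℝ (hA.eigenvectorBasis i) x)]

/-- Compare the quadratic form with the operator norm on one basis vector. This lets the step-size
condition on the spectral norms also give `η * (lam + lamt) ≤ 1`. -/
lemma leastEigenvalue_le_specNorm [Nonempty ι] {A : Matrix ι ι ℝ} (hA : A.IsHermitian) :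
    leastEigenvalue A ≤ specNorm A := by
  have i := Classical.arbitrary ι
  have h := leastEigenvalue_mul_norm_sq_le hA (EuclideanSpace.single i 1)
  have h1 : ‖(EuclideanSpace.single i 1 : EuclideanSpace ℝ ι)‖ = 1 := by simp
  have h2 := real_inner_le_norm (EuclideanSpace.single i 1 : EuclideanSpace ℝ ι)
    (Matrix.toEuclideanCLM (𝕜 := ℝ) A (EuclideanSpace.single i 1))
  have h3 := (Matrix.toEuclideanCLM (𝕜 := ℝ) A).le_opNorm (EuclideanSpace.single i 1)
  rw [h1] at h h2 h3
  unfold specNorm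
  linarith

/-- Rayleigh quotient at a basis vector. It is used to bound the least eigenvalues above by a power
of `M`, so that powers of the spectrum can be traded for powers of `M` in the width condition. -/
lemma leastEigenvalue_le_diag {A : Matrix ι ι ℝ} (hA : A.IsHermitian) (i : ι) :
    leastEigenvalue A ≤ A i i := by
  have h := leastEigenvalue_mul_norm_sq_le hA (EuclideanSpace.single i 1)
  rw [EuclideanSpace.inner_single_left, Matrix.ofLp_toEuclideanCLM] at h
  simpa using h

/-- A gradient step for a quadratic form with spectrum in `[lam, N]` and `η N ≤ 1` contracts. -/
lemma norm_sub_smul_toEuclideanCLM_le {A : Matrix ι ι ℝ} (hA : A.IsHermitian) {lam η N : ℝ}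
    (hl : ∀ x : EuclideanSpace ℝ ι,
      lam * ‖x‖ ^ 2 ≤ inner ℝ x (Matrix.toEuclideanCLM (𝕜 := ℝ) A x))
    (hN : specNorm A ≤ N) (hη : 0 ≤ η) (hηN : η * N ≤ 1) (hηl : η * lam ≤ 1)
    (x : EuclideanSpace ℝ ι) :
    ‖x - η • Matrix.toEuclideanCLM (𝕜 := ℝ) A x‖ ≤ (1 - η * lam) * ‖x‖ := by
  apply le_of_sq_le_sq _ (mul_nonneg (by linarith) (norm_nonneg _))
  rw [mul_pow, ← hA.eigenvectorBasis.sum_sq_inner_right x,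
    ← hA.eigenvectorBasis.sum_sq_inner_right (x - _), Finset.mul_sum]
  refine Finset.sum_le_sum fun i _ => ?_
  rw [inner_sub_right, real_inner_smul_right, inner_eigenvectorBasis_toEuclideanCLM]
  have hb : ‖hA.eigenvectorBasis i‖ = 1 := hA.eigenvectorBasis.orthonormal.1 i
  have h1 : lam ≤ hA.eigenvalues i := by
    have := hl (hA.eigenvectorBasis i)
    rw [inner_eigenvectorBasis_toEuclideanCLM, real_inner_self_eq_norm_sq, hb] at this
    simpa using this
  have h2 : hA.eigenvalues i ≤ N := by
    have := (Matrix.toEuclideanCLM (𝕜 := ℝ) A).le_opNorm (hA.eigenvectorBasis i)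
    rw [toEuclideanCLM_eigenvectorBasis, norm_smul, hb, mul_one, mul_one, Real.norm_eq_abs] at this
    exact (le_abs_self _).trans (this.trans hN)
  have e : inner ℝ (hA.eigenvectorBasis i) x - η * (hA.eigenvalues i *
      inner ℝ (hA.eigenvectorBasis i) x) =
      (1 - η * hA.eigenvalues i) * inner ℝ (hA.eigenvectorBasis i) x := by ring
  rw [e, mul_pow]
  have h3 := mul_le_mul_of_nonneg_left h1 hη
  have h4 := mul_le_mul_of_nonneg_left h2 hη
  exact mul_le_mul_of_nonneg_right (pow_le_pow_left₀ (by linarith) (by linarith) 2) (sq_nonneg _)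

lemma specNorm_add_le (A B : Matrix ι ι ℝ) : specNorm (A + B) ≤ specNorm A + specNorm B := by
  unfold specNorm; rw [map_add]; exact norm_add_le _ _

end Spectral

/-! ### Strict positivity of the limiting Gram matrices -/

section Positivity

lemma measurable_relu : Measurable relu := measurable_id.max measurable_const

lemma measurable_step : Measurable step :=
  Measurable.ite measurableSet_Ici measurable_const measurable_const

lemma continuous_relu : Continuous relu := continuous_id.max continuous_const

/-- The coordinates have everywhere positive densities. The instance upgrades an almost sure
identity to a pointwise one wherever the function is continuous. -/
instance isOpenPosMeasure_stdGaussian {e : ℕ} :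
    (stdGaussian (EuclideanSpace ℝ (Fin e))).IsOpenPosMeasure := by
  rw [← map_pi_eq_stdGaussian]
  have : (gaussianReal 0 1).IsOpenPosMeasure :=
    (gaussianReal_absolutelyContinuous' 0 one_ne_zero).isOpenPosMeasure
  exact (PiLp.continuous_toLp 2 _).isOpenPosMeasure_map (WithLp.toLp_surjective 2)

/-- The quadratic form at `x` is the second moment of `∑ i, x i • f i`, so definiteness is linear
independence of the `f i` modulo null sets. The target is a general inner product space because the
indicator kernel needs the vector-valued features `step ⟪w, v i⟫ • v i`. -/
lemma posDef_integral_inner {Ω F : Type*} [MeasurableSpace Ω] {μ : Measure Ω}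
    [NormedAddCommGroup F] [InnerProductSpace ℝ F] {n : ℕ} {f : Fin n → Ω → F}
    (hf : ∀ i, MemLp (f i) 2 μ)
    (hind : ∀ x : Fin n → ℝ, (∀ᵐ ω ∂μ, ∑ i, x i • f i ω = 0) → x = 0) :
    (Matrix.of fun i j => ∫ ω, inner ℝ (f i ω) (f j ω) ∂μ).PosDef := by
  refine Matrix.PosDef.of_dotProduct_mulVec_pos ?_ fun x hx => ?_
  · ext i j
    simp [real_inner_comm]
  have hint : ∀ i j, Integrable (fun ω => inner ℝ (f i ω) (f j ω)) μ := fun i j =>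
    ((hf i).norm.integrable_mul (hf j).norm).mono ((hf i).1.inner (hf j).1)
      (Filter.Eventually.of_forall fun ω => by
        simpa using norm_inner_le_norm (𝕜 := ℝ) (f i ω) (f j ω))
  have e : star x ⬝ᵥ (Matrix.of fun i j => ∫ ω, inner ℝ (f i ω) (f j ω) ∂μ).mulVec x =
      ∫ ω, ‖∑ i, x i • f i ω‖ ^ 2 ∂μ := by
    simp_rw [← real_inner_self_eq_norm_sq, sum_inner, inner_sum, real_inner_smul_left,
      real_inner_smul_right]
    rw [integral_finsetSum _ fun i _ => integrable_finsetSum _ fun j _ =>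
      ((hint i j).const_mul _).const_mul _]
    simp_rw [integral_finsetSum _ fun j _ => ((hint _ j).const_mul _).const_mul _,
      integral_const_mul]
    simp only [dotProduct, Matrix.mulVec, Matrix.of_apply, Finset.mul_sum, star_trivial]
    exact Finset.sum_congr rfl fun i _ => Finset.sum_congr rfl fun j _ => by ring
  rw [e]
  refine (integral_nonneg fun ω => by positivity).lt_of_ne fun h0 => hx (hind x ?_)
  have hL : MemLp (fun ω => ∑ i, x i • f i ω) 2 μ :=
    memLp_finsetSum _ fun i _ => (hf i).const_smul (x i)
  have h1 := (integral_eq_zero_iff_of_nonneg (fun ω => by positivity)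
    (by simpa using hL.integrable_norm_pow two_ne_zero)).mp h0.symm
  filter_upwards [h1] with ω hω
  simpa using hω

lemma eq_zero_of_ae_of_continuousAt {X F : Type*} [TopologicalSpace X] [MeasurableSpace X]
    [NormedAddCommGroup F] {μ : Measure X} [μ.IsOpenPosMeasure] {f : X → F}
    (h : ∀ᵐ x ∂μ, f x = 0) {x : X} (hc : ContinuousAt f x) : f x = 0 := by
  by_contra hx
  have h1 : {y | f y ≠ 0} ∈ nhds x := hc.eventually_ne hx
  exact (Measure.measure_pos_of_mem_nhds μ h1).ne' h

variable {n e : ℕ}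

/-- On the hyperplane orthogonal to `v i` there is a point off all the other hyperplanes. -/
lemma NoTwoParallel.exists_inner_eq_zero {v : Fin n → EuclideanSpace ℝ (Fin e)}
    (hv : NoTwoParallel v) (i : Fin n) :
    ∃ w : EuclideanSpace ℝ (Fin e), inner ℝ w (v i) = 0 ∧ ∀ j, j ≠ i → inner ℝ w (v j) ≠ 0 := by
  by_contra! hcon
  let K : Submodule ℝ (EuclideanSpace ℝ (Fin e)) := (ℝ ∙ v i)ᗮ
  have hK : ∀ w : EuclideanSpace ℝ (Fin e), w ∈ K ↔ inner ℝ w (v i) = 0 := fun w => by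
    rw [Submodule.mem_orthogonal_singleton_iff_inner_left]
  have hcov : (⋃ j : {j // j ≠ i}, (((ℝ ∙ v j)ᗮ.comap K.subtype : Submodule ℝ K) : Set K)) =
      Set.univ := by
    refine Set.eq_univ_of_forall fun w => ?_
    obtain ⟨j, hj, h0⟩ := hcon w ((hK _).mp w.2)
    refine Set.mem_iUnion.mpr ⟨⟨j, hj⟩, ?_⟩
    simpa [Submodule.mem_orthogonal_singleton_iff_inner_left] using h0
  -- A vector space over an infinite field is not a finite union of proper subspaces, so one of the
  -- other hyperplanes contains all of `K`. Taking orthogonal complements makes `v j` a multiple of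
  -- `v i`.
  obtain ⟨⟨j, hj⟩, htop⟩ := Subspace.exists_eq_top_of_iUnion_eq_univ hcov
  have hle : K ≤ (ℝ ∙ v j)ᗮ := fun w hw => by
    have : (⟨w, hw⟩ : K) ∈ ((ℝ ∙ v j)ᗮ.comap K.subtype : Submodule ℝ K) := htop ▸ trivial
    exact this
  have h2 := Submodule.orthogonal_le hle
  rw [Submodule.orthogonal_orthogonal, Submodule.orthogonal_orthogonal] at h2
  obtain ⟨c, hc⟩ := Submodule.mem_span_singleton.mp (h2 (Submodule.mem_span_singleton_self (v j)))
  have h3 := LinearIndependent.pair_iff.mp (hv.2 i j hj.symm) c (-1) (by rw [hc]; simp)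
  simpa using h3.2

/-- Points on both sides of the hyperplane `v i`, on the same side of all the others. -/
lemma NoTwoParallel.exists_crossing {v : Fin n → EuclideanSpace ℝ (Fin e)}
    (hv : NoTwoParallel v) (i : Fin n) :
    ∃ w h : EuclideanSpace ℝ (Fin e), inner ℝ w (v i) = 0 ∧ 0 < inner ℝ h (v i) ∧
      ∀ j, j ≠ i → ∃ s, step (inner ℝ w (v j)) = s ∧ step (inner ℝ (w + h) (v j)) = s ∧
        step (inner ℝ (w - h) (v j)) = s ∧ inner ℝ (w + h) (v j) ≠ 0 ∧
        inner ℝ (w - h) (v j) ≠ 0 := by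
  obtain ⟨w, hw, hwj⟩ := hv.exists_inner_eq_zero i
  have hev : ∀ᶠ t : ℝ in nhdsWithin 0 (Set.Ioi 0), 0 < t ∧ ∀ j, j ≠ i →
      |t * inner ℝ (v i) (v j)| < |inner ℝ w (v j)| := by
    refine Filter.Eventually.and self_mem_nhdsWithin ?_
    refine Filter.eventually_all.mpr fun j => ?_
    by_cases hj : j = i
    · exact Filter.Eventually.of_forall fun _ h => absurd hj h
    · have hc : Continuous fun t : ℝ => |t * inner ℝ (v i) (v j)| := by fun_prop
      have := (hc.tendsto 0).eventually_lt_const (u := |inner ℝ w (v j)|)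
        (by simpa using hwj j hj)
      exact (this.filter_mono nhdsWithin_le_nhds).mono fun t ht _ => ht
  obtain ⟨t, ht, hj⟩ := hev.exists
  refine ⟨w, t • v i, hw, ?_, fun j hji => ⟨_, rfl, ?_⟩⟩
  · rw [real_inner_smul_left]
    exact mul_pos ht (real_inner_self_pos.mpr (hv.1 i))
  · rw [inner_add_left, inner_sub_left, real_inner_smul_left]
    have h1 := hj j hji
    generalize t * inner ℝ (v i) (v j) = x at h1
    generalize inner ℝ w (v j) = z at h1
    obtain ⟨h2, h3⟩ := abs_lt.mp h1
    unfold step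
    rcases abs_cases z with ⟨h4, h5⟩ | ⟨h4, h5⟩
    · rw [h4] at h2 h3
      rw [if_pos h5, if_pos (by linarith), if_pos (by linarith)]
      exact ⟨rfl, rfl, by linarith [h2], by linarith⟩
    · rw [h4] at h2 h3
      rw [if_neg (by linarith), if_neg (by linarith), if_neg (by linarith)]
      exact ⟨rfl, rfl, by linarith, by linarith⟩

lemma memLp_inner (v : EuclideanSpace ℝ (Fin e)) :
    MemLp (fun w : EuclideanSpace ℝ (Fin e) => (inner ℝ w v : ℝ)) 2
      (stdGaussian (EuclideanSpace ℝ (Fin e))) := by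
  have h := IsGaussian.memLp_id (stdGaussian (EuclideanSpace ℝ (Fin e))) 2 (by simp)
  refine (h.norm.mul_const ‖v‖).mono (by fun_prop) (Filter.Eventually.of_forall fun w => ?_)
  simpa using norm_inner_le_norm (𝕜 := ℝ) w v

lemma memLp_relu_inner (v : EuclideanSpace ℝ (Fin e)) :
    MemLp (fun w : EuclideanSpace ℝ (Fin e) => relu (inner ℝ w v)) 2
      (stdGaussian (EuclideanSpace ℝ (Fin e))) :=
  (memLp_inner v).mono (continuous_relu.comp (by fun_prop)).aestronglyMeasurable
    (Filter.Eventually.of_forall fun w => by simpa using abs_relu_le _)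

/-- In a vanishing combination of ridge functions, take the second difference across the kink of the
`i`-th one at a point where all the others are locally linear. Only the coefficient `x i` survives.
-/
lemma NoTwoParallel.posDef_gramRelu {v : Fin n → EuclideanSpace ℝ (Fin e)}
    (hv : NoTwoParallel v) : (gramRelu v).PosDef := by
  have h := posDef_integral_inner (F := ℝ) (fun i => memLp_relu_inner (v i)) (fun x hx => by
    ext i
    obtain ⟨w, h, hw, hh, hj⟩ := hv.exists_crossing i
    have hz : ∀ w' : EuclideanSpace ℝ (Fin e), ∑ i, x i • relu (inner ℝ w' (v i)) = 0 := fun w' =>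
      eq_zero_of_ae_of_continuousAt hx (Continuous.continuousAt (continuous_finsetSum _ fun i _ =>
        (continuous_relu.comp (continuous_id.inner continuous_const)).const_smul (x i)))
    have key : (∑ j, x j • relu (inner ℝ (w + h) (v j))) + (∑ j, x j • relu (inner ℝ (w - h) (v j)))
        - 2 * ∑ j, x j • relu (inner ℝ w (v j)) = x i * inner ℝ h (v i) := by
      rw [Finset.mul_sum, ← Finset.sum_add_distrib, ← Finset.sum_sub_distrib,
        Finset.sum_eq_single i]
      · rw [inner_add_left, inner_sub_left, hw, relu, relu, relu, max_eq_left (by linarith),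
          max_eq_right (by linarith), max_self]
        simp
      · intro j _ hji
        obtain ⟨s, h1, h2, h3, -⟩ := hj j hji
        rw [relu_eq_step_mul, relu_eq_step_mul, relu_eq_step_mul, h1, h2, h3, inner_add_left,
          inner_sub_left]
        simp only [smul_eq_mul]
        ring
      · simp
    rw [hz, hz, hz] at key
    have : x i * inner ℝ h (v i) = 0 := by rw [← key]; simp
    exact (mul_eq_zero.mp this).resolve_right hh.ne')
  convert h using 1
  ext i j
  simp [gramRelu, mul_comm]

lemma memLp_step_smul (v : EuclideanSpace ℝ (Fin e)) :
    MemLp (fun w : EuclideanSpace ℝ (Fin e) => step (inner ℝ w v) • v) 2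
      (stdGaussian (EuclideanSpace ℝ (Fin e))) := by
  have hm : Measurable fun w : EuclideanSpace ℝ (Fin e) => step (inner ℝ w v) :=
    measurable_step.comp (by fun_prop)
  refine MemLp.of_bound (hm.smul_const v).aestronglyMeasurable ‖v‖
    (Filter.Eventually.of_forall fun w => ?_)
  rw [norm_smul, Real.norm_eq_abs]
  exact mul_le_of_le_one_left (norm_nonneg _) (abs_step_le_one _)

lemma continuousAt_step {x : ℝ} (hx : x ≠ 0) : ContinuousAt step x := by
  rcases lt_or_gt_of_ne hx with h | h
  · refine (continuousAt_const (y := (0 : ℝ))).congr ?_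
    filter_upwards [gt_mem_nhds h] with z hz
    rw [step, if_neg (by linarith)]
  · refine (continuousAt_const (y := (1 : ℝ))).congr ?_
    filter_upwards [lt_mem_nhds h] with z hz
    rw [step, if_pos hz.le]

/-- Here the difference across the hyperplane of `v i` isolates the jump `x i • v i`, the other
indicators being equal on both sides. The combination is discontinuous, so it is evaluated only at
`w + h` and `w - h`, which lie off every hyperplane. -/
lemma NoTwoParallel.posDef_gramStep {v : Fin n → EuclideanSpace ℝ (Fin e)}
    (hv : NoTwoParallel v) : (gramStep v).PosDef := by
  have h := posDef_integral_inner (fun i => memLp_step_smul (v i)) (fun x hx => by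
    ext i
    obtain ⟨w, h, hw, hh, hj⟩ := hv.exists_crossing i
    have hp : inner ℝ (w + h) (v i) = inner ℝ h (v i) := by rw [inner_add_left, hw, zero_add]
    have hm : inner ℝ (w - h) (v i) = - inner ℝ h (v i) := by rw [inner_sub_left, hw, zero_sub]
    have hz : ∀ w' : EuclideanSpace ℝ (Fin e), (∀ j, inner ℝ w' (v j) ≠ 0) →
        ∑ i, x i • step (inner ℝ w' (v i)) • v i = 0 := fun w' hw' => by
      refine eq_zero_of_ae_of_continuousAt hx (tendsto_finsetSum _ fun j _ => ?_)
      have h1 : ContinuousAt (fun w : EuclideanSpace ℝ (Fin e) => step (inner ℝ w (v j))) w' :=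
        ContinuousAt.comp (f := fun w : EuclideanSpace ℝ (Fin e) => (inner ℝ w (v j) : ℝ))
          (continuousAt_step (hw' j)) (by fun_prop)
      exact ((h1.smul continuousAt_const).const_smul (x j))
    have hz1 := hz (w + h) fun j => by
      by_cases hji : j = i
      · rw [hji, hp]; exact hh.ne'
      · obtain ⟨s, -, -, -, h4, -⟩ := hj j hji; exact h4
    have hz2 := hz (w - h) fun j => by
      by_cases hji : j = i
      · rw [hji, hm]; exact (neg_lt_zero.mpr hh).ne
      · obtain ⟨s, -, -, -, -, h4⟩ := hj j hji; exact h4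
    have key : (∑ j, x j • step (inner ℝ (w + h) (v j)) • v j) -
        ∑ j, x j • step (inner ℝ (w - h) (v j)) • v j = x i • v i := by
      rw [← Finset.sum_sub_distrib, Finset.sum_eq_single i]
      · rw [hp, hm, step, step, if_pos hh.le, if_neg (by linarith)]
        simp
      · intro j _ hji
        obtain ⟨s, h1, h2, h3, -⟩ := hj j hji
        rw [h2, h3, sub_self]
      · simp
    rw [hz1, hz2, sub_self] at key
    exact (smul_eq_zero.mp key.symm).resolve_right (hv.1 i))
  convert h using 1
  ext i j
  simp only [gramStep, Matrix.of_apply, real_inner_smul_left, real_inner_smul_right]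
  congr 1
  ext w
  ring

end Positivity

/-! ### Exponential moments and Bernstein's inequality -/

section Concentration

variable {X : Type*} [MeasurableSpace X]

/-- Sub-exponential functions of scale `K`. -/
structure SubExp (f : X → ℝ) (K : ℝ) (ν : Measure X) : Prop where
  meas : Measurable f
  lintegral_le : ∫⁻ x, ENNReal.ofReal (Real.exp (|f x| / K)) ∂ν ≤ 3

/-- Functions with a square-exponential moment at scale `M`. -/
structure SqExp (f : X → ℝ) (M : ℝ) (ν : Measure X) : Prop where
  meas : Measurable f
  lintegral_le : ∫⁻ x, ENNReal.ofReal (Real.exp (f x ^ 2 / (4 * M ^ 2))) ∂ν ≤ 2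

variable {ν : Measure X} {f g h : X → ℝ} {K M : ℝ}

lemma SubExp.neg (hf : SubExp f K ν) : SubExp (fun x => -f x) K ν :=
  ⟨hf.meas.neg, by simpa only [abs_neg] using hf.lintegral_le⟩

lemma SubExp.integrable_exp (hf : SubExp f K ν) :
    Integrable (fun x => Real.exp (|f x| / K)) ν := by
  have hm : Measurable fun x => Real.exp (|f x| / K) :=
    ((continuous_abs.measurable.comp hf.meas).div_const K).exp
  refine ⟨hm.aestronglyMeasurable, ?_⟩
  rw [hasFiniteIntegral_iff_ofReal (Filter.Eventually.of_forall fun x => (Real.exp_pos _).le)]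
  exact hf.lintegral_le.trans_lt (by simp)

lemma SubExp.integral_exp_le (hf : SubExp f K ν) :
    ∫ x, Real.exp (|f x| / K) ∂ν ≤ 3 := by
  rw [integral_eq_lintegral_of_nonneg_ae
    (Filter.Eventually.of_forall fun x => (Real.exp_pos _).le) hf.integrable_exp.1]
  exact ENNReal.toReal_le_of_le_ofReal (by norm_num) (by simpa using hf.lintegral_le)

lemma SubExp.integrable (hf : SubExp f K ν) (hK : 0 < K) : Integrable f ν := by
  refine (hf.integrable_exp.const_mul K).mono hf.meas.aestronglyMeasurable
    (Filter.Eventually.of_forall fun x => ?_)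
  rw [Real.norm_eq_abs, Real.norm_of_nonneg (by positivity)]
  have := Real.add_one_le_exp (|f x| / K)
  calc |f x| = K * (|f x| / K) := by field_simp
    _ ≤ _ := by gcongr; linarith

lemma exp_le_one_add_add (t : ℝ) : Real.exp t ≤ 1 + t + t ^ 2 * Real.exp |t| := by
  have h := Complex.norm_exp_sub_sum_le_norm_mul_exp (t : ℂ) 2
  have e : Complex.exp t - ∑ m ∈ Finset.range 2, (t : ℂ) ^ m / m.factorial =
      ((Real.exp t - (1 + t) : ℝ) : ℂ) := by
    simp [Finset.sum_range_succ]
  rw [e, Complex.norm_real, Complex.norm_real, Real.norm_eq_abs, Real.norm_eq_abs, sq_abs] at h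
  linarith [le_abs_self (Real.exp t - (1 + t))]

lemma exp_mul_le_of_abs_le {K s x : ℝ} (hK : 0 < K) (hs : |s| ≤ 1 / (2 * K)) :
    Real.exp (s * x) ≤ 1 + s * x + 8 * K ^ 2 * s ^ 2 * Real.exp (|x| / K) := by
  have h1 := exp_le_one_add_add (s * x)
  have h2 : |s * x| ≤ |x| / (2 * K) := by
    rw [abs_mul]
    calc |s| * |x| ≤ 1 / (2 * K) * |x| := by gcongr
      _ = _ := by ring
  set y := |x| / (2 * K) with hy
  have hy0 : 0 ≤ y := by positivity
  have h3 : y ^ 2 ≤ 2 * Real.exp y := by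
    have := Real.quadratic_le_exp_of_nonneg hy0
    nlinarith
  have h4 : x ^ 2 = 4 * K ^ 2 * y ^ 2 := by
    rw [hy, div_pow, sq_abs]; field_simp; ring
  have h5 : Real.exp (|x| / K) = Real.exp y * Real.exp y := by
    rw [← Real.exp_add]; congr 1; rw [hy]; field_simp; ring
  have h6 : (s * x) ^ 2 * Real.exp |s * x| ≤ (s ^ 2 * (4 * K ^ 2 * (2 * Real.exp y))) * Real.exp y := by
    rw [mul_pow, h4]
    gcongr
  rw [h5]
  linarith

lemma SubExp.integrable_exp_mul (hf : SubExp f K ν) (hK : 0 < K) {s : ℝ}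
    (hs : |s| ≤ 1 / (2 * K)) : Integrable (fun x => Real.exp (s * f x)) ν := by
  refine hf.integrable_exp.mono (hf.meas.const_mul s).exp.aestronglyMeasurable
    (Filter.Eventually.of_forall fun x => ?_)
  rw [Real.norm_of_nonneg (Real.exp_pos _).le, Real.norm_of_nonneg (Real.exp_pos _).le]
  apply Real.exp_le_exp.mpr
  calc s * f x ≤ |s| * |f x| := by rw [← abs_mul]; exact le_abs_self _
    _ ≤ 1 / K * |f x| := by
      gcongr
      exact hs.trans (one_div_le_one_div_of_le hK (by linarith))
    _ = _ := by ring

/-- Integrate the pointwise bound `exp_mul_le_of_abs_le`; the constant `24` is `8` times the bound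
`3` on the exponential moment. -/
lemma SubExp.mgf_le [IsProbabilityMeasure ν] (hf : SubExp f K ν) (hK : 0 < K) {s : ℝ}
    (hs : |s| ≤ 1 / (2 * K)) :
    ∫ x, Real.exp (s * f x) ∂ν ≤ Real.exp (s * ∫ x, f x ∂ν + 24 * K ^ 2 * s ^ 2) := by
  have hi : Integrable (fun x => 1 + s * f x) ν :=
    (integrable_const _).add ((hf.integrable hK).const_mul s)
  calc _ ≤ ∫ x, (1 + s * f x + 8 * K ^ 2 * s ^ 2 * Real.exp (|f x| / K)) ∂ν :=
        integral_mono (hf.integrable_exp_mul hK hs)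
          (hi.add (hf.integrable_exp.const_mul _))
          fun x => exp_mul_le_of_abs_le hK hs
    _ = 1 + s * ∫ x, f x ∂ν + 8 * K ^ 2 * s ^ 2 * ∫ x, Real.exp (|f x| / K) ∂ν := by
        rw [integral_add hi (hf.integrable_exp.const_mul _), integral_add (integrable_const _)
          ((hf.integrable hK).const_mul s), integral_const_mul, integral_const_mul]
        simp
    _ ≤ 1 + s * ∫ x, f x ∂ν + 8 * K ^ 2 * s ^ 2 * 3 := by gcongr; exact hf.integral_exp_le
    _ ≤ _ := by
        have := Real.add_one_le_exp (s * ∫ x, f x ∂ν + 24 * K ^ 2 * s ^ 2)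
        linarith

/-- One-sided Bernstein inequality for i.i.d. sub-exponential variables. -/
lemma SubExp.measure_sum_ge_le [IsProbabilityMeasure ν] (hf : SubExp f K ν) (hK : 0 < K) (m : ℕ)
    {ε : ℝ} (hε : 0 ≤ ε) (hεK : ε ≤ 24 * K) :
    (Measure.pi fun _ : Fin m => ν) {x | m * (∫ x, f x ∂ν) + m * ε ≤ ∑ r, f (x r)} ≤
      ENNReal.ofReal (Real.exp (-(m * ε ^ 2 / (96 * K ^ 2)))) := by
  -- The minimizer of `-s ε + 24 K ^ 2 s ^ 2`. The restriction `ε ≤ 24 K` is precisely what keeps it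
  -- in the range `|s| ≤ 1 / (2 K)`.
  set s := ε / (48 * K ^ 2) with hs
  have hs0 : 0 ≤ s := by positivity
  have hs1 : |s| ≤ 1 / (2 * K) := by
    rw [abs_of_nonneg hs0, hs, div_le_div_iff₀ (by positivity) (by positivity)]
    nlinarith
  have hint : Integrable (fun x : Fin m → X => Real.exp (s * ∑ r, f (x r)))
      (Measure.pi fun _ : Fin m => ν) := by
    simp_rw [Finset.mul_sum, Real.exp_sum]
    exact Integrable.fintype_prod fun _ => hf.integrable_exp_mul hK hs1
  have h := measure_ge_le_exp_mul_mgf (m * (∫ x, f x ∂ν) + m * ε) hs0 hint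
  have e : mgf (fun x : Fin m → X => ∑ r, f (x r)) (Measure.pi fun _ : Fin m => ν) s =
      (∫ x, Real.exp (s * f x) ∂ν) ^ m := by
    rw [mgf]
    simp_rw [Finset.mul_sum, Real.exp_sum]
    rw [integral_fintype_prod_eq_pow (fun x => Real.exp (s * f x)), Fintype.card_fin]
  rw [e] at h
  rw [← ENNReal.ofReal_toReal (measure_ne_top (Measure.pi fun _ : Fin m => ν) _)]
  refine ENNReal.ofReal_le_ofReal (h.trans ?_)
  calc _ ≤ Real.exp (-s * (m * (∫ x, f x ∂ν) + m * ε)) *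
        (Real.exp (s * ∫ x, f x ∂ν + 24 * K ^ 2 * s ^ 2)) ^ m :=
          mul_le_mul_of_nonneg_left (pow_le_pow_left₀
            (integral_nonneg fun x => (Real.exp_pos (s * f x)).le) (hf.mgf_le hK hs1) m)
            (Real.exp_pos _).le
    _ = Real.exp (-(m * ε ^ 2 / (96 * K ^ 2))) := by
          rw [← Real.exp_nat_mul, ← Real.exp_add]
          congr 1
          rw [hs]; field_simp; ring

/-- Two-sided Bernstein inequality for the empirical mean. -/
lemma SubExp.measure_abs_mean_sub_gt_le [IsProbabilityMeasure ν] (hf : SubExp f K ν) (hK : 0 < K)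
    {m : ℕ} (hm : 0 < m) {ε : ℝ} (hε : 0 ≤ ε) (hεK : ε ≤ 24 * K) :
    (Measure.pi fun _ : Fin m => ν)
        {x | ε < |(1 / (m : ℝ)) * ∑ r, f (x r) - ∫ x, f x ∂ν|} ≤
      2 * ENNReal.ofReal (Real.exp (-(m * ε ^ 2 / (96 * K ^ 2)))) := by
  have hm' : (0 : ℝ) < m := by exact_mod_cast hm
  refine (measure_mono ?_).trans ((measure_union_le _ _).trans
    ((add_le_add (hf.measure_sum_ge_le hK m hε hεK) (hf.neg.measure_sum_ge_le hK m hε hεK)).trans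
      (two_mul _).ge))
  intro x hx
  have hx' : ε < |(1 / (m : ℝ)) * ∑ r, f (x r) - ∫ x, f x ∂ν| := hx
  have e : (∑ r, f (x r)) = m * ((1 / (m : ℝ)) * ∑ r, f (x r)) := by field_simp
  simp only [Set.mem_union, Set.mem_ofPred_eq, integral_neg, Finset.sum_neg_distrib]
  rw [e]
  rcases lt_abs.mp hx' with h | h
  · left; nlinarith
  · right; nlinarith

lemma SubExp.of_abs_le_one [IsProbabilityMeasure ν] (hf : Measurable f) (h : ∀ x, |f x| ≤ 1) :
    SubExp f 1 ν := by
  refine ⟨hf, ?_⟩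
  calc _ ≤ ∫⁻ _, (3 : ℝ≥0∞) ∂ν := lintegral_mono fun x => by
        rw [div_one]
        refine ENNReal.ofReal_le_of_le_toReal ?_
        have := Real.exp_one_lt_d9
        have := Real.exp_le_exp.mpr (h x)
        simp; linarith
    _ = 3 := by simp

lemma SqExp.measure_abs_gt_le (hf : SqExp f M ν) (hM : 0 < M) {B : ℝ} (hB : 0 ≤ B) :
    ν {x | B < |f x|} ≤ 2 * ENNReal.ofReal (Real.exp (-(B ^ 2 / (4 * M ^ 2)))) := by
  have hm : Measurable fun x => ENNReal.ofReal (Real.exp (f x ^ 2 / (4 * M ^ 2))) :=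
    (((hf.meas.pow_const 2).div_const _).exp).ennreal_ofReal
  have h := mul_meas_ge_le_lintegral (μ := ν) hm
    (ENNReal.ofReal (Real.exp (B ^ 2 / (4 * M ^ 2))))
  have h1 : ν {x | B < |f x|} ≤ ν {x | ENNReal.ofReal (Real.exp (B ^ 2 / (4 * M ^ 2))) ≤
      ENNReal.ofReal (Real.exp (f x ^ 2 / (4 * M ^ 2)))} := by
    refine measure_mono fun x hx => ?_
    refine ENNReal.ofReal_le_ofReal (Real.exp_le_exp.mpr ?_)
    have hx' : B < |f x| := hx
    rw [← sq_abs (f x)]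
    gcongr
  rw [Real.exp_neg, ENNReal.ofReal_inv_of_pos (Real.exp_pos _), ← div_eq_mul_inv]
  rw [ENNReal.le_div_iff_mul_le (Or.inl (by simp [Real.exp_pos])) (Or.inl (by simp)), mul_comm]
  exact (mul_le_mul_right h1 _).trans (h.trans hf.lintegral_le)

/-- A function dominated by products of functions with square-exponential moments. -/
lemma SqExp.subExp (hf : SqExp f M ν) (hg : SqExp g M ν) (hM : 1 ≤ M) (hh : Measurable h)
    (hle : ∀ x, |h x| ≤ M ^ 2 * (|f x| * |g x|)) : SubExp h (4 * M ^ 4) ν := by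
  refine ⟨hh, ?_⟩
  have hpt : ∀ x, ENNReal.ofReal (Real.exp (|h x| / (4 * M ^ 4))) ≤
      2⁻¹ * (ENNReal.ofReal (Real.exp (f x ^ 2 / (4 * M ^ 2))) +
        ENNReal.ofReal (Real.exp (g x ^ 2 / (4 * M ^ 2)))) := fun x => by
    have hM0 : 0 < M := by linarith
    have h1 : |h x| / (4 * M ^ 4) ≤ f x ^ 2 / (4 * M ^ 2) / 2 + g x ^ 2 / (4 * M ^ 2) / 2 := by
      have : |f x| * |g x| ≤ (f x ^ 2 + g x ^ 2) / 2 := by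
        nlinarith [sq_nonneg (|f x| - |g x|), sq_abs (f x), sq_abs (g x)]
      calc |h x| / (4 * M ^ 4) ≤ (M ^ 2 * ((f x ^ 2 + g x ^ 2) / 2)) / (4 * M ^ 4) := by
            gcongr; exact (hle x).trans (by gcongr)
        _ = _ := by field_simp
    have h2 : Real.exp (|h x| / (4 * M ^ 4)) ≤ 2⁻¹ * (Real.exp (f x ^ 2 / (4 * M ^ 2)) +
        Real.exp (g x ^ 2 / (4 * M ^ 2))) := by
      refine (Real.exp_le_exp.mpr h1).trans ?_
      rw [Real.exp_add]
      have e1 : ∀ z : ℝ, Real.exp z = Real.exp (z / 2) ^ 2 := fun z => by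
        rw [← Real.exp_nat_mul]; congr 1; push_cast; ring
      rw [e1 (f x ^ 2 / (4 * M ^ 2)), e1 (g x ^ 2 / (4 * M ^ 2))]
      nlinarith [sq_nonneg (Real.exp (f x ^ 2 / (4 * M ^ 2) / 2) -
        Real.exp (g x ^ 2 / (4 * M ^ 2) / 2))]
    refine (ENNReal.ofReal_le_ofReal h2).trans (le_of_eq ?_)
    rw [ENNReal.ofReal_mul (by norm_num), ENNReal.ofReal_add (Real.exp_pos _).le
      (Real.exp_pos _).le, ENNReal.ofReal_inv_of_pos (by norm_num)]
    simp
  refine (lintegral_mono hpt).trans ?_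
  have hm : Measurable fun x => ENNReal.ofReal (Real.exp (f x ^ 2 / (4 * M ^ 2))) :=
    (((hf.meas.pow_const 2).div_const _).exp).ennreal_ofReal
  rw [lintegral_const_mul' _ _ (by simp), lintegral_add_left hm]
  calc _ ≤ (2⁻¹ : ℝ≥0∞) * (2 + 2) := by gcongr; exacts [hf.lintegral_le, hg.lintegral_le]
    _ = 2 := by rw [← two_mul, ← mul_assoc, ENNReal.inv_mul_cancel (by simp) (by simp), one_mul]
    _ ≤ 3 := by norm_num

lemma SqExp.comp_measurePreserving {Y : Type*} [MeasurableSpace Y] {μ : Measure Y} {φ : Y → X}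
    (hf : SqExp f M ν) (hφ : MeasurePreserving φ μ ν) : SqExp (fun y => f (φ y)) M μ := by
  refine ⟨hf.meas.comp hφ.measurable, ?_⟩
  have hm : Measurable fun x => ENNReal.ofReal (Real.exp (f x ^ 2 / (4 * M ^ 2))) :=
    (((hf.meas.pow_const 2).div_const _).exp).ennreal_ofReal
  rw [hφ.lintegral_comp hm]
  exact hf.lintegral_le

lemma lintegral_exp_mul_gaussianReal (t : ℝ) :
    ∫⁻ x, ENNReal.ofReal (Real.exp (t * x)) ∂(gaussianReal 0 1) =
      ENNReal.ofReal (Real.exp (t ^ 2 / 2)) := by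
  rw [← ofReal_integral_eq_lintegral_ofReal (integrable_exp_mul_gaussianReal t)
    (Filter.Eventually.of_forall fun x => (Real.exp_pos _).le)]
  have := mgf_gaussianReal (p := gaussianReal 0 1) (X := id) (μ := 0) (v := 1) Measure.map_id t
  rw [mgf] at this
  simp only [id] at this
  rw [this]; simp

lemma lintegral_exp_sq_gaussianReal_le :
    ∫⁻ x, ENNReal.ofReal (Real.exp (x ^ 2 / 4)) ∂(gaussianReal 0 1) ≤ 2 := by
  rw [gaussianReal_of_var_ne_zero _ one_ne_zero, lintegral_withDensity_eq_lintegral_mul _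
    (measurable_gaussianPDF 0 1) (by fun_prop)]
  have e : ∀ x : ℝ, (gaussianPDF 0 1 * fun x => ENNReal.ofReal (Real.exp (x ^ 2 / 4))) x =
      ENNReal.ofReal ((√(2 * Real.pi))⁻¹ * Real.exp (-(1 / 4) * x ^ 2)) := fun x => by
    rw [Pi.mul_apply, gaussianPDF, gaussianPDFReal, ← ENNReal.ofReal_mul (by positivity),
      mul_assoc, ← Real.exp_add]
    congr 2
    · simp
    · congr 1; simp; ring
  simp_rw [e]
  rw [← ofReal_integral_eq_lintegral_ofReal
    ((integrable_exp_neg_mul_sq (by norm_num)).const_mul _)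
    (Filter.Eventually.of_forall fun x => by positivity), integral_const_mul, integral_gaussian]
  refine ENNReal.ofReal_le_of_le_toReal ?_
  have hpi := Real.pi_pos
  have : Real.pi / (1 / 4) = 2 * (2 * Real.pi) := by ring
  rw [this, Real.sqrt_mul (by norm_num : (0 : ℝ) ≤ 2) (2 * Real.pi)]
  have h2 : √(2 * Real.pi) ≠ 0 := by positivity
  rw [mul_comm, mul_assoc, mul_inv_cancel₀ h2, mul_one]
  simp only [ENNReal.toReal_ofNat]
  rw [Real.sqrt_le_iff]; norm_num

/-- Write `exp (s ^ 2 / 2)` as the expectation of `exp (s g)` for an auxiliary standard Gaussian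
`g`. Exchanging the integrals brings in the moment generating function of `f`, and what remains is
the expectation of `exp (g ^ 2 / 4)`, which is `√2`. -/
lemma sqExp_of_hasSubgaussianMGF [SFinite ν] {c : NNReal} (hf : Measurable f)
    (h : HasSubgaussianMGF f c ν) (hM : 0 < M) (hc : (c : ℝ) ≤ M ^ 2) : SqExp f M ν := by
  refine ⟨hf, ?_⟩
  have hs2 : √2 ^ 2 = (2 : ℝ) := Real.sq_sqrt (by norm_num)
  have hs : √2 ≠ (0 : ℝ) := by positivity
  have e1 : ∀ x, ENNReal.ofReal (Real.exp (f x ^ 2 / (4 * M ^ 2))) =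
      ∫⁻ y, ENNReal.ofReal (Real.exp (f x / (√2 * M) * y)) ∂(gaussianReal 0 1) := fun x => by
    rw [lintegral_exp_mul_gaussianReal]
    congr 2
    rw [div_pow, mul_pow, hs2]; field_simp; ring
  simp_rw [e1]
  rw [lintegral_lintegral_swap (by
    refine Measurable.aemeasurable ?_
    refine (Measurable.exp ?_).ennreal_ofReal
    exact ((hf.comp measurable_fst).div_const _).mul measurable_snd)]
  refine (lintegral_mono fun y => ?_).trans lintegral_exp_sq_gaussianReal_le
  have e2 : ∀ x, f x / (√2 * M) * y = (y / (√2 * M)) * f x := fun x => by ring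
  simp_rw [e2]
  rw [← ofReal_integral_eq_lintegral_ofReal (h.integrable_exp_mul _)
    (Filter.Eventually.of_forall fun x => (Real.exp_pos _).le)]
  refine ENNReal.ofReal_le_ofReal ((h.mgf_le _).trans (Real.exp_le_exp.mpr ?_))
  rw [div_pow, mul_pow, hs2]
  calc (c : ℝ) * (y ^ 2 / (2 * M ^ 2)) / 2 ≤ M ^ 2 * (y ^ 2 / (2 * M ^ 2)) / 2 := by gcongr
    _ = _ := by field_simp; ring

end Concentration

/-! ### The random signs -/

section SignLaw

/-- The uniform law on `{-1, 1}`. -/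
noncomputable def signLaw : Measure ℝ := uniformOn ({-1, 1} : Set ℝ)

instance isProbabilityMeasure_signLaw : IsProbabilityMeasure signLaw :=
  isProbabilityMeasure_uniformOn (by simp) (by simp)

lemma signLaw_eq : signLaw = (2⁻¹ : ℝ≥0∞) • (Measure.dirac (-1) + Measure.dirac 1) := by
  have h : ({-1, 1} : Set ℝ) = {-1} ∪ {1} := rfl
  have hd : Disjoint ({-1} : Set ℝ) {1} := by simp; norm_num
  have hc : Measure.count ({-1} ∪ {1} : Set ℝ) = 2 := by
    rw [measure_union hd (measurableSet_singleton _)]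
    simp; norm_num
  rw [signLaw, uniformOn, ProbabilityTheory.cond, h, hc, Measure.restrict_union hd (measurableSet_singleton _),
    Measure.restrict_singleton, Measure.restrict_singleton]
  simp

lemma integral_signLaw (f : ℝ → ℝ) : ∫ a, f a ∂signLaw = (f (-1) + f 1) / 2 := by
  rw [signLaw_eq, integral_smul_measure, integral_add_measure (integrable_dirac (by simp))
    (integrable_dirac (by simp)), integral_dirac, integral_dirac]
  simp
  ring

lemma ae_signLaw : ∀ᵐ a ∂signLaw, a ^ 2 = 1 := by
  rw [signLaw_eq]
  refine Measure.ae_smul_measure ?_ _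
  rw [ae_add_measure_iff]
  simp [ae_dirac_eq]

end SignLaw

/-! ### One-dimensional Gaussian marginals -/

section Gaussian

variable {e : ℕ}

lemma map_inner_stdGaussian (v : EuclideanSpace ℝ (Fin e)) :
    (stdGaussian (EuclideanSpace ℝ (Fin e))).map (fun w => (inner ℝ w v : ℝ)) =
      gaussianReal 0 (‖v‖ ^ 2).toNNReal := by
  have h := IsGaussian.map_eq_gaussianReal (μ := stdGaussian (EuclideanSpace ℝ (Fin e)))
    (innerSL ℝ v)
  rw [integral_strongDual_stdGaussian, variance_dual_stdGaussian, innerSL_apply_norm] at h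
  rw [← h]
  congr 1
  ext w
  rw [innerSL_apply_apply, real_inner_comm]

lemma hasSubgaussianMGF_inner (v : EuclideanSpace ℝ (Fin e)) :
    HasSubgaussianMGF (fun w => (inner ℝ w v : ℝ)) (‖v‖ ^ 2).toNNReal
      (stdGaussian (EuclideanSpace ℝ (Fin e))) := by
  refine ⟨fun t => ?_, fun t => ?_⟩
  · have h : Integrable (fun x => Real.exp (t * x))
      ((stdGaussian (EuclideanSpace ℝ (Fin e))).map (fun w => (inner ℝ w v : ℝ))) := by
      rw [map_inner_stdGaussian]; exact integrable_exp_mul_gaussianReal t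
    exact h.comp_measurable (by fun_prop)
  · rw [mgf_gaussianReal (map_inner_stdGaussian v)]
    simp

lemma sqExp_inner {v : EuclideanSpace ℝ (Fin e)} {M : ℝ} (hM : 0 < M) (hv : ‖v‖ ≤ M) :
    SqExp (fun w => (inner ℝ w v : ℝ)) M (stdGaussian (EuclideanSpace ℝ (Fin e))) :=
  sqExp_of_hasSubgaussianMGF (by fun_prop) (hasSubgaussianMGF_inner v) hM (by
    rw [Real.coe_toNNReal _ (sq_nonneg _)]; gcongr)

lemma measurable_near {E : Type*} [NormedAddCommGroup E] [InnerProductSpace ℝ E]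
    [MeasurableSpace E] [BorelSpace E] [SecondCountableTopology E] (R : ℝ) (v : E) :
    Measurable (near R v) :=
  Measurable.ite (measurableSet_le (by fun_prop) measurable_const) measurable_const
    measurable_const

/-- The density of the marginal is at most `1 / (√(2 π) ‖v‖) ≤ 1 / (2 ‖v‖)`, and the interval has
length `2 R ‖v‖`. The normalization of `near` by `‖v‖` makes the result independent of how short `v`
is. -/
lemma integral_near_le {v : EuclideanSpace ℝ (Fin e)} (hv : v ≠ 0) {R : ℝ} (hR : 0 ≤ R) :
    ∫ w, near R v w ∂(stdGaussian (EuclideanSpace ℝ (Fin e))) ≤ R := by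
  have hv0 : 0 < ‖v‖ := norm_pos_iff.mpr hv
  have hvar : (‖v‖ ^ 2).toNNReal ≠ 0 := by
    rw [Ne, Real.toNNReal_eq_zero, not_le]; positivity
  have hs : MeasurableSet (Set.Icc (-(R * ‖v‖)) (R * ‖v‖)) := measurableSet_Icc
  have e1 : ∀ w : EuclideanSpace ℝ (Fin e), near R v w =
      (Set.Icc (-(R * ‖v‖)) (R * ‖v‖)).indicator (fun _ => (1 : ℝ)) (inner ℝ w v) := fun w => by
    simp only [near, Set.indicator, Set.mem_Icc, abs_le]
  simp_rw [e1]
  have e2 := integral_map (μ := stdGaussian (EuclideanSpace ℝ (Fin e)))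
    (φ := fun w => (inner ℝ w v : ℝ)) (by fun_prop)
    (f := (Set.Icc (-(R * ‖v‖)) (R * ‖v‖)).indicator (fun _ => (1 : ℝ)))
    (measurable_const.indicator hs).aestronglyMeasurable
  rw [← e2, map_inner_stdGaussian, integral_gaussianReal_eq_integral_smul hvar]
  have e3 : ∀ x, gaussianPDFReal 0 (‖v‖ ^ 2).toNNReal x •
      (Set.Icc (-(R * ‖v‖)) (R * ‖v‖)).indicator (fun _ => (1 : ℝ)) x ≤
      (Set.Icc (-(R * ‖v‖)) (R * ‖v‖)).indicator (fun _ => (2 * ‖v‖)⁻¹) x := fun x => by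
    by_cases hx : x ∈ Set.Icc (-(R * ‖v‖)) (R * ‖v‖)
    · rw [Set.indicator_of_mem hx, Set.indicator_of_mem hx, smul_eq_mul, mul_one, gaussianPDFReal,
        Real.coe_toNNReal _ (sq_nonneg _)]
      have h1 : 2 * ‖v‖ ≤ √(2 * Real.pi * ‖v‖ ^ 2) := by
        apply Real.le_sqrt_of_sq_le
        nlinarith [Real.pi_gt_three, sq_nonneg ‖v‖]
      calc _ ≤ (√(2 * Real.pi * ‖v‖ ^ 2))⁻¹ * 1 := by
            gcongr
            rw [Real.exp_le_one_iff, neg_div]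
            exact neg_nonpos.mpr (by positivity)
        _ ≤ _ := by rw [mul_one]; gcongr
    · rw [Set.indicator_of_notMem hx, Set.indicator_of_notMem hx, smul_zero]
  have hfin : volume (Set.Icc (-(R * ‖v‖)) (R * ‖v‖)) ≠ ⊤ := by simp
  have hint2 : Integrable ((Set.Icc (-(R * ‖v‖)) (R * ‖v‖)).indicator fun _ => (2 * ‖v‖)⁻¹) :=
    (integrable_indicator_iff hs).mpr (integrableOn_const hfin)
  refine (integral_mono_of_nonneg (Filter.Eventually.of_forall fun x => ?_) hint2
    (Filter.Eventually.of_forall e3)).trans (le_of_eq ?_)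
  · exact smul_nonneg (gaussianPDFReal_nonneg _ _ _)
      (Set.indicator_nonneg (fun _ _ => zero_le_one) _)
  · rw [integral_indicator hs, setIntegral_const, smul_eq_mul, Measure.real, Real.volume_Icc,
      ENNReal.toReal_ofReal (by nlinarith)]
    field_simp
    ring

end Gaussian

/-! ### Moments of a branch unit and of a branch block -/

section Neuron

variable {p d q : ℕ}

/-- The law of one branch neuron `(w̃, ã)`. -/
noncomputable def unitLaw (q : ℕ) : Measure (EuclideanSpace ℝ (Fin q) × ℝ) :=
  (stdGaussian (EuclideanSpace ℝ (Fin q))).prod signLaw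

instance : IsProbabilityMeasure (unitLaw q) := by unfold unitLaw; infer_instance

/-- The law of the `r`-th block `(w_r, (w̃_{rk}, ã_{rk})_k)`. -/
noncomputable def blockLaw (p d q : ℕ) :
    Measure (EuclideanSpace ℝ (Fin d) × (Fin p → EuclideanSpace ℝ (Fin q) × ℝ)) :=
  (stdGaussian (EuclideanSpace ℝ (Fin d))).prod (Measure.pi fun _ => unitLaw q)

instance : IsProbabilityMeasure (blockLaw p d q) := by unfold blockLaw; infer_instance

/-- Output of a branch neuron. -/
noncomputable def unitOut (u : EuclideanSpace ℝ (Fin q)) (x : EuclideanSpace ℝ (Fin q) × ℝ) : ℝ :=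
  x.2 * relu (inner ℝ x.1 u)

/-- Output of a branch block. -/
noncomputable def blockOut (u : EuclideanSpace ℝ (Fin q))
    (x : Fin p → EuclideanSpace ℝ (Fin q) × ℝ) : ℝ :=
  (1 / √(p : ℝ)) * ∑ k, unitOut u (x k)

lemma measurable_relu_inner (u : EuclideanSpace ℝ (Fin q)) :
    Measurable fun w : EuclideanSpace ℝ (Fin q) => relu (inner ℝ w u) :=
  measurable_relu.comp (by fun_prop)

lemma measurable_step_inner (u : EuclideanSpace ℝ (Fin q)) :
    Measurable fun w : EuclideanSpace ℝ (Fin q) => step (inner ℝ w u) :=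
  measurable_step.comp (by fun_prop)

lemma measurable_unitOut (u : EuclideanSpace ℝ (Fin q)) : Measurable (unitOut u) :=
  measurable_snd.mul ((measurable_relu_inner u).comp measurable_fst)

lemma measurable_blockOut (u : EuclideanSpace ℝ (Fin q)) :
    Measurable (blockOut (p := p) u) :=
  (Finset.measurable_sum _ fun k _ => (measurable_unitOut u).comp (measurable_pi_apply k)).const_mul _

lemma ae_unitLaw : ∀ᵐ x ∂unitLaw q, x.2 ^ 2 = 1 :=
  (measurePreserving_snd (μ := stdGaussian (EuclideanSpace ℝ (Fin q)))
    (ν := signLaw)).quasiMeasurePreserving.ae ae_signLaw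

/-- Averaging over the sign replaces the exponential by `cosh (t * relu x)`, and `cosh` is even and
increasing in the modulus, so it is dominated by `cosh (t * x)`. The Gaussian moment generating
function then applies, although `relu` by itself is not centred. -/
lemma hasSubgaussianMGF_unitOut (u : EuclideanSpace ℝ (Fin q)) :
    HasSubgaussianMGF (unitOut u) (‖u‖ ^ 2).toNNReal (unitLaw q) := by
  have hg := hasSubgaussianMGF_inner u
  have hcosh : ∀ t, Integrable (fun w : EuclideanSpace ℝ (Fin q) =>
      (Real.exp (t * inner ℝ w u) + Real.exp (-t * inner ℝ w u)))
      (stdGaussian (EuclideanSpace ℝ (Fin q))) := fun t =>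
    (hg.integrable_exp_mul t).add (hg.integrable_exp_mul (-t))
  have hpt : ∀ (t x : ℝ), Real.exp (t * relu x) + Real.exp (-(t * relu x)) ≤
      Real.exp (t * x) + Real.exp (-t * x) := fun t x => by
    have h : Real.cosh (t * relu x) ≤ Real.cosh (t * x) := by
      rw [Real.cosh_le_cosh, abs_mul, abs_mul]
      exact mul_le_mul_of_nonneg_left (abs_relu_le x) (abs_nonneg t)
    rw [Real.cosh_eq, Real.cosh_eq] at h
    rw [neg_mul]
    linarith
  have hint : ∀ t, Integrable (fun x => Real.exp (t * unitOut u x)) (unitLaw q) := fun t => by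
    have h1 : Integrable (fun x : EuclideanSpace ℝ (Fin q) × ℝ =>
        (Real.exp (t * inner ℝ x.1 u) + Real.exp (-t * inner ℝ x.1 u))) (unitLaw q) :=
      (hcosh t).comp_fst signLaw
    refine h1.mono ((measurable_unitOut u).const_mul t).exp.aestronglyMeasurable ?_
    filter_upwards [ae_unitLaw] with x hx
    rw [Real.norm_of_nonneg (Real.exp_pos _).le, Real.norm_of_nonneg (by positivity)]
    refine le_trans ?_ (hpt t (inner ℝ x.1 u))
    have hp := Real.exp_pos (t * relu (inner ℝ x.1 u))
    have hn := Real.exp_pos (-(t * relu (inner ℝ x.1 u)))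
    rcases (sq_eq_one_iff.mp hx) with h | h <;> rw [unitOut, h]
    · rw [one_mul]; linarith
    · rw [neg_one_mul, mul_neg]; linarith
  refine ⟨hint, fun t => ?_⟩
  rw [mgf, unitLaw, integral_prod _ (hint t)]
  simp only [unitOut]
  simp_rw [integral_signLaw]
  have hhalf : ∫ w : EuclideanSpace ℝ (Fin q), (Real.exp (t * inner ℝ w u) +
      Real.exp (-t * inner ℝ w u)) / 2 ∂(stdGaussian (EuclideanSpace ℝ (Fin q))) ≤
      Real.exp ((‖u‖ ^ 2).toNNReal * t ^ 2 / 2) := by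
    rw [integral_div, integral_add (hg.integrable_exp_mul t) (hg.integrable_exp_mul (-t))]
    have h1 := hg.mgf_le t
    have h2 := hg.mgf_le (-t)
    rw [mgf] at h1 h2
    rw [neg_sq] at h2
    linarith
  refine (integral_mono_of_nonneg (Filter.Eventually.of_forall fun w => by positivity)
    ((hcosh t).div_const 2) (Filter.Eventually.of_forall fun w => ?_)).trans hhalf
  have := hpt t (inner ℝ w u)
  simp only [neg_one_mul, mul_neg, one_mul]
  linarith

/-- The variance proxies of the `p` independent units add up to `p ‖u‖ ^ 2`, and the scaling `1 /
√p` cancels the `p`. -/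
lemma hasSubgaussianMGF_blockOut (hp : 0 < p) (u : EuclideanSpace ℝ (Fin q)) :
    HasSubgaussianMGF (blockOut (p := p) u) (‖u‖ ^ 2).toNNReal
      (Measure.pi fun _ : Fin p => unitLaw q) := by
  have hind : iIndepFun (fun (k : Fin p) (x : Fin p → EuclideanSpace ℝ (Fin q) × ℝ) =>
      unitOut u (x k)) (Measure.pi fun _ : Fin p => unitLaw q) :=
    iIndepFun_pi fun k => (measurable_unitOut u).aemeasurable
  have hk : ∀ k : Fin p, HasSubgaussianMGF (fun x : Fin p → EuclideanSpace ℝ (Fin q) × ℝ =>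
      unitOut u (x k)) (‖u‖ ^ 2).toNNReal (Measure.pi fun _ : Fin p => unitLaw q) := fun k => by
    have h := hasSubgaussianMGF_unitOut u
    have hmp := measurePreserving_eval (fun _ : Fin p => unitLaw q) k
    refine ⟨fun t => hmp.integrable_comp_of_integrable (h.integrable_exp_mul t), fun t => ?_⟩
    rw [mgf, integral_comp_eval (μ := fun _ : Fin p => unitLaw q)
      (f := fun x => Real.exp (t * unitOut u x))
      ((measurable_unitOut u).const_mul t).exp.aestronglyMeasurable]
    exact h.mgf_le t
  have h := (HasSubgaussianMGF.sum_of_iIndepFun hind (s := Finset.univ) fun k _ => hk k).const_mul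
    (1 / √(p : ℝ))
  have hp' : (p : ℝ) ≠ 0 := by exact_mod_cast hp.ne'
  refine ⟨h.integrable_exp_mul, fun t => (h.mgf_le t).trans_eq ?_⟩
  congr 3
  change (1 / √(p : ℝ)) ^ 2 * ((∑ _k : Fin p, (‖u‖ ^ 2).toNNReal : NNReal) : ℝ) = _
  rw [Finset.sum_const, Finset.card_univ, Fintype.card_fin, nsmul_eq_mul, NNReal.coe_mul,
    NNReal.coe_natCast, ← mul_assoc, div_pow, one_pow, Real.sq_sqrt (Nat.cast_nonneg _),
    one_div_mul_cancel hp', one_mul]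

lemma sqExp_blockOut (hp : 0 < p) {u : EuclideanSpace ℝ (Fin q)} {M : ℝ} (hM : 0 < M)
    (hu : ‖u‖ ≤ M) : SqExp (blockOut (p := p) u) M (Measure.pi fun _ : Fin p => unitLaw q) :=
  sqExp_of_hasSubgaussianMGF (measurable_blockOut u) (hasSubgaussianMGF_blockOut hp u) hM (by
    rw [Real.coe_toNNReal _ (sq_nonneg _)]; gcongr)

lemma integral_unitOut (u : EuclideanSpace ℝ (Fin q)) : ∫ x, unitOut u x ∂unitLaw q = 0 := by
  have h := integral_prod_mul (μ := stdGaussian (EuclideanSpace ℝ (Fin q))) (ν := signLaw)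
    (fun w => relu (inner ℝ w u)) (fun a => a)
  simp only [unitOut, unitLaw, mul_comm _ (relu _)]
  rw [h, integral_signLaw]
  simp

lemma memLp_unitOut (u : EuclideanSpace ℝ (Fin q)) : MemLp (unitOut u) 2 (unitLaw q) :=
  (hasSubgaussianMGF_unitOut u).memLp 2

lemma integral_unitOut_mul (u u' : EuclideanSpace ℝ (Fin q)) :
    ∫ x, unitOut u x * unitOut u' x ∂unitLaw q =
      ∫ w, relu (inner ℝ w u) * relu (inner ℝ w u') ∂stdGaussian (EuclideanSpace ℝ (Fin q)) := by
  have h := integral_prod_mul (μ := stdGaussian (EuclideanSpace ℝ (Fin q))) (ν := signLaw)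
    (fun w => relu (inner ℝ w u) * relu (inner ℝ w u')) (fun a => a * a)
  have e : ∀ x, unitOut u x * unitOut u' x =
      relu (inner ℝ x.1 u) * relu (inner ℝ x.1 u') * (x.2 * x.2) := fun x => by
    unfold unitOut; ring
  simp_rw [e]
  rw [unitLaw, h, integral_signLaw]
  norm_num

lemma integral_blockOut (u : EuclideanSpace ℝ (Fin q)) :
    ∫ x, blockOut u x ∂(Measure.pi fun _ : Fin p => unitLaw q) = 0 := by
  simp only [blockOut]
  have hi : ∀ k : Fin p, Integrable (fun x : Fin p → EuclideanSpace ℝ (Fin q) × ℝ =>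
      unitOut u (x k)) (Measure.pi fun _ : Fin p => unitLaw q) := fun k =>
    (measurePreserving_eval (fun _ : Fin p => unitLaw q) k).integrable_comp_of_integrable
      ((memLp_unitOut u).integrable (by norm_num))
  rw [integral_const_mul, integral_finsetSum _ fun k _ => hi k]
  have : ∀ k : Fin p, ∫ x, unitOut u (x k) ∂(Measure.pi fun _ : Fin p => unitLaw q) = 0 :=
    fun k => by
      rw [integral_comp_eval (μ := fun _ : Fin p => unitLaw q)
        (measurable_unitOut u).aestronglyMeasurable, integral_unitOut]
  simp [this]

/-- Distinct units are independent and centred, so only the `p` diagonal terms remain. The mean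
therefore equals the limiting kernel entry exactly, for every `p > 0`. -/
lemma integral_blockOut_mul (hp : 0 < p) (u u' : EuclideanSpace ℝ (Fin q)) :
    ∫ x, blockOut u x * blockOut u' x ∂(Measure.pi fun _ : Fin p => unitLaw q) =
      ∫ w, relu (inner ℝ w u) * relu (inner ℝ w u') ∂stdGaussian (EuclideanSpace ℝ (Fin q)) := by
  set P := Measure.pi fun _ : Fin p => unitLaw q with hP
  have hL : ∀ (u : EuclideanSpace ℝ (Fin q)) (k : Fin p),
      MemLp (fun x : Fin p → EuclideanSpace ℝ (Fin q) × ℝ => unitOut u (x k)) 2 P := fun u k =>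
    (memLp_unitOut u).comp_measurePreserving (measurePreserving_eval (fun _ : Fin p => unitLaw q) k)
  have hkl : ∀ k l : Fin p, ∫ x, unitOut u (x k) * unitOut u' (x l) ∂P =
      if k = l then ∫ w, relu (inner ℝ w u) * relu (inner ℝ w u')
        ∂stdGaussian (EuclideanSpace ℝ (Fin q)) else 0 := fun k l => by
    split_ifs with h
    · subst h
      rw [hP, integral_comp_eval (μ := fun _ : Fin p => unitLaw q)
        (f := fun x => unitOut u x * unitOut u' x)
        ((measurable_unitOut u).mul (measurable_unitOut u')).aestronglyMeasurable,
        integral_unitOut_mul]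
    · have hind : IndepFun (fun x : Fin p → EuclideanSpace ℝ (Fin q) × ℝ => x k)
          (fun x => x l) P :=
        (iIndepFun_pi (μ := fun _ : Fin p => unitLaw q) (X := fun _ x => x)
          fun _ => aemeasurable_id).indepFun h
      have hind2 := hind.comp (measurable_unitOut u) (measurable_unitOut u')
      have h3 := hind2.integral_fun_mul_eq_mul_integral (hL u k).1 (hL u' l).1
      simp only [Function.comp_apply] at h3
      rw [h3, hP, integral_comp_eval (μ := fun _ : Fin p => unitLaw q)
        (measurable_unitOut u).aestronglyMeasurable, integral_unitOut, zero_mul]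
  have e : ∀ x : Fin p → EuclideanSpace ℝ (Fin q) × ℝ, blockOut u x * blockOut u' x =
      (1 / (p : ℝ)) * ∑ k, ∑ l, unitOut u (x k) * unitOut u' (x l) := fun x => by
    rw [← Finset.sum_mul_sum, blockOut, blockOut]
    have hsp : (1 : ℝ) / p = 1 / √(p : ℝ) * (1 / √(p : ℝ)) := by
      rw [div_mul_div_comm, one_mul, Real.mul_self_sqrt (Nat.cast_nonneg _)]
    rw [hsp]; ring
  have hi : ∀ k l, Integrable (fun x : Fin p → EuclideanSpace ℝ (Fin q) × ℝ =>
      unitOut u (x k) * unitOut u' (x l)) P := fun k l => (hL u k).integrable_mul (hL u' l)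
  simp_rw [e]
  rw [integral_const_mul, integral_finsetSum _ fun k _ => integrable_finsetSum _ fun l _ => hi k l]
  simp_rw [integral_finsetSum _ fun l _ => hi _ l, hkl]
  have hp' : (p : ℝ) ≠ 0 := by exact_mod_cast hp.ne'
  simp only [Finset.sum_ite_eq, Finset.mem_univ, if_true, Finset.sum_const, Finset.card_univ,
    Fintype.card_fin, nsmul_eq_mul]
  rw [← mul_assoc, one_div_mul_cancel hp', one_mul]

end Neuron

/-! ### Tail bounds for each property of the initialization -/

section Initialization

variable {m p d q n₁ n₂ : ℕ}

/-- Regroup the weights and signs of independent blocks into a full network. -/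
def assemble (x : Fin m → EuclideanSpace ℝ (Fin d) × (Fin p → EuclideanSpace ℝ (Fin q) × ℝ)) :
    Weights m p d q × Signs m p :=
  ((fun r => (x r).1, fun r k => ((x r).2 k).1), fun r k => ((x r).2 k).2)

/-- The initial law is grouped by kind of parameter, whereas concentration needs `m` i.i.d. blocks.
Regrouping the coordinates of a product measure passes from one to the other. -/
lemma measurePreserving_assemble :
    MeasurePreserving (assemble (m := m) (p := p) (d := d) (q := q))
      (Measure.pi fun _ => blockLaw p d q) (initLaw m p d q) := by
  have h1 := measurePreserving_arrowProdEquivProdArrow (EuclideanSpace ℝ (Fin d))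
    (Fin p → EuclideanSpace ℝ (Fin q) × ℝ) (Fin m)
    (fun _ => stdGaussian (EuclideanSpace ℝ (Fin d)))
    (fun _ => Measure.pi fun _ => unitLaw q)
  have h2 := measurePreserving_pi (fun _ : Fin m => Measure.pi fun _ : Fin p => unitLaw q) _
    (fun _ => measurePreserving_arrowProdEquivProdArrow (EuclideanSpace ℝ (Fin q)) ℝ (Fin p)
      (fun _ => stdGaussian (EuclideanSpace ℝ (Fin q))) (fun _ => signLaw))
  have h3 := measurePreserving_arrowProdEquivProdArrow (Fin p → EuclideanSpace ℝ (Fin q))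
    (Fin p → ℝ) (Fin m)
    (fun _ => Measure.pi fun _ => stdGaussian (EuclideanSpace ℝ (Fin q)))
    (fun _ => Measure.pi fun _ => signLaw)
  have h4 := (measurePreserving_prodAssoc
    (Measure.pi fun _ : Fin m => stdGaussian (EuclideanSpace ℝ (Fin d)))
    (Measure.pi fun _ : Fin m => Measure.pi fun _ : Fin p =>
      stdGaussian (EuclideanSpace ℝ (Fin q)))
    (Measure.pi fun _ : Fin m => Measure.pi fun _ : Fin p => signLaw)).symm
  exact h4.comp (((MeasurePreserving.id _).prod (h3.comp h2)).comp h1)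

lemma measurePreserving_snd_block :
    MeasurePreserving Prod.snd (blockLaw p d q) (Measure.pi fun _ => unitLaw q) :=
  measurePreserving_snd

lemma measurePreserving_fst_block :
    MeasurePreserving Prod.fst (blockLaw p d q) (stdGaussian (EuclideanSpace ℝ (Fin d))) :=
  measurePreserving_fst

lemma measurePreserving_unit (k : Fin p) :
    MeasurePreserving (fun b : EuclideanSpace ℝ (Fin d) × (Fin p → EuclideanSpace ℝ (Fin q) × ℝ) =>
      b.2 k) (blockLaw p d q) (unitLaw q) :=
  (measurePreserving_eval (fun _ : Fin p => unitLaw q) k).comp measurePreserving_snd_block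

lemma ae_sign_sq : ∀ᵐ x ∂(Measure.pi fun _ : Fin m => blockLaw p d q),
    ∀ r k, (assemble x).2 r k ^ 2 = 1 := by
  rw [ae_all_iff]
  intro r
  rw [ae_all_iff]
  intro k
  exact ((measurePreserving_unit (d := d) k).comp
    (measurePreserving_eval (fun _ : Fin m => blockLaw p d q) r)).quasiMeasurePreserving.ae
    ae_unitLaw

lemma measure_iUnion_le_card_mul {Ω ι : Type*} [MeasurableSpace Ω] {P : Measure Ω} [Fintype ι]
    {S : ι → Set Ω} {c : ℝ} (h : ∀ i, P (S i) ≤ ENNReal.ofReal c) :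
    P (⋃ i, S i) ≤ ENNReal.ofReal (Fintype.card ι * c) := by
  refine (measure_iUnion_fintype_le _ _).trans ((Finset.sum_le_sum fun i _ => h i).trans ?_)
  rw [Finset.sum_const, Finset.card_univ, nsmul_eq_mul, ENNReal.ofReal_mul (Nat.cast_nonneg _),
    ENNReal.ofReal_natCast]

variable {M B R ε : ℝ}

lemma measure_blockOut_gt_le (hp : 0 < p) (hM : 0 < M) (hB : 0 ≤ B)
    {u : EuclideanSpace ℝ (Fin q)} (hu : ‖u‖ ≤ M) (r : Fin m) :
    (Measure.pi fun _ : Fin m => blockLaw p d q) {x | B < |blockOut u (x r).2|} ≤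
      ENNReal.ofReal (2 * Real.exp (-(B ^ 2 / (4 * M ^ 2)))) := by
  have h := ((sqExp_blockOut hp hM hu).comp_measurePreserving
    (measurePreserving_snd_block (d := d))).comp_measurePreserving
    (measurePreserving_eval (fun _ : Fin m => blockLaw p d q) r)
  refine (h.measure_abs_gt_le hM hB).trans_eq ?_
  rw [ENNReal.ofReal_mul (by norm_num)]; simp

lemma measure_inner_gt_le (hM : 0 < M) (hB : 0 ≤ B)
    {y : EuclideanSpace ℝ (Fin d)} (hy : ‖y‖ ≤ M) (r : Fin m) :
    (Measure.pi fun _ : Fin m => blockLaw p d q) {x | B < |inner ℝ (x r).1 y|} ≤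
      ENNReal.ofReal (2 * Real.exp (-(B ^ 2 / (4 * M ^ 2)))) := by
  have h := ((sqExp_inner hM hy).comp_measurePreserving
    (measurePreserving_fst_block (p := p) (q := q))).comp_measurePreserving
    (measurePreserving_eval (fun _ : Fin m => blockLaw p d q) r)
  refine (h.measure_abs_gt_le hM hB).trans_eq ?_
  rw [ENNReal.ofReal_mul (by norm_num)]; simp

lemma measure_near_trunk_gt_le (hR : 0 ≤ R) (hR1 : R ≤ 1)
    {y : EuclideanSpace ℝ (Fin d)} (hy : y ≠ 0) :
    (Measure.pi fun _ : Fin m => blockLaw p d q) {x | 2 * R * m < ∑ r, near R y (x r).1} ≤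
      ENNReal.ofReal (Real.exp (-(m * R ^ 2 / 96))) := by
  have hm : Measurable fun b : EuclideanSpace ℝ (Fin d) × (Fin p → EuclideanSpace ℝ (Fin q) × ℝ) =>
      near R y b.1 := (measurable_near R y).comp measurable_fst
  have hs : SubExp (fun b : EuclideanSpace ℝ (Fin d) × (Fin p → EuclideanSpace ℝ (Fin q) × ℝ) =>
      near R y b.1) 1 (blockLaw p d q) := SubExp.of_abs_le_one hm fun b => by
    rw [abs_of_nonneg (near_nonneg _ _ _)]; exact near_le_one _ _ _
  have hi : ∫ b, near R y b.1 ∂(blockLaw p d q) ≤ R := by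
    rw [← integral_map measurePreserving_fst_block.aemeasurable
      (measurable_near R y).aestronglyMeasurable, measurePreserving_fst_block.map_eq]
    exact integral_near_le hy hR
  refine (measure_mono fun x hx => ?_).trans ((hs.measure_sum_ge_le one_pos m hR
    (by linarith)).trans_eq (by norm_num))
  have hx' : 2 * R * m < ∑ r, near R y (x r).1 := hx
  have := mul_le_mul_of_nonneg_left hi (Nat.cast_nonneg (α := ℝ) m)
  simp only [Set.mem_ofPred_eq]
  linarith

/-- The average over `k` within a block again lies in `[0, 1]` and has mean at most `R`, so
concentration over `r` alone suffices. -/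
lemma measure_near_branch_gt_le (hp : 0 < p) (hR : 0 ≤ R) (hR1 : R ≤ 1)
    {u : EuclideanSpace ℝ (Fin q)} (hu : u ≠ 0) :
    (Measure.pi fun _ : Fin m => blockLaw p d q)
      {x | 2 * R * m < ∑ r, (1 / (p : ℝ)) * ∑ k, near R u ((x r).2 k).1} ≤
      ENNReal.ofReal (Real.exp (-(m * R ^ 2 / 96))) := by
  have hp' : (p : ℝ) ≠ 0 := by exact_mod_cast hp.ne'
  have hmk : ∀ k, Measurable
      fun b : EuclideanSpace ℝ (Fin d) × (Fin p → EuclideanSpace ℝ (Fin q) × ℝ) =>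
      near R u (b.2 k).1 := fun k =>
    (measurable_near R u).comp (measurable_fst.comp ((measurable_pi_apply k).comp measurable_snd))
  have hm := (Finset.univ.measurable_sum fun k _ => hmk k).const_mul (1 / (p : ℝ))
  have hs : SubExp (fun b : EuclideanSpace ℝ (Fin d) × (Fin p → EuclideanSpace ℝ (Fin q) × ℝ) =>
      (1 / (p : ℝ)) * ∑ k, near R u (b.2 k).1) 1 (blockLaw p d q) :=
    SubExp.of_abs_le_one hm fun b => by
      rw [abs_of_nonneg (mul_nonneg (by positivity)
        (Finset.sum_nonneg fun _ _ => near_nonneg _ _ _))]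
      calc _ ≤ (1 / (p : ℝ)) * ∑ _k : Fin p, (1 : ℝ) := by
            gcongr; exact near_le_one _ _ _
        _ = 1 := by simp [hp']
  have hik : ∀ k, ∫ b, near R u (b.2 k).1 ∂(blockLaw p d q) ≤ R := fun k => by
    have hmp := (measurePreserving_fst (μ := stdGaussian (EuclideanSpace ℝ (Fin q)))
      (ν := signLaw)).comp (measurePreserving_unit (d := d) k)
    have := integral_map hmp.aemeasurable (measurable_near R u).aestronglyMeasurable
    rw [hmp.map_eq] at this
    exact this.symm.trans_le (integral_near_le hu hR)
  have hint : ∀ k, Integrable (fun b => near R u (b.2 k).1) (blockLaw p d q) := fun k =>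
    (SubExp.of_abs_le_one (hmk k) fun b => by
      rw [abs_of_nonneg (near_nonneg _ _ _)]; exact near_le_one _ _ _).integrable one_pos
  have hi : ∫ b, (1 / (p : ℝ)) * ∑ k, near R u (b.2 k).1 ∂(blockLaw p d q) ≤ R := by
    rw [integral_const_mul, integral_finsetSum _ fun k _ => hint k]
    calc _ ≤ (1 / (p : ℝ)) * ∑ _k : Fin p, R := by gcongr; exact hik _
      _ = R := by simp; field_simp
  refine (measure_mono fun x hx => ?_).trans ((hs.measure_sum_ge_le one_pos m hR
    (by linarith)).trans_eq (by norm_num))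
  have hx' : 2 * R * m < ∑ r, (1 / (p : ℝ)) * ∑ k, near R u ((x r).2 k).1 := hx
  have := mul_le_mul_of_nonneg_left hi (Nat.cast_nonneg (α := ℝ) m)
  simp only [Set.mem_ofPred_eq]
  linarith

lemma abs_inner_le_sq {E : Type*} [NormedAddCommGroup E] [InnerProductSpace ℝ E] {v v' : E}
    (hv : ‖v‖ ≤ M) (hv' : ‖v'‖ ≤ M) : |inner ℝ v v'| ≤ M ^ 2 :=
  (abs_real_inner_le_norm _ _).trans (by
    rw [sq]; exact mul_le_mul hv hv' (norm_nonneg _) ((norm_nonneg _).trans hv))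

lemma measure_kerTrunk_gt_le (hm : 0 < m) (hp : 0 < p) (hM : 1 ≤ M) (hε : 0 ≤ ε)
    (hε1 : ε ≤ 24 * (4 * M ^ 4))
    {u : Fin n₁ → EuclideanSpace ℝ (Fin q)} {y : Fin n₂ → EuclideanSpace ℝ (Fin d)}
    (hu : ∀ i, ‖u i‖ ≤ M) (hy : ∀ j, ‖y j‖ ≤ M) (i i' : Fin n₁) (j j' : Fin n₂) :
    (Measure.pi fun _ : Fin m => blockLaw p d q)
      {x | ε < |kerTrunk (assemble x).2 (assemble x).1 (u i) (u i') (y j) (y j') -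
        Hinf u y (i, j) (i', j')|} ≤
      ENNReal.ofReal (2 * Real.exp (-(m * ε ^ 2 / (96 * (4 * M ^ 4) ^ 2)))) := by
  have hM0 : 0 < M := by linarith
  set f : EuclideanSpace ℝ (Fin d) × (Fin p → EuclideanSpace ℝ (Fin q) × ℝ) → ℝ := fun b =>
    blockOut (u i) b.2 * blockOut (u i') b.2 *
      (inner ℝ (y j) (y j') * (step (inner ℝ b.1 (y j)) * step (inner ℝ b.1 (y j')))) with hf
  have hmeas : Measurable f :=
    (((measurable_blockOut _).comp measurable_snd).mul
      ((measurable_blockOut _).comp measurable_snd)).mul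
      ((((measurable_step_inner _).comp measurable_fst).mul
        ((measurable_step_inner _).comp measurable_fst)).const_mul _)
  have hs : SubExp f (4 * M ^ 4) (blockLaw p d q) :=
    ((sqExp_blockOut hp hM0 (hu i)).comp_measurePreserving measurePreserving_snd_block).subExp
      ((sqExp_blockOut hp hM0 (hu i')).comp_measurePreserving measurePreserving_snd_block) hM hmeas
      fun b => by
        rw [hf, abs_mul, abs_mul, abs_mul (inner ℝ (y j) (y j')), abs_mul (step _), mul_comm]
        gcongr
        calc _ ≤ M ^ 2 * (1 * 1) := by
              gcongr
              · exact abs_inner_le_sq (hy j) (hy j')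
              · exact abs_step_le_one _
              · exact abs_step_le_one _
          _ = _ := by ring
  have hi : ∫ b, f b ∂(blockLaw p d q) = Hinf u y (i, j) (i', j') := by
    have h := integral_prod_mul (μ := stdGaussian (EuclideanSpace ℝ (Fin d)))
      (ν := Measure.pi fun _ : Fin p => unitLaw q)
      (fun w => inner ℝ (y j) (y j') * (step (inner ℝ w (y j)) * step (inner ℝ w (y j'))))
      (fun b => blockOut (u i) b * blockOut (u i') b)
    rw [integral_blockOut_mul hp] at h
    simp only [hf, mul_comm (blockOut (u i) _ * _)]
    rw [blockLaw, h, mul_comm]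
    rfl
  have h := hs.measure_abs_mean_sub_gt_le (by positivity) hm hε hε1
  rw [hi] at h
  refine h.trans_eq ?_
  rw [ENNReal.ofReal_mul (by norm_num)]; simp

lemma measure_kerBranch_gt_le (hm : 0 < m) (hp : 0 < p) (hM : 1 ≤ M) (hε : 0 ≤ ε)
    (hε1 : ε ≤ 24 * (4 * M ^ 4))
    {u : Fin n₁ → EuclideanSpace ℝ (Fin q)} {y : Fin n₂ → EuclideanSpace ℝ (Fin d)}
    (hu : ∀ i, ‖u i‖ ≤ M) (hy : ∀ j, ‖y j‖ ≤ M) (i i' : Fin n₁) (j j' : Fin n₂) :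
    (Measure.pi fun _ : Fin m => blockLaw p d q)
      {x | ε < |kerBranch (assemble x).1 (u i) (u i') (y j) (y j') -
        Htinf u y (i, j) (i', j')|} ≤
      ENNReal.ofReal (2 * Real.exp (-(m * ε ^ 2 / (96 * (4 * M ^ 4) ^ 2)))) := by
  have hM0 : 0 < M := by linarith
  have hp' : (p : ℝ) ≠ 0 := by exact_mod_cast hp.ne'
  set g : Fin p → EuclideanSpace ℝ (Fin d) × (Fin p → EuclideanSpace ℝ (Fin q) × ℝ) → ℝ :=
    fun k b => inner ℝ (u i) (u i') * (step (inner ℝ (b.2 k).1 (u i)) *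
      step (inner ℝ (b.2 k).1 (u i'))) * (relu (inner ℝ b.1 (y j)) * relu (inner ℝ b.1 (y j')))
    with hg
  have hgmeas : ∀ k, Measurable (g k) := fun k =>
    ((((measurable_step_inner _).comp (measurable_fst.comp
      ((measurable_pi_apply k).comp measurable_snd))).mul
      ((measurable_step_inner _).comp (measurable_fst.comp
      ((measurable_pi_apply k).comp measurable_snd)))).const_mul _).mul
      (((measurable_relu_inner _).comp measurable_fst).mul
        ((measurable_relu_inner _).comp measurable_fst))
  have hgle : ∀ k b, |g k b| ≤ M ^ 2 * (|inner ℝ b.1 (y j)| * |inner ℝ b.1 (y j')|) :=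
    fun k b => by
      rw [hg, abs_mul, abs_mul, abs_mul (step _), abs_mul (relu _)]
      refine mul_le_mul ?_ (mul_le_mul (abs_relu_le _) (abs_relu_le _) (abs_nonneg _)
        (abs_nonneg _)) (by positivity) (by positivity)
      calc _ ≤ M ^ 2 * (1 * 1) := by
            gcongr
            · exact abs_inner_le_sq (hu i) (hu i')
            · exact abs_step_le_one _
            · exact abs_step_le_one _
        _ = _ := by ring
  have hsub : ∀ {h : EuclideanSpace ℝ (Fin d) × (Fin p → EuclideanSpace ℝ (Fin q) × ℝ) → ℝ},
      Measurable h → (∀ b, |h b| ≤ M ^ 2 * (|inner ℝ b.1 (y j)| * |inner ℝ b.1 (y j')|)) →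
      SubExp h (4 * M ^ 4) (blockLaw p d q) := fun h1 h2 =>
    ((sqExp_inner hM0 (hy j)).comp_measurePreserving measurePreserving_fst_block).subExp
      ((sqExp_inner hM0 (hy j')).comp_measurePreserving measurePreserving_fst_block) hM h1 h2
  have hs : SubExp (fun b => (1 / (p : ℝ)) * ∑ k, g k b) (4 * M ^ 4) (blockLaw p d q) :=
    hsub ((Finset.univ.measurable_sum fun k _ => hgmeas k).const_mul _) fun b => by
      rw [abs_mul, abs_of_nonneg (by positivity)]
      calc _ ≤ (1 / (p : ℝ)) * ∑ _k : Fin p,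
            M ^ 2 * (|inner ℝ b.1 (y j)| * |inner ℝ b.1 (y j')|) := by
            gcongr
            exact (Finset.abs_sum_le_sum_abs _ _).trans (Finset.sum_le_sum fun k _ => hgle k b)
        _ = _ := by simp; field_simp
  have hgi : ∀ k, ∫ b, g k b ∂(blockLaw p d q) = Htinf u y (i, j) (i', j') := fun k => by
    have h := integral_prod_mul (μ := stdGaussian (EuclideanSpace ℝ (Fin d)))
      (ν := Measure.pi fun _ : Fin p => unitLaw q)
      (fun w => relu (inner ℝ w (y j)) * relu (inner ℝ w (y j')))
      (fun b => inner ℝ (u i) (u i') * (step (inner ℝ (b k).1 (u i)) *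
        step (inner ℝ (b k).1 (u i'))))
    have hms : Measurable fun w : EuclideanSpace ℝ (Fin q) =>
        inner ℝ (u i) (u i') * (step (inner ℝ w (u i)) * step (inner ℝ w (u i'))) :=
      ((measurable_step_inner _).mul (measurable_step_inner _)).const_mul _
    have hmp := (measurePreserving_fst (μ := stdGaussian (EuclideanSpace ℝ (Fin q)))
      (ν := signLaw)).comp (measurePreserving_eval (fun _ : Fin p => unitLaw q) k)
    have h2 := integral_map hmp.aemeasurable hms.aestronglyMeasurable
    rw [hmp.map_eq] at h2
    simp only [Function.comp_apply, Function.eval] at h2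
    rw [← h2] at h
    simp only [hg, mul_comm (inner ℝ (u i) (u i') * (step _ * _))]
    rw [blockLaw, h, mul_comm]
    rfl
  have hi : ∫ b, (1 / (p : ℝ)) * ∑ k, g k b ∂(blockLaw p d q) = Htinf u y (i, j) (i', j') := by
    rw [integral_const_mul, integral_finsetSum _ fun k _ =>
      (hsub (hgmeas k) (hgle k)).integrable (by positivity)]
    simp only [hgi]
    simp; field_simp
  have h := hs.measure_abs_mean_sub_gt_le (by positivity) hm hε hε1
  rw [hi] at h
  refine h.trans_eq ?_
  rw [ENNReal.ofReal_mul (by norm_num)]; simp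

/-- A block contributes a product of two independent factors, one of them centred, so `G` is `√m`
times the empirical mean of a centred sub-exponential variable. -/
lemma measure_G_gt_le (hm : 0 < m) (hp : 0 < p) (hM : 1 ≤ M) (hε : 0 ≤ ε)
    (hε1 : ε ≤ 24 * (4 * M ^ 4)) {u : EuclideanSpace ℝ (Fin q)} {y : EuclideanSpace ℝ (Fin d)}
    (hu : ‖u‖ ≤ M) (hy : ‖y‖ ≤ M) :
    (Measure.pi fun _ : Fin m => blockLaw p d q)
      {x | √(m : ℝ) * ε < |G (assemble x).2 (assemble x).1 u y|} ≤
      ENNReal.ofReal (2 * Real.exp (-(m * ε ^ 2 / (96 * (4 * M ^ 4) ^ 2)))) := by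
  have hM0 : 0 < M := by linarith
  have hm' : (0 : ℝ) < m := by exact_mod_cast hm
  set f : EuclideanSpace ℝ (Fin d) × (Fin p → EuclideanSpace ℝ (Fin q) × ℝ) → ℝ := fun b =>
    blockOut u b.2 * relu (inner ℝ b.1 y) with hf
  have hmeas : Measurable f :=
    ((measurable_blockOut _).comp measurable_snd).mul
      ((measurable_relu_inner _).comp measurable_fst)
  have hs : SubExp f (4 * M ^ 4) (blockLaw p d q) :=
    ((sqExp_blockOut hp hM0 hu).comp_measurePreserving measurePreserving_snd_block).subExp
      ((sqExp_inner hM0 hy).comp_measurePreserving measurePreserving_fst_block) hM hmeas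
      fun b => by
        rw [hf, abs_mul]
        calc _ ≤ 1 * (|blockOut u b.2| * |inner ℝ b.1 y|) := by
              rw [one_mul]
              exact mul_le_mul_of_nonneg_left (abs_relu_le _) (abs_nonneg _)
          _ ≤ _ := by gcongr; nlinarith
  have hi : ∫ b, f b ∂(blockLaw p d q) = 0 := by
    have h := integral_prod_mul (μ := stdGaussian (EuclideanSpace ℝ (Fin d)))
      (ν := Measure.pi fun _ : Fin p => unitLaw q)
      (fun w => relu (inner ℝ w y)) (fun b => blockOut u b)
    rw [integral_blockOut, mul_zero] at h
    simp only [hf, mul_comm (blockOut u _)]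
    exact h
  have h := hs.measure_abs_mean_sub_gt_le (by positivity) hm hε hε1
  rw [hi] at h
  refine le_trans (measure_mono fun x hx => ?_) (h.trans_eq (by
    rw [ENNReal.ofReal_mul (by norm_num)]; simp))
  have hx' : √(m : ℝ) * ε < |(1 / √(m : ℝ)) * ∑ r, f (x r)| := hx
  have hsm : 0 < √(m : ℝ) := Real.sqrt_pos.mpr hm'
  have e : (1 / √(m : ℝ)) * ∑ r, f (x r) = √(m : ℝ) * ((1 / (m : ℝ)) * ∑ r, f (x r) - 0) := by
    have := Real.mul_self_sqrt hm'.le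
    rw [sub_zero, ← mul_assoc]
    congr 1
    field_simp
    linarith
  rw [e, abs_mul, abs_of_pos hsm] at hx'
  exact lt_of_mul_lt_mul_left hx' hsm.le

end Initialization

/-! ### Union bound over all bad events -/

section UnionBound

variable {m p d q n₁ n₂ : ℕ} {M B R ε τ : ℝ}

/-- A random initialization is good with high probability. -/
lemma measure_not_wellInit_le (hm : 0 < m) (hp : 0 < p) (hM : 1 ≤ M) (hB : 0 ≤ B) (hR : 0 ≤ R)
    (hR1 : R ≤ 1) (hε : 0 ≤ ε) (hε1 : ε ≤ 24 * (4 * M ^ 4)) (hτ : 0 ≤ τ)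
    (hτ1 : τ ≤ 24 * (4 * M ^ 4))
    {u : Fin n₁ → EuclideanSpace ℝ (Fin q)} {y : Fin n₂ → EuclideanSpace ℝ (Fin d)}
    (hu : ∀ i, ‖u i‖ ≤ M) (hy : ∀ j, ‖y j‖ ≤ M) (hu0 : ∀ i, u i ≠ 0) (hy0 : ∀ j, y j ≠ 0) :
    (Measure.pi fun _ : Fin m => blockLaw p d q)
      {x | ¬ (WellInit (assemble x).2 u y B R ε (assemble x).1 ∧
        ∀ i j, |G (assemble x).2 (assemble x).1 (u i) (y j)| ≤ √(m : ℝ) * τ)} ≤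
      ENNReal.ofReal (n₁ * m * (2 * Real.exp (-(B ^ 2 / (4 * M ^ 2)))) +
        n₂ * m * (2 * Real.exp (-(B ^ 2 / (4 * M ^ 2)))) +
        n₂ * Real.exp (-(m * R ^ 2 / 96)) + n₁ * Real.exp (-(m * R ^ 2 / 96)) +
        n₁ * n₁ * (n₂ * n₂) * (2 * Real.exp (-(m * ε ^ 2 / (96 * (4 * M ^ 4) ^ 2)))) +
        n₁ * n₁ * (n₂ * n₂) * (2 * Real.exp (-(m * ε ^ 2 / (96 * (4 * M ^ 4) ^ 2)))) +
        n₁ * n₂ * (2 * Real.exp (-(m * τ ^ 2 / (96 * (4 * M ^ 4) ^ 2))))) := by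
  have hM0 : 0 < M := by linarith
  set P := Measure.pi fun _ : Fin m => blockLaw p d q with hP
  have a1 := measure_iUnion_le_card_mul (ι := Fin n₁ × Fin m) fun ir =>
    measure_blockOut_gt_le (d := d) hp hM0 hB (hu ir.1) ir.2
  have a2 := measure_iUnion_le_card_mul (ι := Fin n₂ × Fin m) fun jr =>
    measure_inner_gt_le (p := p) (q := q) hM0 hB (hy jr.1) jr.2
  have a3 := measure_iUnion_le_card_mul fun j =>
    measure_near_trunk_gt_le (m := m) (p := p) (q := q) hR hR1 (hy0 j)
  have a4 := measure_iUnion_le_card_mul fun i =>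
    measure_near_branch_gt_le (m := m) (d := d) hp hR hR1 (hu0 i)
  have a5 := measure_iUnion_le_card_mul (ι := (Fin n₁ × Fin n₁) × (Fin n₂ × Fin n₂)) fun k =>
    measure_kerTrunk_gt_le (m := m) hm hp hM hε hε1 hu hy k.1.1 k.1.2 k.2.1 k.2.2
  have a6 := measure_iUnion_le_card_mul (ι := (Fin n₁ × Fin n₁) × (Fin n₂ × Fin n₂)) fun k =>
    measure_kerBranch_gt_le (m := m) hm hp hM hε hε1 hu hy k.1.1 k.1.2 k.2.1 k.2.2
  have a7 := measure_iUnion_le_card_mul (ι := Fin n₁ × Fin n₂) fun k =>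
    measure_G_gt_le (m := m) hm hp hM hτ hτ1 (hu k.1) (hy k.2)
  have a0 : P {x | ¬ ∀ r k, (assemble x).2 r k ^ 2 = 1} = 0 := ae_sign_sq
  simp only [Fintype.card_prod, Fintype.card_fin, Nat.cast_mul] at a1 a2 a3 a4 a5 a6 a7
  rw [ENNReal.ofReal_add (by positivity) (by positivity),
    ENNReal.ofReal_add (by positivity) (by positivity),
    ENNReal.ofReal_add (by positivity) (by positivity),
    ENNReal.ofReal_add (by positivity) (by positivity),
    ENNReal.ofReal_add (by positivity) (by positivity),
    ENNReal.ofReal_add (by positivity) (by positivity)]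
  refine le_trans ?_ (add_le_add (add_le_add (add_le_add (add_le_add (add_le_add
    (add_le_add a1 a2) a3) a4) a5) a6) a7)
  -- The null event that some sign is not `±1` is added as an eighth event, at no cost in
  -- probability.
  rw [← zero_add (P _ + _ + _ + _ + _ + _), ← a0, ← add_assoc, ← add_assoc, ← add_assoc,
    ← add_assoc, ← add_assoc]
  refine le_trans ?_ ((measure_union_le _ _).trans (add_le_add_left ((measure_union_le _ _).trans
    (add_le_add_left ((measure_union_le _ _).trans (add_le_add_left ((measure_union_le _ _).trans
    (add_le_add_left ((measure_union_le _ _).trans (add_le_add_left ((measure_union_le _ _).trans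
    (add_le_add_left (measure_union_le _ _) _)) _)) _)) _)) _)) _))
  refine measure_mono fun x hx => ?_
  by_contra hcon
  simp only [Set.mem_union, Set.mem_iUnion, Set.mem_ofPred_eq, not_or, not_exists, not_lt,
    not_not] at hcon
  obtain ⟨⟨⟨⟨⟨⟨⟨h0, h1⟩, h2⟩, h3⟩, h4⟩, h5⟩, h6⟩, h7⟩ := hcon
  exact hx ⟨⟨h0, fun i r => h1 (i, r), fun j r => h2 (j, r), h3, h4,
    fun i i' j j' => h5 ((i, i'), (j, j')), fun i i' j j' => h6 ((i, i'), (j, j'))⟩,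
    fun i j => h7 (i, j)⟩

end UnionBound

/-! ### Upper bounds for the spectrum in terms of the data -/

section Scales

variable {n : ℕ} {e : ℕ}

lemma gramRelu_diag_le (v : Fin n → EuclideanSpace ℝ (Fin e)) (i : Fin n) :
    gramRelu v i i ≤ ‖v i‖ ^ 2 := by
  have h1 : ∫ w, (inner ℝ w (v i) : ℝ) ^ 2 ∂stdGaussian (EuclideanSpace ℝ (Fin e)) =
      ‖v i‖ ^ 2 := by
    have hv := variance_dual_stdGaussian (innerSL ℝ (v i))
    rw [variance_of_integral_eq_zero (by fun_prop) (integral_strongDual_stdGaussian _),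
      innerSL_apply_norm] at hv
    rw [← hv]
    simp [real_inner_comm]
  rw [← h1]
  refine integral_mono_of_nonneg (Filter.Eventually.of_forall fun w => mul_self_nonneg _)
    (memLp_inner (v i)).integrable_sq (Filter.Eventually.of_forall fun w => ?_)
  have := abs_relu_le (inner ℝ w (v i))
  change relu (inner ℝ w (v i)) * relu (inner ℝ w (v i)) ≤ _
  rw [← sq]
  exact sq_le_sq.mpr this

lemma gramStep_diag_le (v : Fin n → EuclideanSpace ℝ (Fin e)) (i : Fin n) :
    gramStep v i i ≤ ‖v i‖ ^ 2 := by
  have h : ∀ w : EuclideanSpace ℝ (Fin e), inner ℝ (v i) (v i) * (step (inner ℝ w (v i)) *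
      step (inner ℝ w (v i))) ≤ ‖v i‖ ^ 2 := fun w => by
    rw [real_inner_self_eq_norm_sq]
    refine mul_le_of_le_one_right (sq_nonneg _) ?_
    exact mul_le_one₀ (step_le_one _) (step_nonneg _) (step_le_one _)
  refine (integral_mono_of_nonneg (Filter.Eventually.of_forall fun w => ?_)
    (integrable_const (‖v i‖ ^ 2)) (Filter.Eventually.of_forall h)).trans_eq (by simp)
  exact mul_nonneg real_inner_self_nonneg (mul_nonneg (step_nonneg _) (step_nonneg _))

lemma gramRelu_diag_nonneg (v : Fin n → EuclideanSpace ℝ (Fin e)) (i : Fin n) :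
    0 ≤ gramRelu v i i := integral_nonneg fun _ => mul_self_nonneg _

lemma gramStep_diag_nonneg (v : Fin n → EuclideanSpace ℝ (Fin e)) (i : Fin n) :
    0 ≤ gramStep v i i := integral_nonneg fun _ =>
  mul_nonneg real_inner_self_nonneg (mul_nonneg (step_nonneg _) (step_nonneg _))

lemma leastEigenvalue_kronecker_le {n₁ n₂ : ℕ} {A : Matrix (Fin n₁) (Fin n₁) ℝ}
    {A' : Matrix (Fin n₂) (Fin n₂) ℝ} (h : (A ⊗ₖ A').IsHermitian) {a : ℝ} (i : Fin n₁)
    (j : Fin n₂) (hA : A i i ≤ a) (hA' : A' j j ≤ a) (h0 : 0 ≤ A i i) (h0' : 0 ≤ A' j j) :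
    leastEigenvalue (A ⊗ₖ A') ≤ a ^ 2 := by
  refine (leastEigenvalue_le_diag h (i, j)).trans ?_
  rw [Matrix.kroneckerMap_apply, sq]
  exact mul_le_mul hA hA' h0' (h0.trans hA)

end Scales

/-! ### Choice of `B`, `R`, `ε`, `τ` and the arithmetic of the width condition -/

section Width

/-- The two consequences of the width condition that do not involve the spectrum to the fourth
power. -/
lemma width_bounds {M n m l a b : ℝ} (hM : 1 ≤ M) (hn : 1 ≤ n) (hm : 0 < m) (hl : 0 < l)
    (hl1 : l ≤ 2 * M ^ 4) (ha : 1 / 2 ≤ a) (hb : 1 / 2 ≤ b)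
    (hw : 10 ^ 15 * M ^ 22 * (n ^ 4 * a * b ^ 3) ≤ m * l ^ 4) :
    10 ^ 14 * M ^ 14 * (n ^ 4 * a * b ^ 3) ≤ m * l ^ 2 ∧ 10 ^ 13 * (n ^ 4 * a * b ^ 3) ≤ m := by
  have hl2 : l ^ 2 ≤ 4 * M ^ 8 := by
    calc l ^ 2 ≤ (2 * M ^ 4) ^ 2 := by gcongr
      _ = _ := by ring
  have hX : 0 ≤ n ^ 4 * a * b ^ 3 := by positivity
  have h1 : 10 ^ 14 * M ^ 14 * (n ^ 4 * a * b ^ 3) ≤ m * l ^ 2 := by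
    refine le_of_mul_le_mul_right (a := 4 * M ^ 8) ?_ (by positivity)
    calc 10 ^ 14 * M ^ 14 * (n ^ 4 * a * b ^ 3) * (4 * M ^ 8)
        = 4 * 10 ^ 14 * M ^ 22 * (n ^ 4 * a * b ^ 3) := by ring
      _ ≤ 10 ^ 15 * M ^ 22 * (n ^ 4 * a * b ^ 3) := by gcongr; norm_num
      _ ≤ m * l ^ 2 * l ^ 2 := by linarith
      _ ≤ m * l ^ 2 * (4 * M ^ 8) := by gcongr
  refine ⟨h1, ?_⟩
  refine le_of_mul_le_mul_right (a := 4 * M ^ 8) ?_ (by positivity)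
  calc 10 ^ 13 * (n ^ 4 * a * b ^ 3) * (4 * M ^ 8) ≤
        10 ^ 14 * M ^ 8 * (n ^ 4 * a * b ^ 3) := by nlinarith [mul_nonneg (by positivity : 0 ≤ M ^ 8) hX]
    _ ≤ 10 ^ 14 * M ^ 14 * (n ^ 4 * a * b ^ 3) := by
        gcongr
        norm_num
    _ ≤ m * l ^ 2 := h1
    _ ≤ m * (4 * M ^ 8) := by gcongr

/-- With the width condition all scales of the argument fit together. -/
lemma width_scales {M n m l a b B R ε τ : ℝ} (hM : 1 ≤ M) (hn : 1 ≤ n) (hm : 0 < m) (hl : 0 < l)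
    (hl1 : l ≤ 2 * M ^ 4) (ha : 1 / 2 ≤ a) (hb : 1 / 2 ≤ b)
    (hw : 10 ^ 15 * M ^ 22 * (n ^ 4 * a * b ^ 3) ≤ m * l ^ 4)
    (hB : B = 4 * M * √b) (hR : R = l / (544 * n * B ^ 2 * M ^ 3)) (hε : ε = l / (32 * n))
    (hτ : τ = 4 * M ^ 4 * √(384 * a / m)) :
    n ≤ m ∧ 1 ≤ B ∧ 0 ≤ R ∧ R ≤ 1 ∧ R * M ≤ B ∧ 0 ≤ ε ∧ ε ≤ 24 * (4 * M ^ 4) ∧ 0 ≤ τ ∧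
    τ ≤ 24 * (4 * M ^ 4) ∧
    n * (2 * ε + 14 * M ^ 3 * B ^ 2 * R) + 20 * n * B ^ 2 * R * M ^ 3 ≤ l / 8 ∧
    2 * B * M * (√n / √m) * (√n * (M + √m * τ)) ≤ 3 / 8 * l * R ∧
    4 * b ≤ B ^ 2 / (4 * M ^ 2) ∧ 4 * a ≤ m * R ^ 2 / 96 ∧
    4 * a ≤ m * ε ^ 2 / (96 * (4 * M ^ 4) ^ 2) ∧ 4 * a ≤ m * τ ^ 2 / (96 * (4 * M ^ 4) ^ 2) := by
  obtain ⟨hw2, hw0⟩ := width_bounds hM hn hm hl hl1 ha hb hw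
  have hM0 : 0 < M := by linarith
  have hM4 : 0 < M ^ 4 := by positivity
  have hn0 : 0 < n := by linarith
  have hb0 : 0 < b := by linarith
  have ha0 : 0 < a := by linarith
  have hsb : √b ^ 2 = b := Real.sq_sqrt hb0.le
  have hB2 : B ^ 2 = 16 * M ^ 2 * b := by rw [hB, mul_pow, hsb]; ring
  have hsb1 : 1 / 2 ≤ √b := Real.le_sqrt_of_sq_le (by linarith)
  have hBM : 2 * M ≤ B := by
    have := mul_le_mul_of_nonneg_left hsb1 hM0.le
    rw [hB]; linarith
  have hB1 : 1 ≤ B := by linarith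
  have hB0 : 0 < B := by linarith
  have hn4 : n ≤ n ^ 4 := le_self_pow₀ hn (by norm_num)
  have hn2 : n ^ 2 ≤ n ^ 4 := pow_le_pow_right₀ hn (by norm_num)
  have hb3 : 1 / 8 ≤ b ^ 3 := by
    calc (1 / 8 : ℝ) = (1 / 2) ^ 3 := by norm_num
      _ ≤ b ^ 3 := by gcongr
  have hX : n ^ 4 * a * (1 / 8) ≤ n ^ 4 * a * b ^ 3 := by gcongr
  have hna : n ^ 4 * a ≤ m := by
    have : 0 ≤ n ^ 4 * a := by positivity
    linarith
  have hnm' : n ≤ m := by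
    have : n * (1 / 2) ≤ n ^ 4 * a := by gcongr
    have h3 : 0 ≤ n ^ 4 * a := by positivity
    linarith
  have ham : 384 * a ≤ m := by
    have : 1 * a ≤ n ^ 4 * a := by gcongr; exact one_le_pow₀ hn
    linarith
  have hR0 : 0 ≤ R := by rw [hR]; positivity
  have hR1 : R ≤ 1 := by
    rw [hR, div_le_one (by positivity)]
    calc l ≤ 2 * M ^ 4 := hl1
      _ ≤ 544 * 1 * (2 * M) ^ 2 * M ^ 3 := by
        have h45 : M ^ 4 ≤ M ^ 5 := pow_le_pow_right₀ hM (by norm_num)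
        have h5 : 544 * 1 * (2 * M) ^ 2 * M ^ 3 = 2176 * M ^ 5 := by ring
        linarith
      _ ≤ _ := by gcongr
  have hε0 : 0 ≤ ε := by rw [hε]; positivity
  have hτ0 : 0 ≤ τ := by rw [hτ]; positivity
  have hτ2 : m * τ ^ 2 = (4 * M ^ 4) ^ 2 * (384 * a) := by
    rw [hτ, mul_pow, Real.sq_sqrt (by positivity)]; field_simp
  have hnR : n * B ^ 2 * R * M ^ 3 = l / 544 := by
    rw [hR]; field_simp
  refine ⟨hnm', hB1, hR0, hR1, ?_, hε0, ?_, hτ0, ?_, ?_, ?_, ?_, ?_, ?_, ?_⟩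
  · have := mul_le_mul_of_nonneg_right hR1 hM0.le
    linarith
  · rw [hε]
    calc l / (32 * n) ≤ l := div_le_self hl.le (by linarith)
      _ ≤ _ := by linarith
  · rw [hτ]
    have : √(384 * a / m) ≤ 1 := by
      rw [Real.sqrt_le_iff, one_pow, div_le_one hm]; exact ⟨zero_le_one, ham⟩
    calc 4 * M ^ 4 * √(384 * a / m) ≤ 4 * M ^ 4 * 1 := by gcongr
      _ ≤ _ := by linarith
  -- The budget `l / 8` is split evenly: the terms in `ε` give `l / 16`, and the terms in `R` give
  -- `34 / 544 = 1 / 16` of `l`.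
  · have : n * ε = l / 32 := by rw [hε]; field_simp
    linarith
  · have hsm : 0 < √m := Real.sqrt_pos.mpr hm
    have hsn : √n * √n = n := Real.mul_self_sqrt hn0.le
    have hsa : √a ^ 2 = a := Real.sq_sqrt ha0.le
    have hsa1 : 1 / 2 ≤ √a := Real.le_sqrt_of_sq_le (by linarith)
    have hmτ : √m * τ ≤ 80 * M ^ 4 * √a := by
      have e : √(384 * a / m) = √(384 * a) / √m := Real.sqrt_div (by positivity) _
      have h384 : √(384 * a) ≤ 20 * √a := by
        rw [Real.sqrt_le_iff]
        refine ⟨by positivity, ?_⟩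
        rw [mul_pow, hsa]; linarith
      rw [hτ, e]
      calc √m * (4 * M ^ 4 * (√(384 * a) / √m)) = 4 * M ^ 4 * √(384 * a) := by field_simp
        _ ≤ 4 * M ^ 4 * (20 * √a) := by gcongr
        _ = _ := by ring
    have hMa : M ≤ 2 * M ^ 4 * √a := by
      have : M ≤ M ^ 4 := le_self_pow₀ hM (by norm_num)
      have := mul_le_mul_of_nonneg_left hsa1 hM4.le
      linarith
    have hE : M + √m * τ ≤ 84 * M ^ 4 * √a := by
      have : 0 ≤ M ^ 4 * √a := by positivity
      linarith
    -- Square root of the width condition. The displacement bound is the only one that needs its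
    -- full strength; the remaining items use the weaker consequences `hw2` and `hw0`.
    have hroot : 3 * 10 ^ 7 * (M ^ 11 * n ^ 2 * √a * √b ^ 3) ≤ √m * l ^ 2 := by
      apply le_of_sq_le_sq _ (by positivity)
      have e1 : (3 * 10 ^ 7 * (M ^ 11 * n ^ 2 * √a * √b ^ 3)) ^ 2 =
          9 * 10 ^ 14 * M ^ 22 * (n ^ 4 * √a ^ 2 * (√b ^ 2) ^ 3) := by ring
      have e2 : (√m * l ^ 2) ^ 2 = m * l ^ 4 := by
        rw [mul_pow, Real.sq_sqrt hm.le]; ring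
      rw [e1, e2, hsa, hsb]
      refine le_trans ?_ hw
      gcongr
      norm_num
    have hRe : R = l / (8704 * n * M ^ 5 * √b ^ 2) := by
      rw [hR, hB2, hsb]; congr 1; ring
    calc 2 * B * M * (√n / √m) * (√n * (M + √m * τ))
        ≤ 2 * B * M * (√n / √m) * (√n * (84 * M ^ 4 * √a)) := by gcongr
      _ = 672 * M ^ 6 * n * √a * √b / √m := by rw [hB]; linear_combination (672 * M ^ 6 * √a * √b / √m) * hsn
      _ ≤ 3 / 8 * l * R := by
        rw [hRe, mul_div_assoc', div_le_div_iff₀ hsm (by positivity)]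
        have h0 : 0 ≤ M ^ 11 * n ^ 2 * √a * √b ^ 3 := by positivity
        have e3 : 672 * M ^ 6 * n * √a * √b * (8704 * n * M ^ 5 * √b ^ 2) =
          5849088 * (M ^ 11 * n ^ 2 * √a * √b ^ 3) := by ring
        have e4 : 3 / 8 * l * l * √m = 3 / 8 * (√m * l ^ 2) := by ring
        rw [e3, e4]
        linarith
  · rw [hB2]; apply le_of_eq; field_simp; norm_num
  · rw [hR, hB2, div_pow, ← mul_div_assoc, div_div, le_div_iff₀ (by positivity)]
    have h1 : M ^ 10 * n ^ 2 * b ^ 2 * a ≤ 2 * (M ^ 14 * (n ^ 4 * a * b ^ 3)) := by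
      calc M ^ 10 * n ^ 2 * b ^ 2 * a ≤ M ^ 14 * n ^ 4 * b ^ 2 * a := by
            gcongr
            norm_num
        _ = M ^ 14 * n ^ 4 * a * (b ^ 2 * 1) := by ring
        _ ≤ M ^ 14 * n ^ 4 * a * (b ^ 2 * (2 * b)) := by gcongr; linarith
        _ = _ := by ring
    have h0 : 0 ≤ M ^ 14 * (n ^ 4 * a * b ^ 3) := by positivity
    have e3 : 4 * a * ((544 * n * (16 * M ^ 2 * b) * M ^ 3) ^ 2 * 96) =
      29091692544 * (M ^ 10 * n ^ 2 * b ^ 2 * a) := by ring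
    rw [e3]
    linarith
  · rw [hε, div_pow, ← mul_div_assoc, div_div, le_div_iff₀ (by positivity)]
    have h1 : M ^ 8 * n ^ 2 * a ≤ 8 * (M ^ 14 * (n ^ 4 * a * b ^ 3)) := by
      calc M ^ 8 * n ^ 2 * a ≤ M ^ 14 * n ^ 4 * a := by
            gcongr
            norm_num
        _ = M ^ 14 * (n ^ 4 * a * (1 / 8)) * 8 := by ring
        _ ≤ M ^ 14 * (n ^ 4 * a * b ^ 3) * 8 := by gcongr
        _ = _ := by ring
    have h0 : 0 ≤ M ^ 14 * (n ^ 4 * a * b ^ 3) := by positivity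
    have e3 : 4 * a * ((32 * n) ^ 2 * (96 * (4 * M ^ 4) ^ 2)) =
      6291456 * (M ^ 8 * n ^ 2 * a) := by ring
    rw [e3]
    linarith
  · rw [hτ2]; apply le_of_eq; field_simp; norm_num

/-- The factor `4` in the exponents makes each tail a fourth power, enough to absorb the up to
quadratic count of events and still leave a factor `δ`. -/
lemma exp_neg_four_mul_log_inv {x : ℝ} (hx : 0 < x) : Real.exp (-(4 * Real.log (1 / x))) = x ^ 4 := by
  rw [one_div, Real.log_inv, mul_neg, neg_neg, mul_comm, Real.exp_mul, Real.exp_log hx]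
  norm_cast

/-- The failure probabilities add up to at most `δ`. -/
lemma failure_sum_le {n₁ n₂ m δ x y z w : ℝ} (h1 : 1 ≤ n₁) (h2 : 1 ≤ n₂) (hnm : n₁ * n₂ ≤ m)
    (hδ : 0 < δ) (hδ1 : δ < 1)
    (hx : x ≤ (δ / (2 * m)) ^ 4) (hy : y ≤ (δ / (2 * (n₁ * n₂))) ^ 4)
    (hz : z ≤ (δ / (2 * (n₁ * n₂))) ^ 4) (hw : w ≤ (δ / (2 * (n₁ * n₂))) ^ 4) :
    n₁ * m * (2 * x) + n₂ * m * (2 * x) + n₂ * y + n₁ * y + n₁ * n₁ * (n₂ * n₂) * (2 * z) +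
      n₁ * n₁ * (n₂ * n₂) * (2 * z) + n₁ * n₂ * (2 * w) ≤ δ := by
  set n := n₁ * n₂ with hn
  have hn1 : 1 ≤ n := by rw [hn]; nlinarith
  have hm1 : 1 ≤ m := hn1.trans hnm
  have hs : n₁ + n₂ ≤ 2 * n := by rw [hn]; nlinarith
  have hs' : n₁ + n₂ ≤ 2 * m := by linarith
  set s := δ / (2 * n) with hsdef
  set t := δ / (2 * m) with htdef
  have hs0 : 0 < s := by positivity
  have ht0 : 0 < t := by positivity
  have hs1 : s ≤ 1 / 2 := by
    rw [hsdef, div_le_iff₀ (by positivity)]; linarith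
  have ht1 : t ≤ 1 / 2 := by
    rw [htdef, div_le_iff₀ (by positivity)]; linarith
  have hns : n * s = δ / 2 := by rw [hsdef]; field_simp
  have hmt : m * t = δ / 2 := by rw [htdef]; field_simp
  have hs2 : s ^ 2 ≤ 1 / 4 := by nlinarith
  have ht2 : t ^ 2 ≤ 1 / 4 := by nlinarith
  have hs3 : s ^ 3 ≤ 1 / 8 := by nlinarith
  have hδ2 : δ ^ 2 ≤ δ := by nlinarith
  have e1 : (n₁ + n₂) * (2 * m * x) ≤ δ / 4 := by
    calc (n₁ + n₂) * (2 * m * x) ≤ (n₁ + n₂) * (2 * m * t ^ 4) := by gcongr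
      _ ≤ (2 * m) * (2 * m * t ^ 4) := by gcongr
      _ = 4 * (m * t) ^ 2 * t ^ 2 := by ring
      _ = δ ^ 2 * t ^ 2 := by rw [hmt]; ring
      _ ≤ δ * (1 / 4) := by gcongr
      _ = _ := by ring
  have e2 : (n₁ + n₂) * y ≤ δ / 8 := by
    calc (n₁ + n₂) * y ≤ (n₁ + n₂) * s ^ 4 := by gcongr
      _ ≤ (2 * n) * s ^ 4 := by gcongr
      _ = 2 * (n * s) * s ^ 3 := by ring
      _ = δ * s ^ 3 := by rw [hns]; ring
      _ ≤ δ * (1 / 8) := by gcongr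
      _ = _ := by ring
  have e3 : 4 * n ^ 2 * z ≤ δ / 4 := by
    calc 4 * n ^ 2 * z ≤ 4 * n ^ 2 * s ^ 4 := by gcongr
      _ = 4 * (n * s) ^ 2 * s ^ 2 := by ring
      _ = δ ^ 2 * s ^ 2 := by rw [hns]; ring
      _ ≤ δ * (1 / 4) := by gcongr
      _ = _ := by ring
  have e4 : n * (2 * w) ≤ δ / 8 := by
    calc n * (2 * w) ≤ n * (2 * s ^ 4) := by gcongr
      _ = 2 * (n * s) * s ^ 3 := by ring
      _ = δ * s ^ 3 := by rw [hns]; ring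
      _ ≤ δ * (1 / 8) := by gcongr
      _ = _ := by ring
  have e5 : n₁ * n₁ * (n₂ * n₂) * (2 * z) + n₁ * n₁ * (n₂ * n₂) * (2 * z) = 4 * n ^ 2 * z := by
    rw [hn]; ring
  -- The four pieces add up to `δ (1/4 + 1/8 + 1/4 + 1/8) = 3 δ / 4`.
  nlinarith

end Width

end NeuralOperator

/-! ### Assembly of the main theorem -/

theorem theorem2 :
    ∃ c : ℝ, 0 < c ∧ ∀ M : ℝ, ∃ C : ℝ, 0 < C ∧
      ∀ (n₁ n₂ d q m p : ℕ), 0 < n₁ → 0 < n₂ → 0 < m → 0 < p →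
      ∀ (u : Fin n₁ → EuclideanSpace ℝ (Fin q)) (y : Fin n₂ → EuclideanSpace ℝ (Fin d))
        (z : Fin n₁ → Fin n₂ → ℝ),
        (∀ i, ‖u i‖ ≤ M) → (∀ j, ‖y j‖ ≤ M) → (∀ i j, |z i j| ≤ M) →
        NoTwoParallel u → NoTwoParallel y →
      ∀ (lam lamt δ η : ℝ), lam = leastEigenvalue (Hinf u y) → lamt = leastEigenvalue (Htinf u y) →
        0 < δ → δ < 1 →
        0 < η → η ≤ c / (specNorm (Hinf u y) + specNorm (Htinf u y)) →
        C * ((n₁ : ℝ) ^ 4 * (n₂ : ℝ) ^ 4 * Real.log (2 * (n₁ * n₂) / δ)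
              * Real.log (2 * m / δ) ^ 3)
            / ((min lam lamt) ^ 2 * (lam + lamt) ^ 2) ≤ (m : ℝ) →
        ENNReal.ofReal (1 - δ) ≤
          initLaw m p d q {ω | ∀ t : ℕ,
            sqResidual ω.2 u y z (gd ω.2 u y z η ω.1 t)
              ≤ (1 - η * ((lam + lamt) / 2)) ^ t * sqResidual ω.2 u y z ω.1} := by
  -- Replacing `M₀` by `max M₀ 1` only weakens the data bounds and permits raising powers of `M`
  -- freely.
  refine ⟨1, one_pos, fun M₀ => ⟨10 ^ 15 * (max M₀ 1) ^ 22, by positivity, ?_⟩⟩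
  intro n₁ n₂ d q m p hn₁ hn₂ hm hp u y z hu hy hz hup hyp lam lamt δ η hlam hlamt hδ hδ1 hη hηc hw
  set M := max M₀ 1 with hMdef
  have hM : 1 ≤ M := le_max_right _ _
  replace hu : ∀ i, ‖u i‖ ≤ M := fun i => (hu i).trans (le_max_left _ _)
  replace hy : ∀ j, ‖y j‖ ≤ M := fun j => (hy j).trans (le_max_left _ _)
  replace hz : ∀ i j, |z i j| ≤ M := fun i j => (hz i j).trans (le_max_left _ _)
  have : Nonempty (Fin n₁) := ⟨⟨0, hn₁⟩⟩
  have : Nonempty (Fin n₂) := ⟨⟨0, hn₂⟩⟩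
  have hH : (Hinf u y).PosDef := hup.posDef_gramRelu.kronecker hyp.posDef_gramStep
  have hHt : (Htinf u y).PosDef := hup.posDef_gramStep.kronecker hyp.posDef_gramRelu
  have hlam0 : 0 < lam := hlam ▸ leastEigenvalue_pos hH
  have hlamt0 : 0 < lamt := hlamt ▸ leastEigenvalue_pos hHt
  have hsq : ∀ {e : ℕ} (v : EuclideanSpace ℝ (Fin e)), ‖v‖ ≤ M → ‖v‖ ^ 2 ≤ M ^ 2 := fun v hv => by
    gcongr
  have hlamM : lam ≤ M ^ 4 := by
    have i : Fin n₁ := Classical.arbitrary _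
    have j : Fin n₂ := Classical.arbitrary _
    have := leastEigenvalue_kronecker_le hH.isHermitian i j
      ((gramRelu_diag_le u i).trans (hsq _ (hu i))) ((gramStep_diag_le y j).trans (hsq _ (hy j)))
      (gramRelu_diag_nonneg u i) (gramStep_diag_nonneg y j)
    rw [hlam]
    exact this.trans_eq (by ring)
  have hlamtM : lamt ≤ M ^ 4 := by
    have i : Fin n₁ := Classical.arbitrary _
    have j : Fin n₂ := Classical.arbitrary _
    have := leastEigenvalue_kronecker_le hHt.isHermitian i j
      ((gramStep_diag_le u i).trans (hsq _ (hu i))) ((gramRelu_diag_le y j).trans (hsq _ (hy j)))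
      (gramStep_diag_nonneg u i) (gramRelu_diag_nonneg y j)
    rw [hlamt]
    exact this.trans_eq (by ring)
  set l := lam + lamt with hl
  have hl0 : 0 < l := by positivity
  set N := specNorm (Hinf u y) + specNorm (Htinf u y) with hN
  have hlN : l ≤ N := by
    rw [hl, hN, hlam, hlamt]
    exact add_le_add (leastEigenvalue_le_specNorm hH.isHermitian)
      (leastEigenvalue_le_specNorm hHt.isHermitian)
  have hηN : η * N ≤ 1 := (le_div_iff₀ (hl0.trans_le hlN)).mp hηc
  have hηl : η * l ≤ 1 := (mul_le_mul_of_nonneg_left hlN hη.le).trans hηN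
  have hquad : ∀ x : EuclideanSpace ℝ (Fin n₁ × Fin n₂), l * ‖x‖ ^ 2 ≤
      inner ℝ x (Matrix.toEuclideanCLM (𝕜 := ℝ) (Hinf u y + Htinf u y) x) := fun x => by
    rw [map_add, _root_.add_apply, inner_add_right, hl, add_mul, hlam, hlamt]
    exact add_le_add (leastEigenvalue_mul_norm_sq_le hH.isHermitian x)
      (leastEigenvalue_mul_norm_sq_le hHt.isHermitian x)
  have hlin : ∀ e : EuclideanSpace ℝ (Fin n₁ × Fin n₂),
      ‖e - η • Matrix.toEuclideanCLM (𝕜 := ℝ) (Hinf u y + Htinf u y) e‖ ≤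
        (1 - η * l / 2) * ‖e‖ := fun e => by
    refine (norm_sub_smul_toEuclideanCLM_le (hH.isHermitian.add hHt.isHermitian) hquad
      (specNorm_add_le _ _) hη.le hηN hηl e).trans ?_
    -- The linear step contracts by `1 - η l`; half of the gain is given away here because the later
    -- estimates need only `1 - η l / 2`.
    gcongr
    nlinarith [mul_pos hη hl0]
  have hn₁' : (1 : ℝ) ≤ n₁ := by exact_mod_cast hn₁
  have hn₂' : (1 : ℝ) ≤ n₂ := by exact_mod_cast hn₂
  have hm' : (0 : ℝ) < m := by exact_mod_cast hm
  have hm1 : (1 : ℝ) ≤ m := by exact_mod_cast hm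
  have hn : (1 : ℝ) ≤ n₁ * n₂ := one_le_mul_of_one_le_of_one_le hn₁' hn₂'
  have hlog : ∀ x : ℝ, 1 ≤ x → 1 / 2 ≤ Real.log (2 * x / δ) := fun x hx => by
    have h2 : Real.log 2 ≤ Real.log (2 * x / δ) := by
      apply Real.log_le_log (by norm_num)
      rw [le_div_iff₀ hδ]
      nlinarith
    linarith [Real.log_two_gt_d9]
  set a := Real.log (2 * (n₁ * n₂) / δ) with ha
  set b := Real.log (2 * m / δ) with hb
  have ha2 : 1 / 2 ≤ a := hlog _ hn
  have hb2 : 1 / 2 ≤ b := hlog _ hm1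
  have hw' : 10 ^ 15 * M ^ 22 * ((n₁ * n₂ : ℝ) ^ 4 * a * b ^ 3) ≤ m * l ^ 4 := by
    rw [div_le_iff₀ (by positivity)] at hw
    calc _ = 10 ^ 15 * M ^ 22 * ((n₁ : ℝ) ^ 4 * (n₂ : ℝ) ^ 4 * a * b ^ 3) := by ring
      _ ≤ m * ((min lam lamt) ^ 2 * l ^ 2) := hw
      -- The width condition enters only through the fourth power of `l = lam + lamt`, which is
      -- weaker than the stated denominator.
      _ ≤ m * (l ^ 2 * l ^ 2) := by
        gcongr
        exact (min_le_left _ _).trans (by linarith)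
      _ = _ := by ring
  obtain ⟨hnm, hB1, hR0, hR1, hRM, hε0, hε1, hτ0, hτ1, hsmall, hmove, t1, t2, t3, t4⟩ :=
    width_scales hM hn hm' hl0 (by linarith) ha2 hb2 hw' rfl rfl rfl rfl
  set B := 4 * M * √b
  set R := l / (544 * (n₁ * n₂ : ℝ) * B ^ 2 * M ^ 3)
  set ε := l / (32 * (n₁ * n₂ : ℝ))
  set τ := 4 * M ^ 4 * √(384 * a / m)
  have hcard : (Fintype.card (Fin n₁ × Fin n₂) : ℝ) = n₁ * n₂ := by simp
  set T := {ω : Weights m p d q × Signs m p | ∀ t : ℕ,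
            sqResidual ω.2 u y z (gd ω.2 u y z η ω.1 t)
              ≤ (1 - η * (l / 2)) ^ t * sqResidual ω.2 u y z ω.1} with hT
  set P := Measure.pi fun _ : Fin m => blockLaw p d q with hP
  have hgood : ∀ x, (WellInit (assemble x).2 u y B R ε (assemble x).1 ∧
      ∀ i j, |G (assemble x).2 (assemble x).1 (u i) (y j)| ≤ √(m : ℝ) * τ) →
      assemble x ∈ T := by
    rintro x ⟨hwell, hG⟩ t
    refine hwell.gd_converges (Nat.mul_pos hn₁ hn₂) hm hp hR0 hM hB1 hu hy hRM hη hl0 hηl hlin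
      hsmall ?_ hmove t
    have := norm_le_sqrt_card_mul (e := resid (assemble x).2 u y z (assemble x).1)
      (b := M + √(m : ℝ) * τ) (fun ij => by
        rw [resid_apply]
        exact (abs_sub _ _).trans (by linarith [hG ij.1 ij.2, hz ij.1 ij.2])) (by positivity)
    rwa [hcard] at this
  have hbad : P (assemble ⁻¹' T)ᶜ ≤ ENNReal.ofReal δ := by
    have hsub : (assemble ⁻¹' T)ᶜ ⊆ {x | ¬ (WellInit (assemble x).2 u y B R ε (assemble x).1 ∧
        ∀ i j, |G (assemble x).2 (assemble x).1 (u i) (y j)| ≤ √(m : ℝ) * τ)} :=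
      fun x hx hg => hx (hgood x hg)
    refine (measure_mono hsub).trans
      ((measure_not_wellInit_le hm hp hM (by linarith) hR0 hR1 hε0 hε1 hτ0 hτ1 hu hy hup.1
        hyp.1).trans (ENNReal.ofReal_le_ofReal ?_))
    have hexp : ∀ {x v : ℝ}, 0 < x → 4 * Real.log (2 * x / δ) ≤ v →
        Real.exp (-v) ≤ (δ / (2 * x)) ^ 4 := fun {x v} hx hv => by
      rw [← exp_neg_four_mul_log_inv (by positivity : 0 < δ / (2 * x)), one_div_div]
      exact Real.exp_le_exp.mpr (neg_le_neg hv)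
    exact failure_sum_le hn₁' hn₂' hnm hδ hδ1 (hexp hm' t1) (hexp (by positivity) t2)
      (hexp (by positivity) t3) (hexp (by positivity) t4)
  -- This inequality for a pushforward holds for arbitrary sets, so measurability of the convergence
  -- event is not required; the final computation likewise uses only subadditivity.
  have hle : P (assemble ⁻¹' T) ≤ initLaw m p d q T := by
    rw [← measurePreserving_assemble.map_eq]
    exact Measure.le_map_apply measurePreserving_assemble.aemeasurable T
  refine le_trans ?_ hle
  rw [ENNReal.ofReal_sub _ hδ.le, ENNReal.ofReal_one, tsub_le_iff_right]
  calc (1 : ℝ≥0∞) = P Set.univ := by rw [hP]; simp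
    _ = P ((assemble ⁻¹' T) ∪ (assemble ⁻¹' T)ᶜ) := by rw [Set.union_compl_self]
    _ ≤ P (assemble ⁻¹' T) + P (assemble ⁻¹' T)ᶜ := measure_union_le _ _
    _ ≤ _ := by gcongr
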